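/- **Setting.** Let $\mathcal Y=\{1,\dots,l\}$ and $\mathcal Z=\mathbb R$. Let $\Omega_1\subset\mathbb R^{m_1}$ and $\Omega_2\subset\mathbb R^{m_2}$ be bounded domains (open and connected). For $\vec\varepsilon\in\Omega_1$ let $\Pi^{\vec\varepsilon}=(\pi^{\vec\varepsilon}_{ij})$ be an $l\times l$ stochastic matrix whose entries are real-analytic in $\vec\varepsilon$, with a stationary probability vector $\pi^{\vec\varepsilon}$. For $\vec\theta\in\Omega_2$ and $y\in\mathcal Y$ let $q^{\vec\theta}(\cdot|y)$ be a probability density on $\mathbb R$ such that $\vec\theta\mapsto q^{\vec\theta}(z|y)$ is real-analytic for each $(y,z)$. The stationary Markov chain with parameters $(\pi^{\vec\varepsilon},\Pi^{\vec\varepsilon})$, passed through the memoryless channel $q^{\vec\theta}$, gives the hidden Markov chain $Z$, with block densities $$p(z_{-n}^0)=\sum_{y_{-n}^0}\pi^{\vec\varepsilon}_{y_{-n}}\prod_{i=-n}^{-1}\pi^{\vec\varepsilon}_{y_iy_{i+1}}\prod_{i=-n}^0q^{\vec\theta}(z_i|y_i),$$ and with entropy rate $$H(Z)=\lim_{n\to\infty}\frac{1}{n+1}H(Z_{-n}^0),\qquad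 H(Z_{-n}^0)=-\int_{\mathbb R^{n+1}}p(z_{-n}^0)\log p(z_{-n}^0)\,dz_{-n}^0 .$$ Let $(\vec\varepsilon_0,\vec\theta_0)\in\Omega_1\times\Omega_2$. Write $B(r)$ for the ball of radius $r$ around $\vec\theta_0$ in $\mathbb C^{m_2}$, and write $q^{\vec\theta}(z|y)$ also for the complex-analytic extension in $\vec\theta$. Consider the following conditions. (a) All entries of $\Pi^{\vec\varepsilon_0}$ are positive. (b) $q^{\vec\theta_0}(z|y)>0$ for all $y,z$. (c) There is $r>0$ such that every $q^{\vec\theta}(z|y)$ is analytic in $\vec\theta$ on $B(r)$; for every $y$, $q^{\vec\theta}(z|y)$ is jointly continuous in $(z,\vec\theta)\in\mathbb R\times B(r)$; and the integrals $\int\breve q\,dz$, $\int\breve q\log\hat q\,dz$ and $\int\breve q\log\breve q\,dz$ are finite, where $$\breve q(z)=\sup_{y,\ \vec\theta\in B(r)}|q^{\vec\theta}(z|y)|,\qquad \hat q(z)=\inf_{y,\ \vec\theta\in B(r)}|q^{\vec\theta}(z|y)| .$$ (d) For some index $I$: (i) there is $r>0$ such that, for every $j$, the family of functions $\vec\theta\mapsto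 q^{\vec\theta}(z|j)/q^{\vec\theta}(z|I)$, indexed by $z\in\mathbb R$, is equicontinuous on $B(r)$; (ii) there is $r>0$ such that, for each $z$, the real function $\vec\theta\mapsto\log q^{\vec\theta}(z|I)$ extends analytically to $B(r)$, and $\int_{\mathbb R}\sup_{\vec\theta\in B(r)}|q^{\vec\theta}(z|j)\log q^{\vec\theta}(z|I)|\,dz<\infty$ for all $j$. **Theorem.** Assume (a), (b), (c) and (d), and suppose that there are constants $C',C''>0$ with $$C'\le\left|\frac{q^{\vec\theta_0}(z|j)}{q^{\vec\theta_0}(z|i)}\right|\le C''\qquad\text{for all } i,j \text{ and all } z\in\mathbb R .$$ Then $H(Z)$ exists for all real parameters near $(\vec\varepsilon_0,\vec\theta_0)$ (with all block entropies finite) and is a jointly real-analytic function of $(\vec\varepsilon,\vec\theta)$ around $(\vec\varepsilon_0,\vec\theta_0)$. This applies to the additive Cauchy channel $q(z|i)=\frac1\pi\,\frac{\gamma_i}{(z-\mu_i)^2+\gamma_i^2}$: if (a) holds, then for all $\gamma_1,\dots,\gamma_l>0$ and $\mu_1,\dots,\mu_l\in\mathbb R$, $H(Z)$ exists near, and is a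 real-analytic function of the Markov chain parameters and the channel parameters around, $(\vec\varepsilon_0,(\gamma_1,\mu_1,\dots,\gamma_l,\mu_l))$. -/

import Mathlib

open MeasureTheory Filter Topology Set
open scoped ENNReal

noncomputable section

namespace HiddenMarkov

/-- A bounded domain: a bounded, open, connected (in particular nonempty) set. -/
def IsBoundedDomain {m : ℕ} (Ω : Set (EuclideanSpace ℝ (Fin m))) : Prop :=
  IsOpen Ω ∧ IsConnected Ω ∧ Bornology.IsBounded Ω

/-- `f` is a probability density on the real line. -/
def IsProbDensity (f : ℝ → ℝ) : Prop :=
  Measurable f ∧ (∀ z, 0 ≤ f z) ∧ ∫⁻ z, ENNReal.ofReal (f z) = 1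

/-- `v` is a stationary probability vector of the stochastic matrix `P`. -/
def IsStationaryVector {l : ℕ} (P : Matrix (Fin l) (Fin l) ℝ) (v : Fin l → ℝ) : Prop :=
  v ∈ stdSimplex ℝ (Fin l) ∧ Matrix.vecMul v P = v

/-- The probability that the Markov chain with initial vector `v` and transition matrix `P`
follows the path `y 0, y 1, …, y n`. -/
def pathProb {l : ℕ} (v : Fin l → ℝ) (P : Matrix (Fin l) (Fin l) ℝ) (n : ℕ)
    (y : Fin (n + 1) → Fin l) : ℝ :=
  v (y 0) * ∏ i : Fin n, P (y i.castSucc) (y i.succ)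

/-- The joint density of `n + 1` consecutive outputs of the memoryless channel with output
densities `q y = q(· | y)`, when its input is the Markov chain `(v, P)`. -/
def blockDensity {l : ℕ} (v : Fin l → ℝ) (P : Matrix (Fin l) (Fin l) ℝ) (q : Fin l → ℝ → ℝ)
    (n : ℕ) (z : Fin (n + 1) → ℝ) : ℝ :=
  ∑ y : Fin (n + 1) → Fin l, pathProb v P n y * ∏ i, q (y i) (z i)

/-- The differential entropy of `n + 1` consecutive outputs. -/
def blockEntropy {l : ℕ} (v : Fin l → ℝ) (P : Matrix (Fin l) (Fin l) ℝ) (q : Fin l → ℝ → ℝ)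
    (n : ℕ) : ℝ :=
  -∫ z : Fin (n + 1) → ℝ, blockDensity v P q n z * Real.log (blockDensity v P q n z)

/-- The entropy rate of the hidden Markov chain is well defined: all block entropies are
finite (their integrands are integrable) and the normalized block entropies converge. -/
def HasEntropyRate {l : ℕ} (v : Fin l → ℝ) (P : Matrix (Fin l) (Fin l) ℝ)
    (q : Fin l → ℝ → ℝ) : Prop :=
  (∀ n : ℕ, Integrable (fun z : Fin (n + 1) → ℝ =>
      blockDensity v P q n z * Real.log (blockDensity v P q n z))) ∧
    ∃ h : ℝ, Tendsto (fun n : ℕ => blockEntropy v P q n / ((n : ℝ) + 1)) atTop (𝓝 h)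

/-- The entropy rate of the hidden Markov chain (meaningful under `HasEntropyRate`). -/
def entropyRate {l : ℕ} (v : Fin l → ℝ) (P : Matrix (Fin l) (Fin l) ℝ)
    (q : Fin l → ℝ → ℝ) : ℝ :=
  limUnder atTop (fun n : ℕ => blockEntropy v P q n / ((n : ℝ) + 1))

/-- The entropy rate of a parametrized family of hidden Markov chains exists near the
parameter `x₀` and is a real-analytic function of the parameter around `x₀`. -/
def EntropyRateAnalyticAt {l : ℕ} {E : Type*} [NormedAddCommGroup E] [NormedSpace ℝ E]
    (v : E → Fin l → ℝ) (P : E → Matrix (Fin l) (Fin l) ℝ) (q : E → Fin l → ℝ → ℝ)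
    (x₀ : E) : Prop :=
  (∀ᶠ x in 𝓝 x₀, HasEntropyRate (v x) (P x) (q x)) ∧
    AnalyticAt ℝ (fun x => entropyRate (v x) (P x) (q x)) x₀

/-- The inclusion of `ℝᵐ` in `ℂᵐ`. -/
def toComplex {m : ℕ} (θ : EuclideanSpace ℝ (Fin m)) : EuclideanSpace ℂ (Fin m) :=
  WithLp.toLp 2 (fun i => (θ i : ℂ))

/-- The supremum of `|q^θ(z|y)|` over `y` and over the complex `r`-ball around `θ₀`. -/
def qSup {l m : ℕ} (qc : EuclideanSpace ℂ (Fin m) → Fin l → ℝ → ℂ)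
    (θ₀ : EuclideanSpace ℝ (Fin m)) (r : ℝ) (z : ℝ) : ℝ≥0∞ :=
  ⨆ y : Fin l, ⨆ θ ∈ Metric.ball (toComplex θ₀) r, ‖qc θ y z‖ₑ

/-- The infimum of `|q^θ(z|y)|` over `y` and over the complex `r`-ball around `θ₀`. -/
def qInf {l m : ℕ} (qc : EuclideanSpace ℂ (Fin m) → Fin l → ℝ → ℂ)
    (θ₀ : EuclideanSpace ℝ (Fin m)) (r : ℝ) (z : ℝ) : ℝ≥0∞ :=
  ⨅ y : Fin l, ⨅ θ ∈ Metric.ball (toComplex θ₀) r, ‖qc θ y z‖ₑ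

/-- `qc` extends the germ at `θ₀` of each real function `θ ↦ q^θ(z|y)`. Together with
analyticity on a complex ball around `θ₀` this determines `qc` on that ball. -/
def ExtendsChannel {l m : ℕ} (q : EuclideanSpace ℝ (Fin m) → Fin l → ℝ → ℝ)
    (qc : EuclideanSpace ℂ (Fin m) → Fin l → ℝ → ℂ) (θ₀ : EuclideanSpace ℝ (Fin m)) : Prop :=
  ∀ (y : Fin l) (z : ℝ), ∀ᶠ θ in 𝓝 θ₀, qc (toComplex θ) y z = (q θ y z : ℂ)

/-- Condition (c): the complexified channel densities are analytic in the parameter and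
jointly continuous over a common complex ball, on which the three integrals are finite.
Finiteness of the second one contains that its integrand is finite almost everywhere, i.e.
that the infimum does not vanish there (the supremum is positive wherever the channel
density is); the supremum is finite almost everywhere by finiteness of the first one. -/
def ConditionC {l m : ℕ} (qc : EuclideanSpace ℂ (Fin m) → Fin l → ℝ → ℂ)
    (θ₀ : EuclideanSpace ℝ (Fin m)) : Prop :=
  ∃ r : ℝ, 0 < r ∧
    (∀ (y : Fin l) (z : ℝ),
      AnalyticOnNhd ℂ (fun θ => qc θ y z) (Metric.ball (toComplex θ₀) r)) ∧
    (∀ y : Fin l, ContinuousOn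
      (fun p : ℝ × EuclideanSpace ℂ (Fin m) => qc p.2 y p.1)
      (univ ×ˢ Metric.ball (toComplex θ₀) r)) ∧
    (∫⁻ z, qSup qc θ₀ r z) < ∞ ∧
    ((∀ᵐ z : ℝ, qInf qc θ₀ r z ≠ 0) ∧
      Integrable (fun z => (qSup qc θ₀ r z).toReal * Real.log (qInf qc θ₀ r z).toReal)) ∧
    Integrable (fun z => (qSup qc θ₀ r z).toReal * Real.log (qSup qc θ₀ r z).toReal)

/-- Condition (d), (i): the density ratios with denominator index `I`, as functions of the
parameter indexed by the output `z`, are equicontinuous on a complex ball around `θ₀`. -/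
def ConditionD1 {l m : ℕ} (qc : EuclideanSpace ℂ (Fin m) → Fin l → ℝ → ℂ)
    (θ₀ : EuclideanSpace ℝ (Fin m)) (I : Fin l) : Prop :=
  ∃ r : ℝ, 0 < r ∧
    (∀ z : ℝ, ∀ θ ∈ Metric.ball (toComplex θ₀) r, qc θ I z ≠ 0) ∧
    ∀ j : Fin l, EquicontinuousOn
      (fun (z : ℝ) (θ : EuclideanSpace ℂ (Fin m)) => qc θ j z / qc θ I z)
      (Metric.ball (toComplex θ₀) r)

/-- Condition (d), (ii): the real logarithm of `q^θ(z|I)` extends analytically, as `L · z`, to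
a complex ball around `θ₀` that does not depend on `z`, with an integrable supremum of
`|q^θ(z|j) log q^θ(z|I)|` over the ball. -/
def ConditionD2 {l m : ℕ} (q : EuclideanSpace ℝ (Fin m) → Fin l → ℝ → ℝ)
    (qc : EuclideanSpace ℂ (Fin m) → Fin l → ℝ → ℂ)
    (θ₀ : EuclideanSpace ℝ (Fin m)) (I : Fin l) : Prop :=
  ∃ r : ℝ, 0 < r ∧ ∃ L : EuclideanSpace ℂ (Fin m) → ℝ → ℂ,
    (∀ z : ℝ, AnalyticOnNhd ℂ (fun θ => L θ z) (Metric.ball (toComplex θ₀) r)) ∧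
    (∀ z : ℝ, ∀ᶠ θ in 𝓝 θ₀, L (toComplex θ) z = (Real.log (q θ I z) : ℂ)) ∧
    ∀ j : Fin l,
      (∫⁻ z, ⨆ θ ∈ Metric.ball (toComplex θ₀) r, ‖qc θ j z * L θ z‖ₑ) < ∞

/-- The additive Cauchy channel with scales `γ i` and locations `μ i`; for `γ i > 0`,
`q(z|i) = γ i / (π ((z - μ i)² + (γ i)²))`. -/
def cauchyChannel {l : ℕ} (γ μ : Fin l → ℝ) (i : Fin l) (z : ℝ) : ℝ :=
  ProbabilityTheory.cauchyPDFReal (μ i) (Real.toNNReal (γ i)) z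

end HiddenMarkov

end

/-! The entropy rate is minus the stationary mean of the log-density of the next output given the
past, and the past enters only through the filter, the law of the hidden state given the earlier
outputs. The filter forgets its initial value exponentially fast, uniformly in the outputs, and
still does so for complex parameters near the real ones. The rate is therefore obtained from a
uniformly convergent series of holomorphic functions.

The filter is written in logarithmic coordinates `t` of the unnormalized law, modulo additive
constants, and distances are measured by oscillation (Hilbert's projective metric). Up to a
constant, one step is `t ↦ (log ∑ i, exp (t i) * P i j + log q(z|j))_j`. Its derivative in a
direction `h` averages `h` with weights proportional to `exp (t i) * P i j`. For two columns `j`,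
each family of weights dominates `m ^ 2` times the other, where `m` is the least entry of `P`, so
oscillations shrink by `1 - m ^ 2`. The channel term is additive and cancels, so the rate does not
depend on `z`. Complex entries and phases of `exp (t i)` perturb the weights slightly, giving `1 - m
^ 2 + 16 * δ` (`norm_logSum_sub_sub_le`). The two-sided ratio bounds keep the oscillation of `t`
bounded, and equicontinuity of the ratios keeps its imaginary part small; together they give an
invariant complex domain (`RegularChannel.exists_contractiveSystem`).

The pair (hidden state, filter) has a transfer operator with weights `P i j * q(z|j)`. At complex
parameters its mass is only bounded by some `A` slightly above 1, so iterates may grow in sup norm,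
but their Lipschitz constants decay like `(κ * A) ^ k` with `κ * A < 1` (`iter_lip`). Hence the
failures of the iterates to be stationary at a base point are summable (`norm_defect_le`), their sum
is analytic (`analyticAt_limit`), and pairing with the stationary vector telescopes
(`tendsto_sum_iter`). At real parameters the first `n` iterates add up to the expected
log-likelihood of `n` outputs within a bounded error (`norm_expLogLik_sub_le`), so Cesàro means give
the rate (`hasEntropyRate`). The stationary vector is analytic by Cramer's rule.

General channels reach this scheme through identity theorems and measurable majorants. The Cauchy
channel satisfies the uniform estimates directly, because its denominator factors as `(z - μ + iγ)(z
- μ - iγ)`. -/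

noncomputable section

namespace HiddenMarkov

/-! ### Holomorphic functions of several variables -/

/-- Cauchy estimate for the Fréchet derivative. -/
theorem norm_fderiv_le_of_norm_le {E : Type*} [NormedAddCommGroup E] [NormedSpace ℂ E]
    {f : E → ℂ} {c : E} {R M : ℝ} (hR : 0 < R)
    (hf : DifferentiableOn ℂ f (Metric.ball c R)) (hM : ∀ x ∈ Metric.ball c R, ‖f x‖ ≤ M) :
    ‖fderiv ℂ f c‖ ≤ 2 * M / R := by
  refine Complex.norm_fderiv_le_div_of_mapsTo_ball hf (fun x hx => ?_) hR
  rw [mem_closedBall_iff_norm]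
  have h1 := hM x hx
  have h2 := hM c (Metric.mem_ball_self hR)
  linarith [norm_sub_le (f x) (f c)]

/-- The derivative of a measurable family of differentiable functions on a finite dimensional
space is measurable in the index. -/
theorem aestronglyMeasurable_fderiv_of_family {E α : Type*} [NormedAddCommGroup E]
    [NormedSpace ℂ E] [FiniteDimensional ℂ E] [MeasurableSpace α] {μ : Measure α}
    {F : E → α → ℂ} {x : E} {s : Set E} (hs : s ∈ 𝓝 x)
    (hd : ∀ a, DifferentiableAt ℂ (fun y => F y a) x)
    (hm : ∀ y ∈ s, AEStronglyMeasurable (F y) μ) :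
    AEStronglyMeasurable (fun a => fderiv ℂ (fun y => F y a) x) μ := by
  have key : ∀ h : E, AEStronglyMeasurable (fun a => fderiv ℂ (fun y => F y a) x h) μ := by
    intro h
    have hlim : Tendsto (fun n : ℕ => x + ((n : ℂ) + 1)⁻¹ • h) atTop (𝓝 x) := by
      have h0 : Tendsto (fun n : ℕ => ((n : ℂ) + 1)⁻¹) atTop (𝓝 0) := by
        simpa using tendsto_one_div_add_atTop_nhds_zero_nat (𝕜 := ℂ)
      simpa using tendsto_const_nhds.add (h0.smul_const h)
    obtain ⟨N, hN⟩ := eventually_atTop.1 (hlim.eventually hs)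
    -- A directional derivative is a limit of difference quotients; shifting the index by `N` keeps
    -- every sample point inside `s`.
    refine aestronglyMeasurable_of_tendsto_ae (u := atTop)
      (f := fun (n : ℕ) a => ((n + N : ℕ) + 1 : ℂ) *
        (F (x + ((n + N : ℕ) + 1 : ℂ)⁻¹ • h) a - F x a)) ?_ ?_
    · intro n
      exact ((hm _ (hN (n + N) (by omega))).sub (hm x (mem_of_mem_nhds hs))).const_mul _
    · refine Eventually.of_forall fun a => ?_
      have h1 := (hd a).hasFDerivAt.lim h (c := fun n : ℕ => ((n + N : ℕ) + 1 : ℂ))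
        (l := atTop) ?_
      · simpa using h1
      · have h2 : Tendsto (fun n : ℕ => (n : ℝ)) atTop atTop := tendsto_natCast_atTop_atTop
        refine tendsto_atTop_mono (fun n => ?_) h2
        have : (((n + N : ℕ) : ℂ) + 1) = ((n + N + 1 : ℕ) : ℂ) := by push_cast; ring
        rw [this, Complex.norm_natCast]
        push_cast
        linarith [(Nat.cast_nonneg N : (0:ℝ) ≤ N)]
  let b := Module.finBasis ℂ E
  have : (fun a => fderiv ℂ (fun y => F y a) x) = fun a => ∑ i,
      (ContinuousLinearMap.smulRightL ℂ E ℂ (b.coord i).toContinuousLinearMap)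
        (fderiv ℂ (fun y => F y a) x (b i)) := by
    funext a
    ext y
    conv_lhs => rw [← b.sum_repr y]
    simp only [map_sum, map_smul]
    simp
  rw [this]
  refine Finset.aestronglyMeasurable_fun_sum _ fun i _ => ?_
  exact (ContinuousLinearMap.continuous _).comp_aestronglyMeasurable (key _)

/-- Holomorphy of integrals depending on a parameter, with a dominated integrand. -/
theorem differentiableOn_integral_of_dominated {E α : Type*} [NormedAddCommGroup E]
    [NormedSpace ℂ E] [FiniteDimensional ℂ E] [MeasurableSpace α] {μ : Measure α}
    {F : E → α → ℂ} {U : Set E} (hU : IsOpen U) {G : α → ℝ} (hG : Integrable G μ)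
    (hd : ∀ a, DifferentiableOn ℂ (fun y => F y a) U)
    (hm : ∀ y ∈ U, AEStronglyMeasurable (F y) μ)
    (hb : ∀ᵐ a ∂μ, ∀ y ∈ U, ‖F y a‖ ≤ G a) :
    DifferentiableOn ℂ (fun y => ∫ a, F y a ∂μ) U := by
  intro x hx
  obtain ⟨R, hR, hRU⟩ := Metric.isOpen_iff.1 hU x hx
  -- Each such `y` keeps a ball of radius `R / 2` inside `U`, so Cauchy's estimate turns the
  -- majorant of the integrand into one of its derivative.
  have hhalf : ∀ y ∈ Metric.ball x (R / 2), Metric.ball y (R / 2) ⊆ U := fun y hy =>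
    (Metric.ball_subset_ball' (by have := Metric.mem_ball.1 hy; linarith)).trans hRU
  refine DifferentiableAt.differentiableWithinAt ?_
  refine (hasFDerivAt_integral_of_dominated_of_fderiv_le
    (F' := fun y a => fderiv ℂ (fun y => F y a) y) (s := Metric.ball x (R / 2))
    (bound := fun a => 2 * G a / (R / 2) )
    (Metric.ball_mem_nhds x (by positivity)) ?_ ?_ ?_ ?_ ?_ ?_).differentiableAt
  · exact (eventually_mem_set.2 (hU.mem_nhds hx)).mono hm
  · exact hG.mono' (hm x hx) (hb.mono fun a ha => ha x hx)
  · exact aestronglyMeasurable_fderiv_of_family (hU.mem_nhds hx)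
      (fun a => (hd a).differentiableAt (hU.mem_nhds hx)) hm
  · refine hb.mono fun a ha y hy => ?_
    exact norm_fderiv_le_of_norm_le (by positivity) ((hd a).mono (hhalf y hy))
      fun x' hx' => ha x' (hhalf y hy hx')
  · exact (hG.const_mul 2).div_const _
  · refine Eventually.of_forall fun a y hy => ?_
    have hyU : y ∈ U := hhalf y hy (Metric.mem_ball_self (by positivity))
    exact ((hd a).differentiableAt (hU.mem_nhds hyU)).hasFDerivAt


/-- Cauchy's integral formula on a polydisc. -/
theorem torusIntegral_cauchy (n : ℕ) {f : (Fin n → ℂ) → ℂ} {c : Fin n → ℂ} {R : ℝ} (hR : 0 < R)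
    {U : Set (Fin n → ℂ)} (hU : IsOpen U) (hf : DifferentiableOn ℂ f U)
    (hcU : Metric.closedBall c R ⊆ U) {w : Fin n → ℂ} (hw : w ∈ Metric.ball c R) :
    (∯ x in T(c, fun _ => R), (∏ i, (x i - w i)⁻¹) * f x) =
      (2 * Real.pi * Complex.I) ^ n * f w := by
  induction n with
  | zero => simp [Subsingleton.elim c w]
  | succ n ih =>
    have hw0 : ∀ i, dist (w i) (c i) < R := (dist_pi_lt_iff hR).1 hw
    have hne : ∀ i (x : ℂ), dist x (c i) = R → x - w i ≠ 0 := by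
      intro i x hx h
      have := hw0 i
      rw [← sub_eq_zero.1 h, hx] at this
      exact lt_irrefl _ this
    have htd : ∀ (θ : Fin (n + 1) → ℝ) i, dist (torusMap c (fun _ => R) θ i) (c i) = R := by
      intro θ i
      simp [torusMap, dist_eq_norm, Complex.norm_exp, abs_of_pos hR]
    have htc : Continuous (torusMap c (fun _ => R)) := by
      unfold torusMap
      fun_prop
    have hint : TorusIntegrable (fun x => (∏ i, (x i - w i)⁻¹) * f x) c (fun _ => R) := by
      refine ContinuousOn.integrableOn_compact isCompact_Icc (Continuous.continuousOn ?_)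
      refine Continuous.mul (continuous_finsetProd _ fun i _ => ?_) ?_
      · exact (((continuous_apply i).comp htc).sub continuous_const).inv₀
          fun θ => hne i _ (htd θ i)
      · refine hf.continuousOn.comp_continuous htc fun θ => hcU ?_
        exact (dist_pi_le_iff hR.le).2 fun i => (htd θ i).le
    rw [torusIntegral_succ hint]
    have hmem : ∀ x ∈ Metric.closedBall (c 0) R, ∀ y ∈ Metric.closedBall (c ∘ Fin.succ) R,
        (Fin.cons x y : Fin (n + 1) → ℂ) ∈ U := by
      intro x hx y hy
      refine hcU ((dist_pi_le_iff hR.le).2 fun i => ?_)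
      refine Fin.cases ?_ (fun j => ?_) i
      · simpa using hx
      · simpa using (dist_pi_le_iff hR.le).1 hy j
    -- With the first coordinate frozen on its circle, induction evaluates the inner integral; the
    -- outer one is Cauchy's formula in one variable.
    have hinner : ∀ x ∈ Metric.sphere (c 0) R,
        (∯ y in T(c ∘ Fin.succ, (fun _ => R) ∘ Fin.succ),
          (∏ i, ((Fin.cons x y : Fin (n + 1) → ℂ) i - w i)⁻¹) * f (Fin.cons x y)) =
        (2 * Real.pi * Complex.I) ^ n * ((x - w 0)⁻¹ • f (Fin.cons x (Fin.tail w))) := by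
      intro x hx
      have hcons : Differentiable ℂ (fun y : Fin n → ℂ => (Fin.cons x y : Fin (n + 1) → ℂ)) := by
        rw [differentiable_pi]
        intro i
        refine Fin.cases ?_ (fun j => ?_) i
        · simp
        · simpa using differentiable_apply j
      have := ih (f := fun y => f (Fin.cons x y)) (c := c ∘ Fin.succ)
        (U := (fun y => (Fin.cons x y : Fin (n + 1) → ℂ)) ⁻¹' U)
        (hU.preimage hcons.continuous)
        (hf.comp hcons.differentiableOn (fun y hy => hy))
        (fun y hy => hmem x (Metric.sphere_subset_closedBall hx) y hy) (w := Fin.tail w)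
        ((dist_pi_lt_iff hR).2 fun i => hw0 i.succ)
      calc _ = ∯ y in T(c ∘ Fin.succ, fun _ => R), (x - w 0)⁻¹ *
              ((∏ i, (y i - Fin.tail w i)⁻¹) * f (Fin.cons x y)) := by
            congr 1
            funext y
            rw [Fin.prod_univ_succ]
            simp [Fin.tail, mul_assoc]
        _ = _ := by
            rw [torusIntegral_const_mul, this, smul_eq_mul]
            ring
    rw [circleIntegral.integral_congr hR.le hinner, circleIntegral.integral_const_mul]
    have hcons : Differentiable ℂ
        (fun x : ℂ => (Fin.cons x (Fin.tail w) : Fin (n + 1) → ℂ)) := by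
      rw [differentiable_pi]
      intro i
      refine Fin.cases ?_ (fun j => ?_) i
      · simp
      · simp
    have hd : DifferentiableOn ℂ (fun x : ℂ => f (Fin.cons x (Fin.tail w)))
        (Metric.closedBall (c 0) R) := by
      refine hf.comp hcons.differentiableOn fun x hx => hmem x hx _ ?_
      exact (dist_pi_le_iff hR.le).2 fun i => (hw0 i.succ).le
    rw [DifferentiableOn.circleIntegral_sub_inv_smul hd (hw0 0), Fin.cons_self_tail, smul_eq_mul]
    ring

/-- **Osgood's lemma**: holomorphic functions of several variables are analytic. -/
theorem analyticAt_of_differentiableOn_pi {n : ℕ} {f : (Fin n → ℂ) → ℂ} {U : Set (Fin n → ℂ)}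
    (hU : IsOpen U) (hf : DifferentiableOn ℂ f U) {c : Fin n → ℂ} (hc : c ∈ U) :
    AnalyticAt ℂ f c := by
  obtain ⟨R, hR, hcU⟩ := Metric.nhds_basis_closedBall.mem_iff.1 (hU.mem_nhds hc)
  let K : Set (Fin n → ℝ) := Icc 0 fun _ => 2 * Real.pi
  have : CompactSpace K := isCompact_iff_compactSpace.1 isCompact_Icc
  have htc : Continuous (torusMap c (fun _ => R)) := by
    unfold torusMap
    fun_prop
  have htd : ∀ (θ : Fin n → ℝ) i, dist (torusMap c (fun _ => R) θ i) (c i) = R := by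
    intro θ i
    simp [torusMap, dist_eq_norm, Complex.norm_exp, abs_of_pos hR]
  -- the Cauchy kernel, an analytic function with values in a Banach algebra
  let a : Fin n → C(K, ℂ) := fun i =>
    ⟨fun θ => torusMap c (fun _ => R) θ i, by fun_prop⟩
  let k : (Fin n → ℂ) → C(K, ℂ) := fun w => ∏ i, Ring.inverse (a i - algebraMap ℂ C(K, ℂ) (w i))
  -- For `w` in the open polydisc the factors do not vanish on the torus, so they are units of `C(K,
  -- ℂ)`, where inversion is analytic. Analyticity of `f` follows by applying one continuous linear
  -- functional, without expanding the kernel in a power series.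
  have hunit : ∀ w ∈ Metric.ball c R, ∀ i, IsUnit (a i - algebraMap ℂ C(K, ℂ) (w i)) := by
    intro w hw i
    rw [ContinuousMap.isUnit_iff_forall_ne_zero]
    intro θ h
    have h1 : torusMap c (fun _ => R) θ i = w i := by
      simpa [a, sub_eq_zero] using h
    have h2 := (dist_pi_lt_iff hR).1 hw i
    rw [← h1, htd] at h2
    exact lt_irrefl _ h2
  have hk : AnalyticAt ℂ k c := by
    refine Finset.analyticAt_fun_prod _ fun i _ => ?_
    obtain ⟨u, hu⟩ := hunit c (Metric.mem_ball_self hR) i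
    have h1 : AnalyticAt ℂ (fun w : Fin n → ℂ => a i - algebraMap ℂ C(K, ℂ) (w i)) c := by
      refine analyticAt_const.sub ?_
      exact ((Algebra.linearMap ℂ C(K, ℂ)).toContinuousLinearMap.comp
        (ContinuousLinearMap.proj (R := ℂ) i)).analyticAt c
    exact AnalyticAt.fun_comp (g := Ring.inverse) (by rw [← hu]; exact analyticAt_inverse u) h1
  -- integration against the boundary values
  let g : C(K, ℂ) := ⟨fun θ => (∏ i : Fin n, ((R : ℂ) * Complex.exp (θ.1 i * Complex.I) *
    Complex.I)) * f (torusMap c (fun _ => R) θ), by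
      refine Continuous.mul (continuous_finsetProd _ fun i _ => ?_) ?_
      · have h1 : Continuous fun θ : K => θ.1 i := (continuous_apply i).comp continuous_subtype_val
        exact (continuous_const.mul (Complex.continuous_exp.comp
          ((Complex.continuous_ofReal.comp h1).mul continuous_const))).mul continuous_const
      refine hf.continuousOn.comp_continuous (htc.comp continuous_subtype_val) fun θ => hcU ?_
      exact (dist_pi_le_iff hR.le).2 fun i => (htd θ i).le⟩
  have hK : MeasurableSet K := measurableSet_Icc
  let μ : Measure K := volume.comap Subtype.val
  have hfin : IsFiniteMeasure μ := by
    refine ⟨?_⟩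
    rw [comap_subtype_coe_apply hK, image_univ, Subtype.range_coe]
    exact isCompact_Icc.measure_lt_top
  have hint : ∀ h : C(K, ℂ), Integrable h μ := fun h =>
    Integrable.of_bound h.continuous.aestronglyMeasurable ‖h‖
      (Eventually.of_forall fun x => h.norm_coe_le_norm x)
  let Λ : C(K, ℂ) →L[ℂ] ℂ := LinearMap.mkContinuous
    { toFun := fun h => ∫ θ : K, h θ ∂μ
      map_add' := fun h₁ h₂ => integral_add (hint h₁) (hint h₂)
      map_smul' := fun r h => integral_const_mul r _ } (μ.real univ) fun h => by
        rw [mul_comm]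
        exact norm_integral_le_of_norm_le_const (Eventually.of_forall fun x => h.norm_coe_le_norm x)
  have hΛ : AnalyticAt ℂ (fun w => ((2 * Real.pi * Complex.I) ^ n)⁻¹ * Λ (g * k w)) c :=
    analyticAt_const.mul ((Λ.analyticAt _).fun_comp (analyticAt_const.mul hk))
  refine hΛ.congr ?_
  filter_upwards [Metric.ball_mem_nhds c hR] with w hw
  have hpi : ((2 * Real.pi * Complex.I : ℂ) ^ n) ≠ 0 :=
    pow_ne_zero _ (by simp [Real.pi_ne_zero])
  rw [inv_mul_eq_iff_eq_mul₀ hpi, ← torusIntegral_cauchy n hR hU hf hcU hw, torusIntegral]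
  change (∫ θ : K, (g * k w) θ ∂μ) = _
  let F : (Fin n → ℝ) → ℂ := fun θ => (∏ i : Fin n, ((R : ℂ) *
      Complex.exp (θ i * Complex.I) * Complex.I)) •
      ((∏ i, (torusMap c (fun _ => R) θ i - w i)⁻¹) * f (torusMap c (fun _ => R) θ))
  have hval : ∀ θ : K, (g * k w) θ = F θ := by
    intro θ
    have hkv : k w θ = ∏ i, (torusMap c (fun _ => R) θ i - w i)⁻¹ := by
      simp only [k, ContinuousMap.prod_apply]
      refine Finset.prod_congr rfl fun i _ => ?_
      obtain ⟨u, hu⟩ := hunit w hw i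
      rw [← hu, Ring.inverse_unit]
      have h1 : (↑u⁻¹ : C(K, ℂ)) θ * (u : C(K, ℂ)) θ = 1 := by
        rw [← ContinuousMap.mul_apply, Units.inv_mul, ContinuousMap.one_apply]
      rw [eq_inv_of_mul_eq_one_left h1, hu]
      simp [a]
    rw [ContinuousMap.mul_apply, hkv]
    simp only [g, F, ContinuousMap.coe_mk, smul_eq_mul]
    ring
  rw [integral_congr_ae (Eventually.of_forall hval)]
  exact integral_subtype_comap (μ := volume) hK F

theorem analyticAt_of_differentiableOn {E : Type*} [NormedAddCommGroup E]
    [NormedSpace ℂ E] [FiniteDimensional ℂ E] {f : E → ℂ} {U : Set E}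
    (hU : IsOpen U) (hf : DifferentiableOn ℂ f U) {c : E} (hc : c ∈ U) :
    AnalyticAt ℂ f c := by
  let e : E ≃L[ℂ] (Fin (Module.finrank ℂ E) → ℂ) :=
    (Module.finBasis ℂ E).equivFun.toContinuousLinearEquiv
  have h1 : AnalyticAt ℂ (f ∘ e.symm) (e c) := by
    refine analyticAt_of_differentiableOn_pi (U := e.symm ⁻¹' U)
      (hU.preimage e.symm.continuous) (hf.comp e.symm.differentiable.differentiableOn
        (fun x hx => hx)) (by simpa using hc)
  have h2 := h1.comp (e.toContinuousLinearMap.analyticAt c)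
  refine h2.congr (Eventually.of_forall fun x => by simp)

/-! ### Contraction in logarithmic coordinates -/

/-- Two probability vectors, one dominating a multiple of the other, give close averages. -/
theorem norm_sum_sub_sum_le_of_minorization {ι : Type*} [Fintype ι] {b b' : ι → ℝ} {κ D : ℝ}
    (hb' : ∀ i, 0 ≤ b' i) (hs : ∑ i, b i = 1) (hs' : ∑ i, b' i = 1)
    (hκ : ∀ i, κ * b' i ≤ b i) {h : ι → ℂ} (hD : ∀ i k, ‖h i - h k‖ ≤ D) :
    ‖∑ i, (b i : ℂ) * h i - ∑ i, (b' i : ℂ) * h i‖ ≤ (1 - κ) * D := by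
  have hα : ∑ i, (b i - κ * b' i) = 1 - κ := by
    rw [Finset.sum_sub_distrib, ← Finset.mul_sum, hs, hs', mul_one]
  have hαc : ∑ i, ((b i : ℂ) - κ * b' i) = 1 - κ := by exact_mod_cast hα
  have hsc' : ∑ i, (b' i : ℂ) = 1 := by exact_mod_cast hs'
  -- The coefficients `b i - κ * b' i` are nonnegative with total mass `1 - κ`; pairing them with
  -- `b'` turns the difference into a sum of increments of `h`.
  have key : ∑ i, (b i : ℂ) * h i - ∑ i, (b' i : ℂ) * h i =
      ∑ i, ∑ k, ((b i - κ * b' i : ℝ) : ℂ) * (b' k : ℂ) * (h i - h k) := by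
    have h1 : ∀ i, ∑ k, ((b i - κ * b' i : ℝ) : ℂ) * (b' k : ℂ) * (h i - h k) =
        ((b i : ℂ) - κ * b' i) * h i * ∑ k, (b' k : ℂ) -
          ((b i : ℂ) - κ * b' i) * ∑ k, (b' k : ℂ) * h k := by
      intro i
      rw [Finset.mul_sum, Finset.mul_sum, ← Finset.sum_sub_distrib]
      refine Finset.sum_congr rfl fun k _ => ?_
      push_cast
      ring
    simp only [h1, hsc', mul_one]
    rw [Finset.sum_sub_distrib, ← Finset.sum_mul, hαc]
    simp only [sub_mul, Finset.sum_sub_distrib, mul_assoc, ← Finset.mul_sum]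
    ring
  rw [key]
  calc _ ≤ ∑ i, ∑ k, (b i - κ * b' i) * b' k * D := by
        refine (norm_sum_le _ _).trans (Finset.sum_le_sum fun i _ => ?_)
        refine (norm_sum_le _ _).trans (Finset.sum_le_sum fun k _ => ?_)
        have h0 : 0 ≤ b i - κ * b' i := sub_nonneg.2 (hκ i)
        rw [norm_mul, norm_mul, Complex.norm_real, Complex.norm_real, Real.norm_of_nonneg h0,
          Real.norm_of_nonneg (hb' k)]
        exact mul_le_mul_of_nonneg_left (hD i k) (mul_nonneg h0 (hb' k))
    _ = (1 - κ) * D := by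
        simp only [mul_assoc, ← Finset.mul_sum, ← Finset.sum_mul, hs', one_mul, hα]

/-- Sums of slightly perturbed positive weights. -/
theorem norm_perturbed_sum_sub_le {ι : Type*} [Fintype ι] {e : ι → ℝ} (he : ∀ i, 0 ≤ e i)
    {x : ι → ℂ} {δ : ℝ} (hx : ∀ i, ‖x i‖ ≤ δ) :
    ‖∑ i, (e i : ℂ) * (1 + x i) - (∑ i, e i : ℝ)‖ ≤ δ * ∑ i, e i := by
  have : ∑ i, (e i : ℂ) * (1 + x i) - (∑ i, e i : ℝ) = ∑ i, (e i : ℂ) * x i := by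
    push_cast
    rw [← Finset.sum_sub_distrib]
    exact Finset.sum_congr rfl fun i _ => by ring
  rw [this, Finset.mul_sum]
  refine (norm_sum_le _ _).trans (Finset.sum_le_sum fun i _ => ?_)
  rw [norm_mul, Complex.norm_real, Real.norm_of_nonneg (he i), mul_comm]
  exact mul_le_mul_of_nonneg_right (hx i) (he i)

/-- The sum stays within a quarter of its positive unperturbed value, so its real part is positive.
-/
theorem perturbed_sum_mem_slitPlane {ι : Type*} [Fintype ι] [Nonempty ι] {e : ι → ℝ}
    (he : ∀ i, 0 < e i) {x : ι → ℂ} {δ : ℝ} (hδ : δ ≤ 1 / 4) (hx : ∀ i, ‖x i‖ ≤ δ) :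
    ∑ i, (e i : ℂ) * (1 + x i) ∈ Complex.slitPlane := by
  have hE : 0 < ∑ i, e i := Finset.sum_pos (fun i _ => he i) Finset.univ_nonempty
  have h1 := norm_perturbed_sum_sub_le (fun i => (he i).le) hx
  refine Or.inl ?_
  have h2 := (Complex.abs_re_le_norm _).trans h1
  rw [Complex.sub_re, Complex.ofReal_re] at h2
  nlinarith [abs_le.1 h2]

/-- Numerator and normalization each contribute a relative error `δ`, and the perturbed sum has norm
at least half the unperturbed one; this gives the factor 4. -/
theorem norm_perturbed_weight_sub_le {ι : Type*} [Fintype ι] [Nonempty ι] {e : ι → ℝ}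
    (he : ∀ i, 0 < e i) {x : ι → ℂ} {δ : ℝ} (hδ : δ ≤ 1 / 4) (hx : ∀ i, ‖x i‖ ≤ δ) (i : ι) :
    ‖(e i : ℂ) * (1 + x i) / (∑ k, (e k : ℂ) * (1 + x k)) - ((e i / ∑ k, e k : ℝ) : ℂ)‖ ≤
      4 * δ * (e i / ∑ k, e k) := by
  have hE : 0 < ∑ i, e i := Finset.sum_pos (fun i _ => he i) Finset.univ_nonempty
  have h1 := norm_perturbed_sum_sub_le (fun i => (he i).le) hx
  have hδ0 : 0 ≤ δ := (norm_nonneg _).trans (hx i)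
  set S := ∑ k, (e k : ℂ) * (1 + x k) with hS
  set E := ∑ k, e k with hEdef
  have hSE : 1 / 2 * E ≤ ‖S‖ := by
    have := norm_sub_norm_le (E : ℂ) S
    rw [norm_sub_rev, Complex.norm_real, Real.norm_of_nonneg hE.le] at this
    nlinarith
  have hS0 : S ≠ 0 := by
    intro h
    rw [h, norm_zero] at hSE
    linarith
  have hEc : (E : ℂ) ≠ 0 := by exact_mod_cast hE.ne'
  have key : (e i : ℂ) * (1 + x i) / S - ((e i / E : ℝ) : ℂ) =
      ((e i : ℂ) * (x i * E - (S - E))) / (S * E) := by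
    push_cast
    field_simp
    ring
  rw [key, norm_div, norm_mul, norm_mul, Complex.norm_real, Complex.norm_real,
    Real.norm_of_nonneg hE.le, Real.norm_of_nonneg (he i).le]
  have h2 : ‖x i * E - (S - E)‖ ≤ 2 * δ * E := by
    refine (norm_sub_le _ _).trans ?_
    rw [norm_mul, Complex.norm_real, Real.norm_of_nonneg hE.le]
    nlinarith [hx i]
  rw [div_le_iff₀ (by positivity)]
  have h3 : 4 * δ * (e i / E) * (‖S‖ * E) = 4 * δ * e i * ‖S‖ := by
    field_simp
  rw [h3]
  calc e i * ‖x i * E - (S - E)‖ ≤ e i * (2 * δ * E) := by gcongr; exact (he i).le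
    _ = 4 * δ * e i * (1 / 2 * E) := by ring
    _ ≤ _ := by
      have := (he i).le
      gcongr

/-! ### The filter map in logarithmic coordinates and its complex perturbations -/

variable {l : ℕ}

/-- The logarithm of the normalized sum `∑ i, exp (t i) * p i`. -/
def logSum (I : Fin l) (p t : Fin l → ℂ) : ℂ :=
  Complex.log (∑ i, Complex.exp (t i - t I) * p i)

/-- `p` is a complex vector that is `δ`-close, in relative terms, to the positive vector `p₀`. -/
def IsNear (δ : ℝ) (p₀ : Fin l → ℝ) (p : Fin l → ℂ) : Prop :=
  ∀ i, ‖p i / p₀ i - 1‖ ≤ δ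

/-- The phase of `exp (t i - t I)` and the relative error of `p i` are merged into one factor `1 + x
i`, each contributing at most `δ`. Complex coordinates thus become perturbations of positive
weights. -/
theorem exists_perturbation {I : Fin l} {p₀ : Fin l → ℝ} (hp₀ : ∀ i, 0 < p₀ i) {p t : Fin l → ℂ}
    {δ : ℝ} (hp : IsNear δ p₀ p) (ht : ∀ i j, |(t i - t j).im| ≤ δ) :
    ∃ x : Fin l → ℂ, (∀ i, ‖x i‖ ≤ 2 * δ) ∧
      ∀ i, Complex.exp (t i - t I) * p i =
        ((Real.exp (t i - t I).re * p₀ i : ℝ) : ℂ) * (1 + x i) := by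
  refine ⟨fun i => p i / p₀ i * Complex.exp (Complex.I * (t i - t I).im) - 1, fun i => ?_,
    fun i => ?_⟩
  · have h1 : p i / p₀ i * Complex.exp (Complex.I * (t i - t I).im) - 1 =
        (p i / p₀ i - 1) * Complex.exp (Complex.I * (t i - t I).im) +
          (Complex.exp (Complex.I * (t i - t I).im) - 1) := by ring
    refine (congrArg norm h1).trans_le ((norm_add_le _ _).trans ?_)
    have h2 := Real.norm_exp_I_mul_ofReal_sub_one_le (x := (t i - t I).im)
    have h3 : ‖Complex.exp (Complex.I * (t i - t I).im)‖ = 1 := by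
      rw [mul_comm, Complex.norm_exp_ofReal_mul_I]
    rw [norm_mul, h3, mul_one]
    have h4 := ht i I
    have h5 := hp i
    rw [Real.norm_eq_abs] at h2
    linarith
  · have h0 : (p₀ i : ℂ) ≠ 0 := by exact_mod_cast (hp₀ i).ne'
    have h1 : Complex.exp (t i - t I) =
        Complex.exp ((t i - t I).re : ℂ) * Complex.exp (Complex.I * (t i - t I).im) := by
      rw [← Complex.exp_add]
      congr 1
      conv_lhs => rw [← Complex.re_add_im (t i - t I)]
      ring
    rw [h1]
    push_cast
    field_simp
    ring

theorem sum_exp_mem_slitPlane {I : Fin l} {p₀ : Fin l → ℝ} (hp₀ : ∀ i, 0 < p₀ i)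
    {p t : Fin l → ℂ} {δ : ℝ} (hδ : δ ≤ 1 / 8) (hp : IsNear δ p₀ p)
    (ht : ∀ i j, |(t i - t j).im| ≤ δ) :
    ∑ i, Complex.exp (t i - t I) * p i ∈ Complex.slitPlane := by
  obtain ⟨x, hx, hxe⟩ := exists_perturbation (I := I) hp₀ hp ht
  have : Nonempty (Fin l) := ⟨I⟩
  rw [Finset.sum_congr rfl fun i _ => hxe i]
  exact perturbed_sum_mem_slitPlane (fun i => mul_pos (Real.exp_pos _) (hp₀ i))
    (by linarith) hx

/-- The derivative of `logSum` along a segment is a weighted average of the increments; the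
weights are close to positive probability weights. -/
theorem exists_weights {I : Fin l} {p₀ : Fin l → ℝ} (hp₀ : ∀ i, 0 < p₀ i)
    {p t : Fin l → ℂ} {δ : ℝ} (hδ : δ ≤ 1 / 8) (hp : IsNear δ p₀ p)
    (ht : ∀ i j, |(t i - t j).im| ≤ δ) {h : Fin l → ℂ} {D : ℝ} (hD : ∀ i j, ‖h i - h j‖ ≤ D) :
    ‖(∑ i, (h i - h I) * (Complex.exp (t i - t I) * p i)) /
        (∑ i, Complex.exp (t i - t I) * p i) -
      ∑ i, ((Real.exp (t i - t I).re * p₀ i /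
        ∑ k, Real.exp (t k - t I).re * p₀ k : ℝ) : ℂ) * (h i - h I)‖ ≤ 8 * δ * D := by
  obtain ⟨x, hx, hxe⟩ := exists_perturbation (I := I) hp₀ hp ht
  have : Nonempty (Fin l) := ⟨I⟩
  have he : ∀ i, 0 < Real.exp (t i - t I).re * p₀ i := fun i =>
    mul_pos (Real.exp_pos _) (hp₀ i)
  simp only [hxe]
  set e : Fin l → ℝ := fun i => Real.exp (t i - t I).re * p₀ i with hedef
  change ∀ i, 0 < e i at he
  have hw := norm_perturbed_weight_sub_le he (by linarith) hx
  have hδ0 : 0 ≤ δ := by linarith [(norm_nonneg _).trans (hx I)]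
  have hE : 0 < ∑ i, e i := Finset.sum_pos (fun i _ => he i) Finset.univ_nonempty
  rw [Finset.sum_div, ← Finset.sum_sub_distrib]
  -- The merged perturbation has size `2 * δ`, and the weight estimate multiplies it by 4.
  calc _ ≤ ∑ i, 4 * (2 * δ) * (e i / ∑ k, e k) * D := by
        refine (norm_sum_le _ _).trans (Finset.sum_le_sum fun i _ => ?_)
        have : (h i - h I) * ((e i : ℂ) * (1 + x i)) / (∑ k, (e k : ℂ) * (1 + x k)) -
            ((e i / ∑ k, e k : ℝ) : ℂ) * (h i - h I) =
            ((e i : ℂ) * (1 + x i) / (∑ k, (e k : ℂ) * (1 + x k)) -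
            ((e i / ∑ k, e k : ℝ) : ℂ)) * (h i - h I) := by ring
        rw [this, norm_mul]
        have := he i
        exact mul_le_mul (hw i) (hD i I) (norm_nonneg _) (by positivity)
    _ = 8 * δ * D := by
        rw [← Finset.sum_mul, ← Finset.mul_sum, ← Finset.sum_div, div_self hE.ne']
        ring

theorem hasDerivAt_logSum_segment {I : Fin l} {p s h : Fin l → ℂ} {τ : ℝ}
    (hmem : ∑ i, Complex.exp ((s i + τ * h i) - (s I + τ * h I)) * p i ∈ Complex.slitPlane) :
    HasDerivAt (fun τ : ℝ => logSum I p (fun i => s i + τ * h i))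
      ((∑ i, (h i - h I) * (Complex.exp ((s i + τ * h i) - (s I + τ * h I)) * p i)) /
        (∑ i, Complex.exp ((s i + τ * h i) - (s I + τ * h I)) * p i)) τ := by
  have h1 : ∀ i, HasDerivAt (fun τ : ℝ => s i + τ * h i) (h i) τ := fun i => by
    have := ((Complex.ofRealCLM.hasDerivAt (x := τ)).mul_const (h i)).const_add (s i)
    simpa using this
  have h2 : HasDerivAt
      (fun τ : ℝ => ∑ i, Complex.exp ((s i + τ * h i) - (s I + τ * h I)) * p i)
      (∑ i, (h i - h I) * (Complex.exp ((s i + τ * h i) - (s I + τ * h I)) * p i)) τ := by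
    refine HasDerivAt.fun_sum fun i _ => ?_
    have := (((h1 i).sub (h1 I)).cexp).mul_const (p i)
    refine this.congr_deriv ?_
    simp only [Pi.sub_apply]
    ring
  exact h2.clog_real hmem

theorem abs_im_segment_sub_le {s t : Fin l → ℂ} {δ : ℝ} (hs : ∀ i j, |(s i - s j).im| ≤ δ)
    (ht : ∀ i j, |(t i - t j).im| ≤ δ) {τ : ℝ} (hτ : τ ∈ Icc (0 : ℝ) 1) (i j : Fin l) :
    |((s i + τ * (t i - s i)) - (s j + τ * (t j - s j))).im| ≤ δ := by
  have h1 : ((s i + τ * (t i - s i)) - (s j + τ * (t j - s j))).im =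
      (1 - τ) * (s i - s j).im + τ * (t i - t j).im := by
    simp
    ring
  have h2 := abs_le.1 (hs i j)
  have h3 := abs_le.1 (ht i j)
  have h4 : 0 ≤ 1 - τ := sub_nonneg.2 hτ.2
  rw [h1, abs_le]
  constructor <;> nlinarith [hτ.1]

theorem sum_exp_weights_eq_one {I : Fin l} {p₀ : Fin l → ℝ} (hp₀ : ∀ i, 0 < p₀ i)
    (t : Fin l → ℂ) : ∑ i, Real.exp (t i - t I).re * p₀ i /
      ∑ k, Real.exp (t k - t I).re * p₀ k = 1 := by
  have : Nonempty (Fin l) := ⟨I⟩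
  rw [← Finset.sum_div, div_self]
  exact (Finset.sum_pos (fun i _ => mul_pos (Real.exp_pos _) (hp₀ i))
    Finset.univ_nonempty).ne'

/-- Projective contraction of `logSum`, in logarithmic coordinates. -/
theorem norm_logSum_sub_sub_le {I : Fin l} {p₀ p₀' : Fin l → ℝ} {m : ℝ} (hm : 0 < m)
    (hp₀ : ∀ i, m ≤ p₀ i ∧ p₀ i ≤ 1) (hp₀' : ∀ i, m ≤ p₀' i ∧ p₀' i ≤ 1)
    {p p' : Fin l → ℂ} {δ : ℝ} (hδ : δ ≤ 1 / 8) (hp : IsNear δ p₀ p) (hp' : IsNear δ p₀' p')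
    {s t : Fin l → ℂ} (hs : ∀ i j, |(s i - s j).im| ≤ δ) (ht : ∀ i j, |(t i - t j).im| ≤ δ)
    {D : ℝ} (hD : ∀ i j, ‖(t i - s i) - (t j - s j)‖ ≤ D) :
    ‖(logSum I p t - logSum I p' t) - (logSum I p s - logSum I p' s)‖ ≤
      (1 - m ^ 2 + 16 * δ) * D := by
  have : Nonempty (Fin l) := ⟨I⟩
  have hpos : ∀ i, 0 < p₀ i := fun i => hm.trans_le (hp₀ i).1
  have hpos' : ∀ i, 0 < p₀' i := fun i => hm.trans_le (hp₀' i).1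
  set u : ℝ → Fin l → ℂ := fun τ i => s i + τ * (t i - s i) with hu
  have him : ∀ τ ∈ Icc (0 : ℝ) 1, ∀ i j, |(u τ i - u τ j).im| ≤ δ := fun τ hτ i j =>
    abs_im_segment_sub_le hs ht hτ i j
  have hderiv := fun τ (hτ : τ ∈ Icc (0 : ℝ) 1) =>
    (hasDerivAt_logSum_segment (sum_exp_mem_slitPlane (I := I) hpos hδ hp (him τ hτ))).sub
      (hasDerivAt_logSum_segment (sum_exp_mem_slitPlane (I := I) hpos' hδ hp' (him τ hτ)))
  -- Mean value inequality on the segment from `s` to `t`; the condition on imaginary parts is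
  -- convex, so it holds along the whole segment.
  have h01 := norm_image_sub_le_of_norm_deriv_le_segment_01'
    (C := (1 - m ^ 2 + 16 * δ) * D)
    (fun τ hτ => (hderiv τ hτ).hasDerivWithinAt) (fun τ hτ => ?_)
  · simpa using h01
  · have hτ' : τ ∈ Icc (0 : ℝ) 1 := ⟨hτ.1, hτ.2.le⟩
    have h1 := exists_weights (I := I) hpos hδ hp (him τ hτ') hD
    have h2 := exists_weights (I := I) hpos' hδ hp' (him τ hτ') hD
    have h3 := norm_sum_sub_sum_le_of_minorization (κ := m ^ 2)
      (b := fun i => Real.exp (u τ i - u τ I).re * p₀ i /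
        ∑ k, Real.exp (u τ k - u τ I).re * p₀ k)
      (b' := fun i => Real.exp (u τ i - u τ I).re * p₀' i /
        ∑ k, Real.exp (u τ k - u τ I).re * p₀' k)
      (fun i => div_nonneg (mul_pos (Real.exp_pos _) (hpos' i)).le
        (Finset.sum_nonneg fun k _ => (mul_pos (Real.exp_pos _) (hpos' k)).le))
      (sum_exp_weights_eq_one hpos _) (sum_exp_weights_eq_one hpos' _) (fun i => ?_)
      (h := fun i => (t i - s i) - (t I - s I)) (D := D) (fun i k => by simpa using hD i k)
    · simp only [hu] at h1 h2 h3 ⊢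
      set A := (∑ i, ((t i - s i) - (t I - s I)) * (Complex.exp ((s i + τ * (t i - s i)) -
        (s I + τ * (t I - s I))) * p i)) / ∑ i, Complex.exp ((s i + τ * (t i - s i)) -
        (s I + τ * (t I - s I))) * p i
      set B := (∑ i, ((t i - s i) - (t I - s I)) * (Complex.exp ((s i + τ * (t i - s i)) -
        (s I + τ * (t I - s I))) * p' i)) / ∑ i, Complex.exp ((s i + τ * (t i - s i)) -
        (s I + τ * (t I - s I))) * p' i
      -- Here `w` and `w'` will be the averages with positive weights. Passing to them costs `8 * δ
      -- * D` for each column, hence the `16 * δ`.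
      have key : ∀ w w' : ℂ, A - B = (A - w) + (w - w') - (B - w') := fun w w' => by ring
      rw [key]
      refine (norm_sub_le _ _).trans ((add_le_add ((norm_add_le _ _).trans
        (add_le_add h1 h3)) h2).trans (le_of_eq (by ring)))
    · have he : ∀ k, 0 < Real.exp (u τ k - u τ I).re := fun k => Real.exp_pos _
      generalize hedef : (fun k => Real.exp (u τ k - u τ I).re) = e
      have hee : ∀ k, Real.exp (u τ k - u τ I).re = e k := fun k => congrFun hedef k
      simp only [hee] at he ⊢
      have hS : 0 < ∑ k, e k * p₀ k :=
        Finset.sum_pos (fun k _ => mul_pos (he k) (hpos k)) Finset.univ_nonempty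
      have hS' : 0 < ∑ k, e k * p₀' k :=
        Finset.sum_pos (fun k _ => mul_pos (he k) (hpos' k)) Finset.univ_nonempty
      have h5 : ∑ k, e k * p₀ k ≤ ∑ k, e k := Finset.sum_le_sum fun k _ => by
        nlinarith [(hp₀ k).2, he k]
      have h6 : m * ∑ k, e k ≤ ∑ k, e k * p₀' k := by
        rw [Finset.mul_sum]
        exact Finset.sum_le_sum fun k _ => by nlinarith [(hp₀' k).1, he k]
      rw [mul_div_assoc', div_le_div_iff₀ hS' hS]
      -- One factor `m` is paid by the entry `p₀ i`, the other by the sum `∑ k, e k * p₀' k`.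
      calc m ^ 2 * (e i * p₀' i) * ∑ k, e k * p₀ k
          ≤ m ^ 2 * (e i * 1) * ∑ k, e k := by
            have := he i
            have := (hp₀' i).2
            have := hpos' i
            gcongr
        _ = e i * m * (m * ∑ k, e k) := by ring
        _ ≤ e i * p₀ i * ∑ k, e k * p₀' k := by
            have := he i
            have := (hp₀ i).1
            have := hpos i
            have : 0 < ∑ k, e k := Finset.sum_pos (fun k _ => he k) Finset.univ_nonempty
            gcongr

/-- A single column does not contract: the positive average is at most `D`, and the complex
correction `8 * δ * D` is again at most `D`. -/
theorem norm_logSum_sub_le {I : Fin l} {p₀ : Fin l → ℝ} (hp₀ : ∀ i, 0 < p₀ i)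
    {p : Fin l → ℂ} {δ : ℝ} (hδ : δ ≤ 1 / 8) (hp : IsNear δ p₀ p)
    {s t : Fin l → ℂ} (hs : ∀ i j, |(s i - s j).im| ≤ δ) (ht : ∀ i j, |(t i - t j).im| ≤ δ)
    {D : ℝ} (hD : ∀ i j, ‖(t i - s i) - (t j - s j)‖ ≤ D) :
    ‖logSum I p t - logSum I p s‖ ≤ 2 * D := by
  have : Nonempty (Fin l) := ⟨I⟩
  have hD0 : 0 ≤ D := (norm_nonneg _).trans (hD I I)
  set u : ℝ → Fin l → ℂ := fun τ i => s i + τ * (t i - s i) with hu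
  have him : ∀ τ ∈ Icc (0 : ℝ) 1, ∀ i j, |(u τ i - u τ j).im| ≤ δ := fun τ hτ i j =>
    abs_im_segment_sub_le hs ht hτ i j
  have hderiv := fun τ (hτ : τ ∈ Icc (0 : ℝ) 1) =>
    hasDerivAt_logSum_segment (sum_exp_mem_slitPlane (I := I) hp₀ hδ hp (him τ hτ))
  have h01 := norm_image_sub_le_of_norm_deriv_le_segment_01' (C := 2 * D)
    (fun τ hτ => (hderiv τ hτ).hasDerivWithinAt) (fun τ hτ => ?_)
  · simpa using h01
  · have hτ' : τ ∈ Icc (0 : ℝ) 1 := ⟨hτ.1, hτ.2.le⟩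
    have h1 := exists_weights (I := I) hp₀ hδ hp (him τ hτ') hD
    have h2 : ‖∑ i, ((Real.exp (u τ i - u τ I).re * p₀ i /
        ∑ k, Real.exp (u τ k - u τ I).re * p₀ k : ℝ) : ℂ) * ((t i - s i) - (t I - s I))‖ ≤ D := by
      have hw := sum_exp_weights_eq_one (I := I) hp₀ (u τ)
      calc _ ≤ ∑ i, (Real.exp (u τ i - u τ I).re * p₀ i /
            ∑ k, Real.exp (u τ k - u τ I).re * p₀ k) * D := by
            refine (norm_sum_le _ _).trans (Finset.sum_le_sum fun i _ => ?_)
            have h0 : 0 ≤ Real.exp (u τ i - u τ I).re * p₀ i /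
                ∑ k, Real.exp (u τ k - u τ I).re * p₀ k :=
              div_nonneg (mul_pos (Real.exp_pos _) (hp₀ i)).le
                (Finset.sum_nonneg fun k _ => (mul_pos (Real.exp_pos _) (hp₀ k)).le)
            rw [norm_mul, Complex.norm_real, Real.norm_of_nonneg h0]
            exact mul_le_mul_of_nonneg_left (hD i I) h0
        _ = D := by rw [← Finset.sum_mul, hw, one_mul]
    have h3 := norm_le_norm_add_norm_sub' _ _ |>.trans (add_le_add h2 h1)
    refine h3.trans ?_
    nlinarith

/-- When the differences of the coordinates are real, only the entries of `p` create an imaginary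
part. The perturbation has size `2 * δ`, and `log (1 + x)` costs a factor `3 / 2`. -/
theorem norm_logSum_sub_log_le {I : Fin l} {p₀ : Fin l → ℝ} (hp₀ : ∀ i, 0 < p₀ i)
    {p : Fin l → ℂ} {δ : ℝ} (hδ : δ ≤ 1 / 8) (hp : IsNear δ p₀ p)
    {t : Fin l → ℂ} (ht : ∀ i j, (t i - t j).im = 0) :
    ‖logSum I p t - (Real.log (∑ i, Real.exp (t i - t I).re * p₀ i) : ℂ)‖ ≤ 3 * δ := by
  have : Nonempty (Fin l) := ⟨I⟩
  have hδ0 : 0 ≤ δ := (norm_nonneg _).trans (hp I)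
  obtain ⟨x, hx, hxe⟩ := exists_perturbation (I := I) hp₀ hp (t := t)
    (fun i j => by rw [ht i j, abs_zero]; exact hδ0)
  have he : ∀ i, 0 < Real.exp (t i - t I).re * p₀ i := fun i =>
    mul_pos (Real.exp_pos _) (hp₀ i)
  have hE : 0 < ∑ i, Real.exp (t i - t I).re * p₀ i :=
    Finset.sum_pos (fun i _ => he i) Finset.univ_nonempty
  have h1 := norm_perturbed_sum_sub_le (fun i => (he i).le) hx
  rw [logSum, Finset.sum_congr rfl fun i _ => hxe i]
  set E := ∑ i, Real.exp (t i - t I).re * p₀ i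
  set S := ∑ i, ((Real.exp (t i - t I).re * p₀ i : ℝ) : ℂ) * (1 + x i)
  have hEc : (E : ℂ) ≠ 0 := by exact_mod_cast hE.ne'
  have hS : S = E * (1 + (S - E) / E) := by
    field_simp
    ring
  have hsmall : ‖(S - E) / E‖ ≤ 2 * δ := by
    rw [norm_div, Complex.norm_real, Real.norm_of_nonneg hE.le, div_le_iff₀ hE]
    exact h1
  have hne : 1 + (S - E) / E ≠ 0 := by
    intro h
    have : ‖(S - E) / (E : ℂ)‖ = 1 := by
      rw [eq_neg_of_add_eq_zero_right h, norm_neg, norm_one]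
    linarith
  rw [hS, Complex.log_ofReal_mul hE hne, add_sub_cancel_left]
  refine (Complex.norm_log_one_add_half_le_self (by linarith)).trans ?_
  linarith

/-! ### Contractive systems -/

/-- A holomorphic family of random iterated function systems on a domain `X` of logarithmic
coordinates, with matrix-valued complex weights, that contracts oscillations on average. -/
structure ContractiveSystem (l : ℕ) (W : Type*) [NormedAddCommGroup W] [NormedSpace ℂ W] where
  U : Set W
  X : Set (Fin l → ℂ)
  isOpen_U : IsOpen U
  isOpen_X : IsOpen X
  zero_mem : 0 ∈ X
  M : ℝ
  norm_sub_le : ∀ t ∈ X, ∀ i j, ‖t i - t j‖ ≤ M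
  weight : W → Fin l → Fin l → ℝ → ℂ
  bound : ℝ → ℝ
  integrable_bound : Integrable bound
  weight_diff : ∀ i j z, DifferentiableOn ℂ (fun w => weight w i j z) U
  weight_meas : ∀ w ∈ U, ∀ i j, Measurable (weight w i j)
  weight_le : ∀ w ∈ U, ∀ i j z, ‖weight w i j z‖ ≤ bound z
  -- At complex parameters the total mass of the weights may exceed 1; only the product `κ * A` has
  -- to be below 1.
  A : ℝ
  weight_sum : ∀ w ∈ U, ∀ i, ∑ j, ∫ z, ‖weight w i j z‖ ≤ A
  step : W → ℝ → (Fin l → ℂ) → Fin l → ℂ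
  step_mem : ∀ w ∈ U, ∀ z, ∀ t ∈ X, step w z t ∈ X
  step_diff : ∀ z, DifferentiableOn ℂ
    (fun p : W × (Fin l → ℂ) => step p.1 z p.2) (U ×ˢ X)
  step_meas : ∀ w ∈ U, ∀ t ∈ X, Measurable fun z => step w z t
  κ : ℝ
  κ_nonneg : 0 ≤ κ
  -- Quantifying over `D` expresses the oscillation seminorm of `t - s`, which ignores additive
  -- constants.
  step_contr : ∀ w ∈ U, ∀ z, ∀ s ∈ X, ∀ t ∈ X, ∀ D : ℝ,
    (∀ i j, ‖(t i - s i) - (t j - s j)‖ ≤ D) →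
    ∀ i j, ‖(step w z t i - step w z s i) - (step w z t j - step w z s j)‖ ≤ κ * D
  κ_mul_A : κ * A < 1
  start : W → (Fin l → ℂ) → Fin l → ℂ
  start_diff : ∀ i, DifferentiableOn ℂ
    (fun p : W × (Fin l → ℂ) => start p.1 p.2 i) (U ×ˢ X)
  B : ℝ
  start_le : ∀ w ∈ U, ∀ t ∈ X, ∀ i, ‖start w t i‖ ≤ B
  Λ : ℝ
  Λ_nonneg : 0 ≤ Λ
  start_lip : ∀ w ∈ U, ∀ s ∈ X, ∀ t ∈ X, ∀ D : ℝ,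
    (∀ i j, ‖(t i - s i) - (t j - s j)‖ ≤ D) → ∀ i, ‖start w t i - start w s i‖ ≤ Λ * D

namespace ContractiveSystem

variable {l : ℕ} {W : Type*} [NormedAddCommGroup W] [NormedSpace ℂ W]
  (S : ContractiveSystem l W)

/-- The iterates of the transfer operator on the starting function. -/
def iter : ℕ → W → (Fin l → ℂ) → Fin l → ℂ
  | 0 => S.start
  | k + 1 => fun w t i => ∑ j, ∫ z, S.weight w i j z * iter k w (S.step w z t) j

theorem iter_zero : S.iter 0 = S.start := rfl

theorem iter_succ (k : ℕ) (w : W) (t : Fin l → ℂ) (i : Fin l) :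
    S.iter (k + 1) w t i = ∑ j, ∫ z, S.weight w i j z * S.iter k w (S.step w z t) j := rfl

theorem integrable_weight {w : W} (hw : w ∈ S.U) (i j : Fin l) :
    Integrable (S.weight w i j) :=
  S.integrable_bound.mono' (S.weight_meas w hw i j).aestronglyMeasurable
    (Eventually.of_forall (S.weight_le w hw i j))

theorem A_nonneg {w : W} (hw : w ∈ S.U) (i : Fin l) : 0 ≤ S.A :=
  (Finset.sum_nonneg fun _ _ => integral_nonneg fun _ => norm_nonneg _).trans (S.weight_sum w hw i)

theorem norm_sum_integral_le {w : W} (hw : w ∈ S.U) (i : Fin l) {c : ℝ} {f : ℝ → Fin l → ℂ}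
    (hf : ∀ z j, ‖f z j‖ ≤ c) :
    ‖∑ j, ∫ z, S.weight w i j z * f z j‖ ≤ c * S.A := by
  have hc : 0 ≤ c := (norm_nonneg _).trans (hf 0 i)
  calc _ ≤ ∑ j, (∫ z, ‖S.weight w i j z‖) * c := by
        refine (norm_sum_le _ _).trans (Finset.sum_le_sum fun j _ => ?_)
        rw [← integral_mul_const]
        refine norm_integral_le_of_norm_le ((S.integrable_weight hw i j).norm.mul_const c)
          (Eventually.of_forall fun z => ?_)
        rw [norm_mul]
        exact mul_le_mul_of_nonneg_left (hf z j) (norm_nonneg _)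
    _ ≤ c * S.A := by
        rw [← Finset.sum_mul, mul_comm]
        exact mul_le_mul_of_nonneg_left (S.weight_sum w hw i) hc

/-- This bound may grow with `k`; it only serves to dominate integrals for fixed `k`. Decay comes
from `iter_lip`. -/
theorem norm_iter_le (k : ℕ) : ∀ w ∈ S.U, ∀ t ∈ S.X, ∀ i, ‖S.iter k w t i‖ ≤ S.B * S.A ^ k := by
  induction k with
  | zero => simpa [iter_zero] using S.start_le
  | succ k ih =>
    intro w hw t ht i
    rw [iter_succ, pow_succ, ← mul_assoc]
    exact S.norm_sum_integral_le hw i fun z j => ih w hw _ (S.step_mem w hw z t ht) j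

theorem measurable_comp_step {w : W} (hw : w ∈ S.U) {t : Fin l → ℂ} (ht : t ∈ S.X)
    {f : (Fin l → ℂ) → ℂ} (hf : ContinuousOn f S.X) :
    Measurable fun z => f (S.step w z t) :=
  (continuousOn_iff_continuous_domRestrict.1 hf).measurable.comp
    ((S.step_meas w hw t ht).subtype_mk (h := fun z => S.step_mem w hw z t ht))

theorem iter_diff [FiniteDimensional ℂ W] (k : ℕ) : ∀ i, DifferentiableOn ℂ
    (fun p : W × (Fin l → ℂ) => S.iter k p.1 p.2 i) (S.U ×ˢ S.X) := by
  induction k with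
  | zero => exact S.start_diff
  | succ k ih =>
    intro i
    simp only [iter_succ]
    refine DifferentiableOn.fun_sum fun j _ => ?_
    refine differentiableOn_integral_of_dominated (S.isOpen_U.prod S.isOpen_X)
      (S.integrable_bound.mul_const (S.B * S.A ^ k)) (fun z => ?_) (fun p hp => ?_)
      (Eventually.of_forall fun z p hp => ?_)
    · refine ((S.weight_diff i j z).comp differentiableOn_fst fun p hp => hp.1).mul ?_
      exact (ih j).comp (differentiableOn_fst.prodMk (S.step_diff z))
        fun p hp => ⟨hp.1, S.step_mem _ hp.1 z _ hp.2⟩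
    · refine ((S.weight_meas p.1 hp.1 i j).mul ?_).aestronglyMeasurable
      refine S.measurable_comp_step (f := fun t => S.iter k p.1 t j) hp.1 hp.2 ?_
      exact (ih j).continuousOn.comp (continuousOn_const.prodMk continuousOn_id)
        fun t ht => ⟨hp.1, ht⟩
    · rw [norm_mul]
      exact mul_le_mul (S.weight_le _ hp.1 i j z)
        (S.norm_iter_le k _ hp.1 _ (S.step_mem _ hp.1 z _ hp.2) j) (norm_nonneg _)
        ((norm_nonneg _).trans (S.weight_le _ hp.1 i j z))

theorem continuousOn_iter [FiniteDimensional ℂ W] (k : ℕ) {w : W} (hw : w ∈ S.U) (i : Fin l) :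
    ContinuousOn (fun t => S.iter k w t i) S.X :=
  (S.iter_diff k i).continuousOn.comp (continuousOn_const.prodMk continuousOn_id)
    fun _ ht => ⟨hw, ht⟩

theorem integrable_weight_mul_iter [FiniteDimensional ℂ W] (k : ℕ) {w : W} (hw : w ∈ S.U) {t : Fin l → ℂ} (ht : t ∈ S.X)
    (i j : Fin l) : Integrable fun z => S.weight w i j z * S.iter k w (S.step w z t) j := by
  refine (S.integrable_weight hw i j).mul_bdd (c := S.B * S.A ^ k)
    (S.measurable_comp_step hw ht (S.continuousOn_iter k hw j)).aestronglyMeasurable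
    (Eventually.of_forall fun z => S.norm_iter_le k w hw _ (S.step_mem w hw z t ht) j)

/-- Stepping contracts oscillations by `κ`, and integration against the weights costs at most `A`.
-/
theorem iter_lip [FiniteDimensional ℂ W] (k : ℕ) : ∀ w ∈ S.U, ∀ s ∈ S.X, ∀ t ∈ S.X, ∀ D : ℝ,
    (∀ i j, ‖(t i - s i) - (t j - s j)‖ ≤ D) →
    ∀ i, ‖S.iter k w t i - S.iter k w s i‖ ≤ S.Λ * (S.κ * S.A) ^ k * D := by
  induction k with
  | zero => simpa [iter_zero] using S.start_lip
  | succ k ih =>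
    intro w hw s hs t ht D hD i
    rw [iter_succ, iter_succ, ← Finset.sum_sub_distrib]
    have h1 : ∀ j, (∫ z, S.weight w i j z * S.iter k w (S.step w z t) j) -
        (∫ z, S.weight w i j z * S.iter k w (S.step w z s) j) =
        ∫ z, S.weight w i j z * (S.iter k w (S.step w z t) j - S.iter k w (S.step w z s) j) := by
      intro j
      rw [← integral_sub (S.integrable_weight_mul_iter k hw ht i j)
        (S.integrable_weight_mul_iter k hw hs i j)]
      simp only [mul_sub]
    simp only [h1]
    refine (S.norm_sum_integral_le hw i (c := S.Λ * (S.κ * S.A) ^ k * (S.κ * D))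
      fun z j => ?_).trans (le_of_eq (by ring))
    exact ih w hw _ (S.step_mem w hw z s hs) _ (S.step_mem w hw z t ht) _
      (S.step_contr w hw z s hs t ht D hD) j

/-- The defect of stationarity of the iterates at the base point. -/
def defect (k : ℕ) (w : W) (i : Fin l) : ℂ :=
  S.iter (k + 1) w 0 i - ∑ j, (∫ z, S.weight w i j z) * S.iter k w 0 j

/-- The defect compares an iterate at the image of `0` with its value at `0`. These points of the
domain differ by oscillation at most `M`, so the decaying Lipschitz constant applies. -/
theorem norm_defect_le [FiniteDimensional ℂ W] (k : ℕ) {w : W} (hw : w ∈ S.U) (i : Fin l) :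
    ‖S.defect k w i‖ ≤ S.Λ * S.M * S.A * (S.κ * S.A) ^ k := by
  rw [defect, iter_succ, ← Finset.sum_sub_distrib]
  have h1 : ∀ j, (∫ z, S.weight w i j z * S.iter k w (S.step w z 0) j) -
      (∫ z, S.weight w i j z) * S.iter k w 0 j =
      ∫ z, S.weight w i j z * (S.iter k w (S.step w z 0) j - S.iter k w 0 j) := by
    intro j
    rw [← integral_mul_const, ← integral_sub (S.integrable_weight_mul_iter k hw S.zero_mem i j)
      ((S.integrable_weight hw i j).mul_const _)]
    simp only [mul_sub]
  simp only [h1]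
  refine (S.norm_sum_integral_le hw i (c := S.Λ * (S.κ * S.A) ^ k * S.M)
    fun z j => ?_).trans (le_of_eq (by ring))
  refine S.iter_lip k w hw _ S.zero_mem _ (S.step_mem w hw z 0 S.zero_mem) _ (fun i j => ?_) j
  simpa using S.norm_sub_le _ (S.step_mem w hw z 0 S.zero_mem) i j

theorem summable_rate {w : W} (hw : w ∈ S.U) (i : Fin l) :
    Summable fun k : ℕ => S.Λ * S.M * S.A * (S.κ * S.A) ^ k :=
  (summable_geometric_of_lt_one (mul_nonneg S.κ_nonneg (S.A_nonneg hw i)) S.κ_mul_A).mul_left _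

/-- The limit of the iterates, up to the weights of a stationary vector. -/
def limit (w : W) (i : Fin l) : ℂ := S.start w 0 i + ∑' k, S.defect k w i

theorem defect_diff [FiniteDimensional ℂ W] (k : ℕ) (i : Fin l) :
    DifferentiableOn ℂ (fun w => S.defect k w i) S.U := by
  have hit : ∀ k i, DifferentiableOn ℂ (fun w => S.iter k w 0 i) S.U := fun k i =>
    (S.iter_diff k i).comp (differentiableOn_id.prodMk (differentiableOn_const _))
      fun _ hw => ⟨hw, S.zero_mem⟩
  refine (hit _ _).sub (DifferentiableOn.fun_sum fun j _ => DifferentiableOn.mul ?_ (hit _ _))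
  exact differentiableOn_integral_of_dominated S.isOpen_U S.integrable_bound
    (S.weight_diff i j) (fun w hw => (S.weight_meas w hw i j).aestronglyMeasurable)
    (Eventually.of_forall fun z w hw => S.weight_le w hw i j z)

/-- The series of defects is a dominated integral for counting measure, so holomorphy of parameter
integrals covers it; Osgood's lemma then gives analyticity. -/
theorem analyticAt_limit [FiniteDimensional ℂ W] {w : W} (hw : w ∈ S.U) (i : Fin l) :
    AnalyticAt ℂ (fun w => S.limit w i) w := by
  refine analyticAt_of_differentiableOn S.isOpen_U (DifferentiableOn.add ?_ ?_) hw
  · exact (S.start_diff i).comp (differentiableOn_id.prodMk (differentiableOn_const _))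
      fun _ hw => ⟨hw, S.zero_mem⟩
  · have hsum : ∀ w ∈ S.U, Summable fun k => S.defect k w i := fun w hw =>
      Summable.of_norm_bounded (S.summable_rate hw i) fun k => S.norm_defect_le k hw i
    have hint : Integrable (fun k : ℕ => S.Λ * S.M * S.A * (S.κ * S.A) ^ k) Measure.count :=
      integrable_count_iff.2 (S.summable_rate hw i).norm
    have h1 := differentiableOn_integral_of_dominated (μ := Measure.count) S.isOpen_U
      (F := fun w k => S.defect k w i) hint
      (fun k => S.defect_diff k i)
      (fun w _ => (measurable_of_countable _).aestronglyMeasurable)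
      (Eventually.of_forall fun k w hw => S.norm_defect_le k hw i)
    refine h1.congr fun w' hw' => ?_
    have h2 : Integrable (fun k => S.defect k w' i) Measure.count :=
      integrable_count_iff.2 (hsum w' hw').norm
    rw [integral_countable h2]
    simp [Measure.real]

/-- Averages of the iterates with respect to a stationary vector converge. -/
theorem tendsto_sum_iter [FiniteDimensional ℂ W] {w : W} (hw : w ∈ S.U) {v : Fin l → ℂ}
    (hv : ∀ j, ∑ i, v i * ∫ z, S.weight w i j z = v j) {t : Fin l → ℂ} (ht : t ∈ S.X) :
    Tendsto (fun k => ∑ i, v i * S.iter k w t i) atTop (𝓝 (∑ i, v i * S.limit w i)) := by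
  -- Since `v` is fixed by the integrated weights, pairing it with a defect gives the increment of
  -- the paired iterates, and the sum telescopes.
  have htel : ∀ n, ∑ i, v i * S.iter n w 0 i =
      ∑ i, v i * (S.start w 0 i + ∑ k ∈ Finset.range n, S.defect k w i) := by
    intro n
    induction n with
    | zero => simp [iter_zero]
    | succ n ih =>
      have h1 : ∑ i, v i * ∑ j, (∫ z, S.weight w i j z) * S.iter n w 0 j =
          ∑ j, v j * S.iter n w 0 j := by
        simp only [Finset.mul_sum]
        rw [Finset.sum_comm]
        refine Finset.sum_congr rfl fun j _ => ?_
        rw [← hv j, Finset.sum_mul]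
        exact Finset.sum_congr rfl fun i _ => by ring
      have h2 : ∑ i, v i * S.defect n w i =
          ∑ i, v i * S.iter (n + 1) w 0 i - ∑ i, v i * S.iter n w 0 i := by
        rw [← h1, ← Finset.sum_sub_distrib]
        exact Finset.sum_congr rfl fun i _ => by rw [defect, mul_sub]
      simp only [Finset.sum_range_succ, ← add_assoc, mul_add _ _ (S.defect n w _)]
      rw [Finset.sum_add_distrib, ← ih, h2]
      ring
  have h0 : Tendsto (fun k => ∑ i, v i * S.iter k w 0 i) atTop
      (𝓝 (∑ i, v i * S.limit w i)) := by
    simp only [htel]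
    refine tendsto_finsetSum _ fun i _ => Tendsto.const_mul _ (Tendsto.const_add _ ?_)
    exact (Summable.of_norm_bounded (S.summable_rate hw i) fun k =>
      S.norm_defect_le k hw i).hasSum.tendsto_sum_nat
  -- The starting coordinates are forgotten at rate `κ * A`, so the base point `0` may be replaced
  -- by any `t` in the domain.
  have hdiff : Tendsto (fun k => ∑ i, v i * (S.iter k w t i - S.iter k w 0 i)) atTop (𝓝 0) := by
    have hz : (0 : ℂ) = ∑ _i : Fin l, (0 : ℂ) := by simp
    rw [hz]
    refine tendsto_finsetSum _ fun i _ => ?_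
    rw [← mul_zero (v i)]
    refine Tendsto.const_mul _ ?_
    refine squeeze_zero_norm (a := fun k => S.Λ * (S.κ * S.A) ^ k * S.M) (fun k => ?_) ?_
    · exact S.iter_lip k w hw 0 S.zero_mem t ht S.M
        (fun i j => by simpa using S.norm_sub_le t ht i j) i
    · have := tendsto_pow_atTop_nhds_zero_of_lt_one
        (mul_nonneg S.κ_nonneg (S.A_nonneg hw i)) S.κ_mul_A
      simpa using (this.const_mul S.Λ).mul_const S.M
  have := h0.add hdiff
  rw [add_zero] at this
  refine this.congr fun k => ?_
  rw [← Finset.sum_add_distrib]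
  exact Finset.sum_congr rfl fun i _ => by ring

end ContractiveSystem

/-! ### The contractive system of a regular channel -/

/-- A channel whose densities `q` extend holomorphically in the parameter, with dominated
densities and entropies, and whose likelihood ratios depend uniformly continuously on the
parameter at `θ₀`. Here `L` is the logarithm of the density with index `I`. -/
structure RegularChannel (l : ℕ) (E : Type*) [NormedAddCommGroup E] [NormedSpace ℂ E]
    (I : Fin l) (θ₀ : E) where
  V : Set E
  isOpen_V : IsOpen V
  mem_V : θ₀ ∈ V
  q : E → Fin l → ℝ → ℂ
  L : E → ℝ → ℂ
  G : ℝ → ℝ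
  integrable_G : Integrable G
  H : ℝ → ℝ
  integrable_H : Integrable H
  q_diff : ∀ j z, DifferentiableOn ℂ (fun θ => q θ j z) V
  q_meas : ∀ θ ∈ V, ∀ j, Measurable (q θ j)
  q_le : ∀ θ ∈ V, ∀ j z, ‖q θ j z‖ ≤ G z
  q_ne : ∀ θ ∈ V, ∀ z, q θ I z ≠ 0
  L_diff : ∀ z, DifferentiableOn ℂ (fun θ => L θ z) V
  L_meas : ∀ θ ∈ V, Measurable (L θ)
  qL_le : ∀ᵐ z, ∀ θ ∈ V, ∀ j, ‖q θ j z * L θ z‖ ≤ H z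
  q₀ : Fin l → ℝ → ℝ
  q_base : ∀ j z, q θ₀ j z = q₀ j z
  q₀_pos : ∀ j z, 0 < q₀ j z
  q₀_integral : ∀ j, ∫ z, q₀ j z = 1
  C : ℝ
  ratio_le : ∀ j z, |Real.log (q₀ j z / q₀ I z)| ≤ C
  -- The factor `⊤` makes the convergence uniform in the output. It is relative to the base ratio,
  -- so that it passes to logarithms.
  ratio_tendsto : ∀ j, Tendsto
    (fun p : E × ℝ => (q p.1 j p.2 / q p.1 I p.2) / (q₀ j p.2 / q₀ I p.2 : ℝ))
    (𝓝 θ₀ ×ˢ ⊤) (𝓝 1)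

namespace RegularChannel

variable {l : ℕ} {E : Type*} [NormedAddCommGroup E] [NormedSpace ℂ E] {I : Fin l} {θ₀ : E}
  (Q : RegularChannel l E I θ₀)

/-- The transition weights, depending on the transition matrix and the channel parameter. -/
def weight (w : (Fin l → Fin l → ℂ) × E) (i j : Fin l) (z : ℝ) : ℂ := w.1 i j * Q.q w.2 j z

/-- The filter recursion in logarithmic coordinates. -/
def step (w : (Fin l → Fin l → ℂ) × E) (z : ℝ) (t : Fin l → ℂ) (j : Fin l) : ℂ :=
  logSum I (fun i => w.1 i j) t - logSum I (fun i => w.1 i I) t +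
    Complex.log (Q.q w.2 j z / Q.q w.2 I z)

/-- The expected logarithm of the density of the next output, up to its coboundary. -/
def start (w : (Fin l → Fin l → ℂ) × E) (t : Fin l → ℂ) (i : Fin l) : ℂ :=
  logSum I (fun i => w.1 i I) t + ∑ j, w.1 i j * ∫ z, Q.q w.2 j z * Q.L w.2 z

/-- Dividing by the positive base ratio leaves `log (1 + x)` with `‖x‖ ≤ δ`. Hence the principal
logarithm is close to the real one and has no branch problem. -/
theorem log_ratio_eq {θ : E} {j : Fin l} {z δ : ℝ} (hδ : δ ≤ 1 / 2)
    (h : ‖(Q.q θ j z / Q.q θ I z) / (Q.q₀ j z / Q.q₀ I z : ℝ) - 1‖ ≤ δ) :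
    ‖Complex.log (Q.q θ j z / Q.q θ I z) - (Real.log (Q.q₀ j z / Q.q₀ I z) : ℂ)‖ ≤ 3 / 2 * δ ∧
      Q.q θ j z / Q.q θ I z ∈ Complex.slitPlane := by
  have hb : 0 < Q.q₀ j z / Q.q₀ I z := div_pos (Q.q₀_pos _ _) (Q.q₀_pos _ _)
  set b := Q.q₀ j z / Q.q₀ I z
  set r := Q.q θ j z / Q.q θ I z
  have hbc : (b : ℂ) ≠ 0 := by exact_mod_cast hb.ne'
  have hr : r = b * (1 + (r / b - 1)) := by
    field_simp
    ring
  have hslit : 1 + (r / b - 1) ∈ Complex.slitPlane :=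
    Complex.mem_slitPlane_of_norm_lt_one (by linarith)
  rw [hr]
  constructor
  · rw [Complex.log_ofReal_mul hb (Complex.slitPlane_ne_zero hslit), add_sub_cancel_left]
    exact (Complex.norm_log_one_add_half_le_self (by linarith)).trans (by linarith)
  · rw [Complex.mem_slitPlane_iff] at hslit ⊢
    rw [Complex.re_ofReal_mul, Complex.im_ofReal_mul]
    exact hslit.imp (mul_pos hb) (mul_ne_zero hb.ne')

/-- The domain of logarithmic coordinates: small imaginary oscillation, bounded oscillation. -/
def logDomain (l : ℕ) (η M : ℝ) : Set (Fin l → ℂ) :=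
  {t | ∀ i j, |(t i - t j).im| < η ∧ ‖t i - t j‖ < M}

theorem isOpen_logDomain (l : ℕ) (η M : ℝ) : IsOpen (logDomain l η M) := by
  simp only [logDomain, ofPred_forall]
  refine isOpen_iInter_of_finite fun i => isOpen_iInter_of_finite fun j => IsOpen.and ?_ ?_
  · refine isOpen_lt (continuous_abs.comp (Complex.continuous_im.comp ?_)) continuous_const
    fun_prop
  · exact isOpen_lt (by fun_prop) continuous_const

omit [NormedSpace ℂ E] in
theorem eventually_isNear {P₀ : Fin l → Fin l → ℝ} (hP₀ : ∀ i j, 0 < P₀ i j) {δ : ℝ}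
    (hδ : 0 < δ) : ∀ᶠ w : (Fin l → Fin l → ℂ) × E in
      𝓝 ((fun i j => (P₀ i j : ℂ)), θ₀), ∀ j, IsNear δ (fun i => P₀ i j) fun i => w.1 i j := by
  simp only [IsNear, eventually_all]
  intro j i
  have h0 : (P₀ i j : ℂ) ≠ 0 := by exact_mod_cast (hP₀ i j).ne'
  have hc : Continuous fun w : (Fin l → Fin l → ℂ) × E => ‖w.1 i j / P₀ i j - 1‖ := by fun_prop
  have h1 := hc.tendsto ((fun i j => (P₀ i j : ℂ)), θ₀)
  simp only [div_self h0, sub_self, norm_zero] at h1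
  exact (h1.eventually (gt_mem_nhds hδ)).mono fun w hw => le_of_lt hw

theorem eventually_ratio {δ : ℝ} (hδ : 0 < δ) : ∀ᶠ θ in 𝓝 θ₀, ∀ j z,
    ‖(Q.q θ j z / Q.q θ I z) / (Q.q₀ j z / Q.q₀ I z : ℝ) - 1‖ ≤ δ := by
  rw [eventually_all]
  intro j
  have h1 := (Q.ratio_tendsto j).eventually (Metric.closedBall_mem_nhds (1 : ℂ) hδ)
  rw [eventually_prod_iff] at h1
  obtain ⟨pa, hpa, pb, hpb, h⟩ := h1
  rw [eventually_top] at hpb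
  filter_upwards [hpa] with θ hθ z
  simpa [dist_eq_norm] using h hθ (hpb z)

/-- The total mass equals 1 at the base parameter and is continuous there by dominated convergence
with majorant `G`. -/
theorem eventually_weight_sum {P₀ : Fin l → Fin l → ℝ} (hP₀ : ∀ i j, 0 < P₀ i j)
    (hP₁ : ∀ i, ∑ j, P₀ i j = 1) {A : ℝ} (hA : 1 < A) :
    ∀ᶠ w : (Fin l → Fin l → ℂ) × E in 𝓝 ((fun i j => (P₀ i j : ℂ)), θ₀),
      ∀ i, ∑ j, ∫ z, ‖Q.weight w i j z‖ ≤ A := by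
  rw [eventually_all]
  intro i
  have hcont : ∀ j, ContinuousAt (fun θ => ∫ z, ‖Q.q θ j z‖) θ₀ := fun j => by
    have hV := Q.isOpen_V.mem_nhds Q.mem_V
    refine continuousAt_of_dominated (bound := Q.G) ?_ ?_ Q.integrable_G ?_
    · filter_upwards [hV] with θ hθ using (Q.q_meas θ hθ j).norm.aestronglyMeasurable
    · filter_upwards [hV] with θ hθ
      exact Eventually.of_forall fun z => by simpa using Q.q_le θ hθ j z
    · exact Eventually.of_forall fun z =>
        (((Q.q_diff j z).differentiableAt hV).continuousAt).norm
  have hc : ContinuousAt (fun w : (Fin l → Fin l → ℂ) × E =>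
      ∑ j, ‖w.1 i j‖ * ∫ z, ‖Q.q w.2 j z‖) ((fun i j => (P₀ i j : ℂ)), θ₀) := by
    refine tendsto_finsetSum _ fun j _ => Tendsto.mul ?_ ?_
    · have : Continuous fun w : (Fin l → Fin l → ℂ) × E => ‖w.1 i j‖ := by fun_prop
      exact this.tendsto _
    · exact (hcont j).tendsto.comp (continuousAt_snd (p := ((fun i j => (P₀ i j : ℂ)), θ₀)))
  have hval : ∑ j, ‖(P₀ i j : ℂ)‖ * ∫ z, ‖Q.q θ₀ j z‖ = 1 := by
    rw [← hP₁ i]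
    refine Finset.sum_congr rfl fun j _ => ?_
    have : ∀ z, ‖Q.q θ₀ j z‖ = Q.q₀ j z := fun z => by
      rw [Q.q_base, Complex.norm_real, Real.norm_of_nonneg (Q.q₀_pos j z).le]
    simp only [this, Q.q₀_integral, mul_one, Complex.norm_real,
      Real.norm_of_nonneg (hP₀ i j).le]
  have h1 : ∀ᶠ w : (Fin l → Fin l → ℂ) × E in 𝓝 ((fun i j => (P₀ i j : ℂ)), θ₀),
      ∑ j, ‖w.1 i j‖ * ∫ z, ‖Q.q w.2 j z‖ < A :=
    hc.eventually (gt_mem_nhds (by simpa only [hval] using hA))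
  filter_upwards [h1] with w hw
  refine le_trans (le_of_eq (Finset.sum_congr rfl fun j _ => ?_)) hw.le
  simp only [weight, norm_mul, integral_const_mul]


theorem norm_le_two_of_isNear {δ : ℝ} (hδ : δ ≤ 1) {p₀ : Fin l → ℝ}
    (hp₀ : ∀ i, 0 < p₀ i ∧ p₀ i ≤ 1) {p : Fin l → ℂ} (h : IsNear δ p₀ p) (i : Fin l) :
    ‖p i‖ ≤ 2 := by
  have h1 := h i
  have h2 := norm_le_norm_add_norm_sub' (p i / p₀ i) 1
  rw [norm_one, norm_div, Complex.norm_real, Real.norm_of_nonneg (hp₀ i).1.le] at h2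
  have h3 : ‖p i‖ / p₀ i ≤ 2 := by linarith
  rw [div_le_iff₀ (hp₀ i).1] at h3
  nlinarith [(hp₀ i).2]

theorem sum_norm_le {ι : Type*} [Fintype ι] {f : ι → ℂ} {c : ℝ} (hf : ∀ j, ‖f j‖ ≤ c) :
    ‖∑ j, f j‖ ≤ Fintype.card ι * c := by
  refine (norm_sum_le _ _).trans ((Finset.sum_le_sum fun j _ => hf j).trans ?_)
  simp

theorem differentiableOn_logSum {δ : ℝ} (hδ : δ ≤ 1 / 8) {M : ℝ} {P₀ : Fin l → Fin l → ℝ}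
    (hP₀ : ∀ i j, 0 < P₀ i j) {U : Set ((Fin l → Fin l → ℂ) × E)}
    (hU : ∀ w ∈ U, ∀ j, IsNear δ (fun i => P₀ i j) fun i => w.1 i j) (j : Fin l) :
    DifferentiableOn ℂ (fun p : ((Fin l → Fin l → ℂ) × E) × (Fin l → ℂ) =>
      logSum I (fun i => p.1.1 i j) p.2) (U ×ˢ logDomain l δ M) := by
  refine DifferentiableOn.clog ?_ fun p hp =>
    sum_exp_mem_slitPlane (fun i => hP₀ i j) hδ (hU _ hp.1 j) fun i k => (hp.2 i k).1.le
  fun_prop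

/-- In this fourfold difference the channel term and the column `I` cancel. Only the columns `i` and
`j` remain, and the rate is independent of `z`. -/
theorem step_contr {δ m : ℝ} (hδ : δ ≤ 1 / 8) (hm : 0 < m) {P₀ : Fin l → Fin l → ℝ}
    (hP₀ : ∀ i j, m ≤ P₀ i j ∧ P₀ i j ≤ 1) {w : (Fin l → Fin l → ℂ) × E}
    (hw : ∀ j, IsNear δ (fun i => P₀ i j) fun i => w.1 i j) (z : ℝ) {s t : Fin l → ℂ}
    (hs : ∀ i j, |(s i - s j).im| ≤ δ) (ht : ∀ i j, |(t i - t j).im| ≤ δ) {D : ℝ}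
    (hD : ∀ i j, ‖(t i - s i) - (t j - s j)‖ ≤ D) (i j : Fin l) :
    ‖(Q.step w z t i - Q.step w z s i) - (Q.step w z t j - Q.step w z s j)‖ ≤
      (1 - m ^ 2 + 16 * δ) * D := by
  have h := norm_logSum_sub_sub_le (I := I) hm (fun k => hP₀ k i) (fun k => hP₀ k j) hδ
    (hw i) (hw j) hs ht hD
  refine le_trans (le_of_eq (congrArg norm ?_)) h
  simp only [step]
  ring

/-- Comparison with the image of the origin: contraction controls the difference, and that image has
oscillation at most `2 * (c + δ)`. -/
theorem norm_step_sub_step_le {κ δ c M : ℝ} {w : (Fin l → Fin l → ℂ) × E} {z : ℝ}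
    {t : Fin l → ℂ}
    (hcontr : ∀ D, (∀ i j, ‖(t i - 0) - (t j - 0)‖ ≤ D) → ∀ i j,
      ‖(Q.step w z t i - Q.step w z 0 i) - (Q.step w z t j - Q.step w z 0 j)‖ ≤ κ * D)
    (ht : ∀ i j, ‖t i - t j‖ ≤ M) (h0 : ∀ j, ‖logSum I (fun i => w.1 i j) 0‖ ≤ c)
    (hr : ∀ j, ‖Complex.log (Q.q w.2 j z / Q.q w.2 I z)‖ ≤ δ) (i j : Fin l) :
    ‖Q.step w z t i - Q.step w z t j‖ ≤ κ * M + 2 * (c + δ) := by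
  have h1 := hcontr M (fun i j => by simpa using ht i j) i j
  have key : Q.step w z t i - Q.step w z t j =
      ((Q.step w z t i - Q.step w z 0 i) - (Q.step w z t j - Q.step w z 0 j)) +
        ((logSum I (fun k => w.1 k i) 0 + Complex.log (Q.q w.2 i z / Q.q w.2 I z)) -
        (logSum I (fun k => w.1 k j) 0 + Complex.log (Q.q w.2 j z / Q.q w.2 I z))) := by
    simp only [step]
    ring
  rw [key]
  refine (norm_add_le _ _).trans (add_le_add h1 ((norm_sub_le _ _).trans ?_))
  have h2 := norm_add_le (logSum I (fun k => w.1 k i) 0) (Complex.log (Q.q w.2 i z / Q.q w.2 I z))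
  have h3 := norm_add_le (logSum I (fun k => w.1 k j) 0) (Complex.log (Q.q w.2 j z / Q.q w.2 I z))
  linarith [h0 i, h0 j, hr i, hr j]

/-- Comparison with the image of the real part of `t`: the displacement is purely imaginary with
oscillation at most `η`, and real coordinates have a nearly real image. -/
theorem abs_im_step_sub_step_le {κ η δ δ' : ℝ} {w : (Fin l → Fin l → ℂ) × E} {z : ℝ}
    {t : Fin l → ℂ}
    (hcontr : ∀ D, (∀ i j, ‖(t i - (t i).re) - (t j - (t j).re)‖ ≤ D) → ∀ i j,
      ‖(Q.step w z t i - Q.step w z (fun i => (t i).re) i) -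
        (Q.step w z t j - Q.step w z (fun i => (t i).re) j)‖ ≤ κ * D)
    (ht : ∀ i j, |(t i - t j).im| ≤ η)
    (h0 : ∀ j, ∃ x : ℝ, ‖logSum I (fun i => w.1 i j) (fun i => (t i).re) - x‖ ≤ δ)
    (hr : ∀ j, ∃ x : ℝ, ‖Complex.log (Q.q w.2 j z / Q.q w.2 I z) - x‖ ≤ δ') (i j : Fin l) :
    |(Q.step w z t i - Q.step w z t j).im| ≤ κ * η + 2 * (δ + δ') := by
  have h1 := hcontr η (fun i j => ?_) i j
  · have him : ∀ {c : ℂ} {b : ℝ}, (∃ x : ℝ, ‖c - x‖ ≤ b) → |c.im| ≤ b := by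
      rintro c b ⟨x, hx⟩
      refine le_trans ?_ hx
      simpa using Complex.abs_im_le_norm (c - x)
    have hi := him (h0 i)
    have hj := him (h0 j)
    have hri := him (hr i)
    have hrj := him (hr j)
    have h2 := (Complex.abs_im_le_norm _).trans h1
    have key : (Q.step w z t i - Q.step w z t j).im =
        ((Q.step w z t i - Q.step w z (fun i => (t i).re) i) -
          (Q.step w z t j - Q.step w z (fun i => (t i).re) j)).im +
        (logSum I (fun k => w.1 k i) (fun i => (t i).re)).im +
        (Complex.log (Q.q w.2 i z / Q.q w.2 I z)).im -
        (logSum I (fun k => w.1 k j) (fun i => (t i).re)).im -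
        (Complex.log (Q.q w.2 j z / Q.q w.2 I z)).im := by
      simp only [step, Complex.add_im, Complex.sub_im]
      ring
    rw [key, abs_le]
    have a1 := abs_le.1 h2
    have a2 := abs_le.1 hi
    have a3 := abs_le.1 hj
    have a4 := abs_le.1 hri
    have a5 := abs_le.1 hrj
    constructor <;> linarith [a1.1, a1.2, a2.1, a2.2, a3.1, a3.2, a4.1, a4.2, a5.1, a5.2]
  · have h3 : ∀ c : ℂ, c - (c.re : ℂ) = (c.im : ℂ) * Complex.I := fun c => by
      apply Complex.ext <;> simp
    rw [h3, h3, ← sub_mul, norm_mul, Complex.norm_I, mul_one, ← Complex.ofReal_sub,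
      Complex.norm_real, Real.norm_eq_abs]
    simpa using ht i j

/-- A regular channel driven by a positive transition matrix defines a contractive system. -/
theorem exists_contractiveSystem [FiniteDimensional ℂ E] {P₀ : Fin l → Fin l → ℝ} (hP₀ : ∀ i j, 0 < P₀ i j)
    (hP₁ : ∀ i, ∑ j, P₀ i j = 1) (M₀ : ℝ) :
    ∃ S : ContractiveSystem l ((Fin l → Fin l → ℂ) × E),
      S.weight = Q.weight ∧ S.step = Q.step ∧ S.start = Q.start ∧
      ((fun i j => (P₀ i j : ℂ)), θ₀) ∈ S.U ∧ (∀ w ∈ S.U, w.2 ∈ Q.V) ∧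
      ∀ t : Fin l → ℝ, (∀ i j, |t i - t j| < M₀) → (fun i => (t i : ℂ)) ∈ S.X := by
  have : Nonempty (Fin l) := ⟨I⟩
  -- constants
  obtain ⟨⟨i₁, j₁⟩, hmin⟩ := Finite.exists_min fun p : Fin l × Fin l => P₀ p.1 p.2
  set m := P₀ i₁ j₁ with hmdef
  have hm : 0 < m := hP₀ i₁ j₁
  have hP1 : ∀ i j, P₀ i j ≤ 1 := fun i j => by
    rw [← hP₁ i]
    exact Finset.single_le_sum (f := fun j => P₀ i j) (fun j _ => (hP₀ i j).le) (Finset.mem_univ j)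
  have hPm : ∀ i j, m ≤ P₀ i j ∧ P₀ i j ≤ 1 := fun i j => ⟨hmin (i, j), hP1 i j⟩
  have hm1 : m ≤ 1 := hP1 i₁ j₁
  have hm2 : 0 < m ^ 2 := by positivity
  have hm2' : m ^ 2 ≤ 1 := by nlinarith
  -- `η` bounds imaginary oscillations in the domain, and `δ` is the tolerance for the matrix and
  -- the ratios. Then `κ = 1 - 3 * m ^ 2 / 4`, so `κ * A < 1`. One step creates the imaginary error
  -- `9 * δ = 3 * m ^ 2 * η / 8`, half of the room `(1 - κ) * η` left by contraction.
  obtain ⟨η, hη⟩ : ∃ η : ℝ, η = m ^ 2 / 64 := ⟨_, rfl⟩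
  obtain ⟨κ, hκ⟩ : ∃ κ : ℝ, κ = 1 - m ^ 2 + 16 * η := ⟨_, rfl⟩
  obtain ⟨δ, hδ⟩ : ∃ δ : ℝ, δ = m ^ 2 * η / 24 := ⟨_, rfl⟩
  obtain ⟨A, hA⟩ : ∃ A : ℝ, A = 1 + m ^ 2 / 4 := ⟨_, rfl⟩
  have hη0 : 0 < η := by rw [hη]; positivity
  have hη8 : η ≤ 1 / 8 := by linarith
  have hκ0 : 0 ≤ κ := by linarith
  have hκ1 : 0 < 1 - κ := by linarith
  have hδ0 : 0 < δ := by rw [hδ]; positivity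
  have hδη : δ ≤ η := by nlinarith
  have hκA : κ * A < 1 := by
    rw [hκ, hA, hη]
    nlinarith
  have hinv : κ * η + 2 * (3 * δ + 3 / 2 * δ) < η := by
    rw [hκ, hδ, hη]
    nlinarith [mul_pos hm2 hm2]
  obtain ⟨c, hc⟩ : ∃ c : ℝ, ∀ j, |Real.log (∑ i, P₀ i j)| + 3 * δ ≤ c := by
    obtain ⟨j₂, hj₂⟩ := Finite.exists_max fun j => |Real.log (∑ i, P₀ i j)|
    exact ⟨|Real.log (∑ i, P₀ i j₂)| + 3 * δ, fun j => by linarith [hj₂ j]⟩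
  obtain ⟨c', hc'⟩ : ∃ c' : ℝ, c' = Q.C + 3 / 2 * δ := ⟨_, rfl⟩
  -- Above `2 * (c + c') / (1 - κ)` every bound on oscillations is preserved by a step; `M₀` makes
  -- room for the initial filter.
  obtain ⟨M, hM₀, hM1, hMstep⟩ : ∃ M, M₀ ≤ M ∧ 0 < M ∧ κ * M + 2 * (c + c') < M := by
    refine ⟨max M₀ (max 1 ((2 * (c + c') + 1) / (1 - κ))), le_max_left _ _, ?_, ?_⟩
    · exact lt_of_lt_of_le one_pos ((le_max_left _ _).trans (le_max_right _ _))
    · set M := max M₀ (max 1 ((2 * (c + c') + 1) / (1 - κ)))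
      have : (2 * (c + c') + 1) / (1 - κ) ≤ M := (le_max_right _ _).trans (le_max_right _ _)
      rw [div_le_iff₀ hκ1] at this
      linarith
  -- the neighbourhood of parameters
  have hev : ∀ᶠ w : (Fin l → Fin l → ℂ) × E in 𝓝 ((fun i j => (P₀ i j : ℂ)), θ₀),
      w.2 ∈ Q.V ∧ (∀ j, IsNear δ (fun i => P₀ i j) fun i => w.1 i j) ∧
      (∀ j z, ‖(Q.q w.2 j z / Q.q w.2 I z) / (Q.q₀ j z / Q.q₀ I z : ℝ) - 1‖ ≤ δ) ∧
      ∀ i, ∑ j, ∫ z, ‖Q.weight w i j z‖ ≤ A := by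
    have hsnd : Tendsto (fun w : (Fin l → Fin l → ℂ) × E => w.2)
        (𝓝 ((fun i j => (P₀ i j : ℂ)), θ₀)) (𝓝 θ₀) :=
      continuousAt_snd (p := ((fun i j => (P₀ i j : ℂ)), θ₀))
    refine (hsnd.eventually (Q.isOpen_V.mem_nhds Q.mem_V)).and ((eventually_isNear hP₀ hδ0).and
      ((hsnd.eventually (Q.eventually_ratio hδ0)).and ?_))
    exact Q.eventually_weight_sum hP₀ hP₁ (by linarith)
  obtain ⟨U, hU, hUo, hUmem⟩ := eventually_nhds_iff.1 hev
  have hnear : ∀ w ∈ U, ∀ j, IsNear η (fun i => P₀ i j) fun i => w.1 i j := fun w hw j i =>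
    ((hU w hw).2.1 j i).trans hδη
  have hw2 : ∀ w ∈ U, ∀ i j, ‖w.1 i j‖ ≤ 2 := fun w hw i j =>
    norm_le_two_of_isNear (by linarith) (fun k => ⟨hP₀ k j, hP1 k j⟩) (hnear w hw j) i
  have hlog : ∀ w ∈ U, ∀ j z, ‖Complex.log (Q.q w.2 j z / Q.q w.2 I z) -
      (Real.log (Q.q₀ j z / Q.q₀ I z) : ℂ)‖ ≤ 3 / 2 * δ ∧
      Q.q w.2 j z / Q.q w.2 I z ∈ Complex.slitPlane := fun w hw j z =>
    Q.log_ratio_eq (by linarith) ((hU w hw).2.2.1 j z)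
  have hlogc : ∀ w ∈ U, ∀ z j, ‖Complex.log (Q.q w.2 j z / Q.q w.2 I z)‖ ≤ c' := by
    intro w hw z j
    have h1 := norm_le_norm_add_norm_sub' (Complex.log (Q.q w.2 j z / Q.q w.2 I z))
      (Real.log (Q.q₀ j z / Q.q₀ I z) : ℂ)
    rw [Complex.norm_real, Real.norm_eq_abs] at h1
    linarith [Q.ratio_le j z, (hlog w hw j z).1]
  have hsum0 : ∀ w ∈ U, ∀ j, ‖logSum I (fun i => w.1 i j) 0‖ ≤ c := by
    intro w hw j
    have h1 := norm_logSum_sub_log_le (I := I) (fun i => hP₀ i j) (by linarith)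
      ((hU w hw).2.1 j) (t := 0) (by simp)
    have h2 := norm_le_norm_add_norm_sub' (logSum I (fun i => w.1 i j) 0)
      (Real.log (∑ i, Real.exp ((0 : Fin l → ℂ) i - (0 : Fin l → ℂ) I).re * P₀ i j) : ℂ)
    rw [Complex.norm_real, Real.norm_eq_abs] at h2
    simp only [Pi.zero_apply, sub_self, Complex.zero_re, Real.exp_zero, one_mul] at h1 h2
    linarith [hc j]
  have hreal : ∀ w ∈ U, ∀ (s : Fin l → ℝ) j, ∃ x : ℝ,
      ‖logSum I (fun i => w.1 i j) (fun i => (s i : ℂ)) - x‖ ≤ 3 * δ := fun w hw s j =>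
    ⟨_, norm_logSum_sub_log_le (I := I) (fun i => hP₀ i j) (by linarith)
      ((hU w hw).2.1 j) (t := fun i => (s i : ℂ)) (by simp)⟩
  have hzero : (0 : Fin l → ℂ) ∈ logDomain l η M := fun i j => by
    simpa using ⟨hη0, hM1⟩
  have hreal_mem : ∀ s : Fin l → ℝ, ∀ i j, |((fun i => (s i : ℂ)) i - (fun i => (s i : ℂ)) j).im| ≤ η :=
    fun s i j => by simpa using hη0.le
  have hqL : ∀ w ∈ U, ∀ j, ‖∫ z, Q.q w.2 j z * Q.L w.2 z‖ ≤ ∫ z, Q.H z := fun w hw j =>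
    norm_integral_le_of_norm_le Q.integrable_H
      (Q.qL_le.mono fun z hz => hz w.2 (hU w hw).1 j)
  have hα : ∀ w ∈ U, ∀ i, ‖∑ j, w.1 i j * ∫ z, Q.q w.2 j z * Q.L w.2 z‖ ≤
      Fintype.card (Fin l) * (2 * ∫ z, Q.H z) := fun w hw i => sum_norm_le fun j => by
    rw [norm_mul]
    exact mul_le_mul (hw2 w hw i j) (hqL w hw j) (norm_nonneg _) zero_le_two
  refine ⟨{
    U := U
    X := logDomain l η M
    isOpen_U := hUo
    isOpen_X := isOpen_logDomain l η M
    zero_mem := hzero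
    M := M
    norm_sub_le := fun t ht i j => (ht i j).2.le
    weight := Q.weight
    bound := fun z => 2 * Q.G z
    integrable_bound := Q.integrable_G.const_mul 2
    weight_diff := fun i j z => ?_
    weight_meas := fun w hw i j => (Q.q_meas w.2 (hU w hw).1 j).const_mul _
    weight_le := fun w hw i j z => ?_
    A := A
    weight_sum := fun w hw => (hU w hw).2.2.2
    step := Q.step
    step_mem := fun w hw z t ht i j => ⟨?_, ?_⟩
    step_diff := fun z => ?_
    step_meas := fun w hw t ht => ?_
    κ := κ
    κ_nonneg := hκ0
    step_contr := fun w hw z s hs t ht D hD => ?_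
    κ_mul_A := hκA
    start := Q.start
    start_diff := fun i => ?_
    -- `c` bounds `logSum` at the origin, `2 * M` its variation over the domain, and the last term
    -- the expected logarithm of the density.
    B := c + 2 * M + Fintype.card (Fin l) * (2 * ∫ z, Q.H z)
    start_le := fun w hw t ht i => ?_
    Λ := 2
    Λ_nonneg := zero_le_two
    start_lip := fun w hw s hs t ht D hD i => ?_ },
    rfl, rfl, rfl, hUmem, fun w hw => (hU w hw).1, fun t ht i j => ?_⟩
  · refine DifferentiableOn.mul (by fun_prop) ?_
    exact (Q.q_diff j z).comp differentiableOn_snd fun w hw => (hU w hw).1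
  · rw [weight, norm_mul]
    exact mul_le_mul (hw2 w hw i j) (Q.q_le _ (hU w hw).1 j z) (norm_nonneg _) zero_le_two
  · refine lt_of_le_of_lt (Q.abs_im_step_sub_step_le (κ := κ) (fun D hD => ?_)
      (fun i j => (ht i j).1.le) (hreal w hw fun i => (t i).re)
      (fun j => ⟨_, (hlog w hw j z).1⟩) i j) hinv
    rw [hκ]
    exact Q.step_contr hη8 hm hPm (hnear w hw) z (hreal_mem _) (fun i j => (ht i j).1.le) hD
  · refine lt_of_le_of_lt (Q.norm_step_sub_step_le (κ := κ) (M := M) (fun D hD => ?_)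
      (fun i j => (ht i j).2.le) (hsum0 w hw) (hlogc w hw z) i j) hMstep
    rw [hκ]
    exact Q.step_contr hη8 hm hPm (hnear w hw) z (fun i j => (hzero i j).1.le)
      (fun i j => (ht i j).1.le) hD
  · rw [differentiableOn_pi]
    intro j
    refine ((differentiableOn_logSum hη8 hP₀ hnear j).sub
      (differentiableOn_logSum hη8 hP₀ hnear I)).add ?_
    have hq : ∀ j, DifferentiableOn ℂ (fun p : ((Fin l → Fin l → ℂ) × E) × (Fin l → ℂ) =>
        Q.q p.1.2 j z) (U ×ˢ logDomain l η M) := fun j =>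
      (Q.q_diff j z).comp (differentiable_fst.snd.differentiableOn) fun p hp => (hU _ hp.1).1
    have hdiv : DifferentiableOn ℂ (fun p : ((Fin l → Fin l → ℂ) × E) × (Fin l → ℂ) =>
        Q.q p.1.2 j z / Q.q p.1.2 I z) (U ×ˢ logDomain l η M) := by
      simp only [div_eq_mul_inv]
      exact (hq j).mul ((hq I).fun_inv fun p hp => Q.q_ne _ (hU _ hp.1).1 z)
    exact hdiv.clog fun p hp => (hlog _ hp.1 j z).2
  · rw [measurable_pi_iff]
    intro j
    have hq := Q.q_meas w.2 (hU w hw).1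
    exact measurable_const.add ((hq j).div (hq I)).clog
  · rw [hκ]
    exact Q.step_contr hη8 hm hPm (hnear w hw) z (fun i j => (hs i j).1.le)
      (fun i j => (ht i j).1.le) hD
  · refine (differentiableOn_logSum hη8 hP₀ hnear I).add (DifferentiableOn.fun_sum fun j _ => ?_)
    refine DifferentiableOn.mul (by fun_prop) ?_
    have hV : DifferentiableOn ℂ (fun θ => ∫ z, Q.q θ j z * Q.L θ z) Q.V :=
      differentiableOn_integral_of_dominated Q.isOpen_V Q.integrable_H
        (fun z => (Q.q_diff j z).mul (Q.L_diff z))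
        (fun θ hθ => ((Q.q_meas θ hθ j).mul (Q.L_meas θ hθ)).aestronglyMeasurable)
        (Q.qL_le.mono fun z hz θ hθ => hz θ hθ j)
    exact hV.comp (differentiable_fst.snd.differentiableOn) fun p hp => (hU _ hp.1).1
  · have h1 := norm_logSum_sub_le (I := I) (fun i => hP₀ i I) hη8 (hnear w hw I) (s := 0)
      (fun i j => (hzero i j).1.le) (fun i j => (ht i j).1.le) (D := M)
      (fun i j => by simpa using (ht i j).2.le)
    have h2 := norm_le_norm_add_norm_sub' (logSum I (fun i => w.1 i I) t)
      (logSum I (fun i => w.1 i I) 0)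
    exact (norm_add_le _ _).trans (add_le_add (by linarith [hsum0 w hw I]) (hα w hw i))
  · have h1 := norm_logSum_sub_le (I := I) (fun i => hP₀ i I) hη8 (hnear w hw I)
      (fun i j => (hs i j).1.le) (fun i j => (ht i j).1.le) hD
    refine le_trans (le_of_eq (congrArg norm ?_)) h1
    simp only [start]
    ring
  · have h1 : (t i : ℂ) - t j = ((t i - t j : ℝ) : ℂ) := by push_cast; rfl
    rw [h1, Complex.ofReal_im, abs_zero, Complex.norm_real, Real.norm_eq_abs]
    exact ⟨hη0, (ht i j).trans_le hM₀⟩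

end RegularChannel

/-! ### Block densities -/

variable {l : ℕ}

/-- The density of `n` outputs, with `a` the (unnormalized) law of the hidden state one time unit
before the first output. -/
def outDensity (P : Matrix (Fin l) (Fin l) ℝ) (q : Fin l → ℝ → ℝ) :
    (n : ℕ) → (Fin l → ℝ) → (Fin n → ℝ) → ℝ
  | 0, a, _ => ∑ i, a i
  | n + 1, a, z => outDensity P q n (fun j => (∑ i, a i * P i j) * q j (z 0)) (Fin.tail z)

variable {P : Matrix (Fin l) (Fin l) ℝ} {q : Fin l → ℝ → ℝ}

theorem blockDensity_zero (u : Fin l → ℝ) (z : Fin 1 → ℝ) :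
    blockDensity u P q 0 z = ∑ j, u j * q j (z 0) := by
  rw [blockDensity, ← (Equiv.funUnique (Fin 1) (Fin l)).symm.sum_comp]
  simp [pathProb]

theorem blockDensity_succ (u : Fin l → ℝ) (n : ℕ) (z : Fin (n + 2) → ℝ) :
    blockDensity u P q (n + 1) z =
      blockDensity (fun j => ∑ i, u i * q i (z 0) * P i j) P q n (Fin.tail z) := by
  rw [blockDensity, ← (Fin.consEquiv fun _ => Fin l).sum_comp, Fintype.sum_prod_type_right,
    blockDensity]
  refine Finset.sum_congr rfl fun y _ => ?_
  simp only [pathProb, Fin.consEquiv_apply]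
  rw [Finset.sum_mul, Finset.sum_mul]
  refine Finset.sum_congr rfl fun i _ => ?_
  rw [Fin.prod_univ_succ, Fin.prod_univ_succ (f := fun k => q _ (z k))]
  simp [Fin.tail]
  ring

/-- Placing the initial law one time unit earlier makes every output follow a transition, so one
recursion covers all of them. -/
theorem blockDensity_vecMul (n : ℕ) : ∀ (a : Fin l → ℝ) (z : Fin (n + 1) → ℝ),
    blockDensity (fun j => ∑ i, a i * P i j) P q n z = outDensity P q (n + 1) a z := by
  induction n with
  | zero =>
    intro a z
    rw [blockDensity_zero, outDensity, outDensity]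
  | succ n ih =>
    intro a z
    rw [blockDensity_succ, outDensity, ← ih]

theorem outDensity_smul (n : ℕ) : ∀ (c : ℝ) (a : Fin l → ℝ) (z : Fin n → ℝ),
    outDensity P q n (fun i => c * a i) z = c * outDensity P q n a z := by
  induction n with
  | zero => intro c a z; simp [outDensity, Finset.mul_sum]
  | succ n ih =>
    intro c a z
    rw [outDensity, outDensity, ← ih]
    congr 1
    funext j
    simp only [mul_assoc, ← Finset.mul_sum]

theorem outDensity_sum {ι : Type*} [Fintype ι] (n : ℕ) :
    ∀ (c : ι → ℝ) (a : ι → Fin l → ℝ) (z : Fin n → ℝ),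
    outDensity P q n (fun i => ∑ k, c k * a k i) z = ∑ k, c k * outDensity P q n (a k) z := by
  induction n with
  | zero =>
    intro c a z
    simp only [outDensity, Finset.mul_sum]
    exact Finset.sum_comm
  | succ n ih =>
    intro c a z
    simp only [outDensity]
    rw [← ih]
    congr 1
    funext j
    simp only [Finset.sum_mul, Finset.mul_sum]
    rw [Finset.sum_comm]
    exact Finset.sum_congr rfl fun k _ => Finset.sum_congr rfl fun i _ => by ring

theorem outDensity_eq_sum_single (n : ℕ) (a : Fin l → ℝ) (z : Fin n → ℝ) :
    outDensity P q n a z = ∑ k, a k * outDensity P q n (Pi.single k 1) z := by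
  rw [← outDensity_sum]
  congr 1
  funext i
  simp [Pi.single_apply]

theorem outDensity_single_succ (n : ℕ) (i : Fin l) (z : Fin (n + 1) → ℝ) :
    outDensity P q (n + 1) (Pi.single i 1) z =
      ∑ j, P i j * q j (z 0) * outDensity P q n (Pi.single j 1) (Fin.tail z) := by
  rw [outDensity, outDensity_eq_sum_single]
  simp [Pi.single_apply]

theorem measurable_outDensity (hq : ∀ j, Measurable (q j)) {α : Type*} [MeasurableSpace α]
    (n : ℕ) : ∀ {a : α → Fin l → ℝ} {z : α → Fin n → ℝ}, Measurable a → Measurable z →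
      Measurable fun x => outDensity P q n (a x) (z x) := by
  induction n with
  | zero =>
    intro a z ha _
    simp only [outDensity]
    exact Finset.measurable_fun_sum _ fun i _ => (measurable_pi_apply i).comp ha
  | succ n ih =>
    intro a z ha hz
    simp only [outDensity]
    refine ih (measurable_pi_iff.2 fun j => ?_) (measurable_pi_iff.2 fun k => ?_)
    · refine (Finset.measurable_fun_sum _ fun i _ => ?_).mul
        ((hq j).comp ((measurable_pi_apply 0).comp hz))
      exact ((measurable_pi_apply i).comp ha).mul_const _
    · exact (measurable_pi_apply k.succ).comp hz

theorem outDensity_nonneg (hP : ∀ i j, 0 ≤ P i j) (hq : ∀ j z, 0 ≤ q j z) (n : ℕ) :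
    ∀ {a : Fin l → ℝ} (z : Fin n → ℝ), (∀ i, 0 ≤ a i) → 0 ≤ outDensity P q n a z := by
  induction n with
  | zero => exact fun _ ha => Finset.sum_nonneg fun i _ => ha i
  | succ n ih =>
    exact fun z ha => ih _ fun j => mul_nonneg
      (Finset.sum_nonneg fun i _ => mul_nonneg (ha i) (hP i j)) (hq _ _)

theorem outDensity_pos [Nonempty (Fin l)] (hP : ∀ i j, 0 < P i j) (hq : ∀ j z, 0 < q j z)
    (n : ℕ) : ∀ {a : Fin l → ℝ} (z : Fin n → ℝ), (∀ i, 0 < a i) → 0 < outDensity P q n a z := by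
  induction n with
  | zero => exact fun _ ha => Finset.sum_pos (fun i _ => ha i) Finset.univ_nonempty
  | succ n ih =>
    exact fun z ha => ih _ fun j => mul_pos
      (Finset.sum_pos (fun i _ => mul_pos (ha i) (hP i j)) Finset.univ_nonempty) (hq _ _)

/-! ### Expected log-likelihoods -/

/-- The real version of `logSum`. -/
def realLogSum (I : Fin l) (p t : Fin l → ℝ) : ℝ :=
  Real.log (∑ i, Real.exp (t i - t I) * p i)

theorem logSum_ofReal {I : Fin l} {p : Fin l → ℝ} (hp : ∀ i, 0 < p i) (t : Fin l → ℝ) :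
    logSum I (fun i => (p i : ℂ)) (fun i => (t i : ℂ)) = realLogSum I p t := by
  rw [realLogSum, Complex.ofReal_log
    (Finset.sum_nonneg fun i _ => mul_nonneg (Real.exp_pos _).le (hp i).le)]
  simp [logSum]

/-- The real filter recursion in logarithmic coordinates. -/
def realStep (P : Matrix (Fin l) (Fin l) ℝ) (q : Fin l → ℝ → ℝ) (I : Fin l) (z : ℝ)
    (t : Fin l → ℝ) (j : Fin l) : ℝ :=
  realLogSum I (fun i => P i j) t - realLogSum I (fun i => P i I) t + Real.log (q j z / q I z)

/-- The log-likelihood of `n` outputs for the initial law with logarithmic coordinates `t`. -/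
def logLik (P : Matrix (Fin l) (Fin l) ℝ) (q : Fin l → ℝ → ℝ) (I : Fin l) (n : ℕ)
    (t : Fin l → ℝ) (z : Fin n → ℝ) : ℝ :=
  Real.log (outDensity P q n (fun i => Real.exp (t i - t I)) z)

/-- The updated law is a scalar times the exponential of the new coordinates relative to `I`.
Homogeneity of the density pulls the scalar out, and its logarithm is the increment. -/
theorem logLik_succ {I : Fin l} (hP : ∀ i j, 0 < P i j) (hq : ∀ j z, 0 < q j z) (n : ℕ)
    (t : Fin l → ℝ) (z : Fin (n + 1) → ℝ) :
    logLik P q I (n + 1) t z = Real.log (q I (z 0)) + realLogSum I (fun i => P i I) t +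
      logLik P q I n (realStep P q I (z 0) t) (Fin.tail z) := by
  have : Nonempty (Fin l) := ⟨I⟩
  have hpos : ∀ j, 0 < ∑ i, Real.exp (t i - t I) * P i j := fun j =>
    Finset.sum_pos (fun i _ => mul_pos (Real.exp_pos _) (hP i j)) Finset.univ_nonempty
  have key : (fun j => (∑ i, Real.exp (t i - t I) * P i j) * q j (z 0)) =
      fun j => (q I (z 0) * ∑ i, Real.exp (t i - t I) * P i I) *
        Real.exp (realStep P q I (z 0) t j - realStep P q I (z 0) t I) := by
    funext j
    have h1 : realStep P q I (z 0) t j - realStep P q I (z 0) t I =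
        realLogSum I (fun i => P i j) t - realLogSum I (fun i => P i I) t +
          Real.log (q j (z 0) / q I (z 0)) := by
      simp [realStep, div_self (hq I (z 0)).ne']
    rw [h1, Real.exp_add, Real.exp_sub, realLogSum, realLogSum, Real.exp_log (hpos j),
      Real.exp_log (hpos I), Real.exp_log (div_pos (hq _ _) (hq _ _))]
    have := (hpos I).ne'
    have := (hq I (z 0)).ne'
    field_simp
  rw [logLik, outDensity, key, outDensity_smul, Real.log_mul
    (mul_pos (hq _ _) (hpos I)).ne' (outDensity_pos hP hq n _ fun i => Real.exp_pos _).ne',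
    Real.log_mul (hq _ _).ne' (hpos I).ne', realLogSum, logLik]

/-! ### Integrals of log-likelihoods -/

theorem measurePreserving_head_tail (n : ℕ) :
    MeasurePreserving (MeasurableEquiv.piFinSuccAbove (fun _ : Fin (n + 1) => ℝ) 0) volume
      ((volume : Measure ℝ).prod (volume : Measure (Fin n → ℝ))) :=
  volume_preserving_piFinSuccAbove (fun _ => ℝ) 0

theorem integrable_head_tail {n : ℕ} {F : ℝ × (Fin n → ℝ) → ℝ}
    (hF : Integrable F (volume.prod volume)) :
    Integrable fun z : Fin (n + 1) → ℝ => F (z 0, Fin.tail z) :=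
  ((measurePreserving_head_tail n).integrable_comp_emb
    (MeasurableEquiv.measurableEmbedding _)).2 hF

theorem integral_head_tail {n : ℕ} (F : ℝ × (Fin n → ℝ) → ℝ) :
    ∫ z : Fin (n + 1) → ℝ, F (z 0, Fin.tail z) = ∫ p, F p ∂(volume.prod volume) :=
  (measurePreserving_head_tail n).integral_comp' F

theorem integral_sum_head_tail {ι : Type*} [Fintype ι] {n : ℕ} {F : ι → ℝ × (Fin n → ℝ) → ℝ}
    (hF : ∀ j, Integrable (F j) (volume.prod volume)) :
    Integrable (fun z : Fin (n + 1) → ℝ => ∑ j, F j (z 0, Fin.tail z)) ∧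
      ∫ z : Fin (n + 1) → ℝ, ∑ j, F j (z 0, Fin.tail z) =
        ∑ j, ∫ p, F j p ∂(volume.prod volume) := by
  refine ⟨integrable_finsetSum _ fun j _ => integrable_head_tail (hF j), ?_⟩
  rw [integral_finsetSum _ fun j _ => integrable_head_tail (hF j)]
  exact Finset.sum_congr rfl fun j _ => integral_head_tail (F j)

/-- A positive stochastic matrix and positive output densities, with integrable log-densities. -/
structure RealModel (l : ℕ) (I : Fin l) where
  P : Matrix (Fin l) (Fin l) ℝ
  q : Fin l → ℝ → ℝ
  P_pos : ∀ i j, 0 < P i j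
  P_sum : ∀ i, ∑ j, P i j = 1
  q_pos : ∀ j z, 0 < q j z
  q_meas : ∀ j, Measurable (q j)
  q_int : ∀ j, Integrable (q j)
  q_integral : ∀ j, ∫ z, q j z = 1
  q_log : ∀ j, Integrable fun z => q j z * Real.log (q I z)

namespace RealModel

variable {l : ℕ} {I : Fin l} (R : RealModel l I)

/-- The density of `n` outputs when the preceding hidden state is `i`. -/
def dens (n : ℕ) (i : Fin l) (z : Fin n → ℝ) : ℝ := outDensity R.P R.q n (Pi.single i 1) z

theorem dens_nonneg (n : ℕ) (i : Fin l) (z : Fin n → ℝ) : 0 ≤ R.dens n i z :=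
  outDensity_nonneg (fun i j => (R.P_pos i j).le) (fun j z => (R.q_pos j z).le) n z fun j => by
    rw [Pi.single_apply]
    split_ifs <;> norm_num

theorem measurable_dens (n : ℕ) (i : Fin l) : Measurable (R.dens n i) :=
  measurable_outDensity R.q_meas n measurable_const measurable_id

theorem dens_succ (n : ℕ) (i : Fin l) (z : Fin (n + 1) → ℝ) :
    R.dens (n + 1) i z = ∑ j, R.P i j * R.q j (z 0) * R.dens n j (Fin.tail z) :=
  outDensity_single_succ n i z

theorem integrable_dens (n : ℕ) : ∀ i, Integrable (R.dens n i) ∧ ∫ z, R.dens n i z = 1 := by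
  induction n with
  | zero =>
    intro i
    have : R.dens 0 i = fun _ => 1 := by
      funext z
      simp [dens, outDensity]
    rw [this, volume_pi, Measure.pi_of_empty]
    exact ⟨integrable_const _, by simp⟩
  | succ n ih =>
    intro i
    have h1 : ∀ j, Integrable
        (fun p : ℝ × (Fin n → ℝ) => R.P i j * (R.q j p.1 * R.dens n j p.2))
        (volume.prod volume) := fun j => ((R.q_int j).mul_prod (ih j).1).const_mul _
    have h2 : ∀ z : Fin (n + 1) → ℝ, R.dens (n + 1) i z =
        ∑ j, (fun p : ℝ × (Fin n → ℝ) => R.P i j * (R.q j p.1 * R.dens n j p.2))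
          (z 0, Fin.tail z) := fun z => by
      rw [dens_succ]
      exact Finset.sum_congr rfl fun j _ => mul_assoc _ _ _
    have h3 := integral_sum_head_tail h1
    rw [show R.dens (n + 1) i = fun z => _ from funext h2]
    refine ⟨h3.1, h3.2.trans ?_⟩
    rw [← R.P_sum i]
    refine Finset.sum_congr rfl fun j _ => ?_
    rw [integral_const_mul, integral_prod_mul, R.q_integral, (ih j).2]
    ring

/-- The expected log-likelihood of `n` outputs. -/
def expLogLik (n : ℕ) (t : Fin l → ℝ) (i : Fin l) : ℝ :=
  ∫ z, R.dens n i z * logLik R.P R.q I n t z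

theorem measurable_logLik_step (n : ℕ) (t : Fin l → ℝ) :
    Measurable fun p : ℝ × (Fin n → ℝ) =>
      logLik R.P R.q I n (realStep R.P R.q I p.1 t) p.2 := by
  refine Real.measurable_log.comp (measurable_outDensity R.q_meas n
    (measurable_pi_iff.2 fun i => Real.measurable_exp.comp ?_) measurable_snd)
  have h : ∀ i, Measurable fun p : ℝ × (Fin n → ℝ) => realStep R.P R.q I p.1 t i := fun i =>
    measurable_const.add (Real.measurable_log.comp
      (((R.q_meas i).comp measurable_fst).div ((R.q_meas I).comp measurable_fst)))
  exact (h i).sub (h I)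

variable {T : Set (Fin l → ℝ)}

/-- One step of the recursion for the expected log-likelihood. -/
theorem expLogLik_succ (hT : ∀ t ∈ T, ∀ z, realStep R.P R.q I z t ∈ T) {n : ℕ} {c b : ℝ}
    (hint : ∀ t ∈ T, ∀ i, Integrable fun z => R.dens n i z * logLik R.P R.q I n t z)
    (hc : ∀ t ∈ T, ∀ i, ∫ z, |R.dens n i z * logLik R.P R.q I n t z| ≤ c)
    (hb : ∀ t ∈ T, |realLogSum I (fun i => R.P i I) t| ≤ b) {t : Fin l → ℝ} (ht : t ∈ T)
    (i : Fin l) :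
    (Integrable fun z => R.dens (n + 1) i z * logLik R.P R.q I (n + 1) t z) ∧
    (∫ z, |R.dens (n + 1) i z * logLik R.P R.q I (n + 1) t z| ≤
      ∑ j, (∫ z, |R.q j z * Real.log (R.q I z)|) + b + c) ∧
    (∀ j, Integrable fun z => R.q j z * R.expLogLik n (realStep R.P R.q I z t) j) ∧
    R.expLogLik (n + 1) t i = realLogSum I (fun i => R.P i I) t +
      ∑ j, R.P i j * (∫ z, R.q j z * Real.log (R.q I z)) +
      ∑ j, R.P i j * ∫ z, R.q j z * R.expLogLik n (realStep R.P R.q I z t) j := by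
  set γ := realLogSum I (fun i => R.P i I) t
  -- The three terms of `logLik_succ`, weighted by the density of the first output and that of the
  -- remaining ones, for first hidden state `j`.
  set F₁ : Fin l → ℝ × (Fin n → ℝ) → ℝ := fun j p =>
    (R.q j p.1 * Real.log (R.q I p.1)) * R.dens n j p.2 with hF₁
  set F₂ : Fin l → ℝ × (Fin n → ℝ) → ℝ := fun j p => (R.q j p.1 * γ) * R.dens n j p.2 with hF₂
  set F₃ : Fin l → ℝ × (Fin n → ℝ) → ℝ := fun j p => R.q j p.1 *
    (R.dens n j p.2 * logLik R.P R.q I n (realStep R.P R.q I p.1 t) p.2) with hF₃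
  have h1 : ∀ j, Integrable (F₁ j) (volume.prod volume) := fun j =>
    (R.q_log j).mul_prod (R.integrable_dens n j).1
  have h2 : ∀ j, Integrable (F₂ j) (volume.prod volume) := fun j =>
    ((R.q_int j).mul_const γ).mul_prod (R.integrable_dens n j).1
  have hF₃m : ∀ j, AEStronglyMeasurable (F₃ j) (volume.prod volume) := fun j =>
    (((R.q_meas j).comp measurable_fst).mul (((R.measurable_dens n j).comp measurable_snd).mul
      (R.measurable_logLik_step n t))).aestronglyMeasurable
  have h3b : ∀ j z, ∫ z', ‖F₃ j (z, z')‖ ≤ R.q j z * c := fun j z => by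
    simp only [hF₃, norm_mul, integral_const_mul]
    rw [Real.norm_of_nonneg (R.q_pos j z).le]
    refine mul_le_mul_of_nonneg_left ?_ (R.q_pos j z).le
    simpa [abs_mul] using hc _ (hT t ht z) j
  -- The inner integral depends on the first output through the new coordinates, so integrability on
  -- the product needs an `L¹` bound uniform over `T`.
  have h3 : ∀ j, Integrable (F₃ j) (volume.prod volume) := fun j => by
    rw [integrable_prod_iff (hF₃m j)]
    refine ⟨Eventually.of_forall fun z => ?_, ?_⟩
    · simp only [hF₃]
      exact (hint _ (hT t ht z) j).const_mul _
    refine ((R.q_int j).mul_const c).mono' (hF₃m j).norm.integral_prod_right'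
      (Eventually.of_forall fun z => ?_)
    rw [Real.norm_of_nonneg (integral_nonneg fun _ => norm_nonneg _)]
    exact h3b j z
  have heq : ∀ z : Fin (n + 1) → ℝ, R.dens (n + 1) i z * logLik R.P R.q I (n + 1) t z =
      ∑ j, (fun p => R.P i j * (F₁ j p + F₂ j p + F₃ j p)) (z 0, Fin.tail z) := fun z => by
    rw [dens_succ, logLik_succ R.P_pos R.q_pos, Finset.sum_mul]
    refine Finset.sum_congr rfl fun j _ => ?_
    simp only [hF₁, hF₂, hF₃]
    ring
  have hF : ∀ j, Integrable (fun p => R.P i j * (F₁ j p + F₂ j p + F₃ j p))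
      (volume.prod volume) := fun j => (((h1 j).add (h2 j)).add (h3 j)).const_mul _
  have hqe : ∀ j z, ∫ z', F₃ j (z, z') =
      R.q j z * R.expLogLik n (realStep R.P R.q I z t) j := fun j z => by
    simp only [hF₃, integral_const_mul, expLogLik]
  refine ⟨?_, ?_, fun j => ?_, ?_⟩
  · simp only [heq]
    exact (integral_sum_head_tail hF).1
  · have habs : ∀ j, ∫ p, |F₁ j p + F₂ j p + F₃ j p| ∂(volume.prod volume) ≤
        (∫ z, |R.q j z * Real.log (R.q I z)|) + b + c := fun j => by
      have e1 : ∫ p, |F₁ j p| ∂(volume.prod volume) = ∫ z, |R.q j z * Real.log (R.q I z)| := by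
        simp only [hF₁, abs_mul _ (R.dens n j _), abs_of_nonneg (R.dens_nonneg n j _)]
        rw [integral_prod_mul (fun z => |R.q j z * Real.log (R.q I z)|) (R.dens n j),
          (R.integrable_dens n j).2, mul_one]
      have e2 : ∫ p, |F₂ j p| ∂(volume.prod volume) ≤ b := by
        simp only [hF₂, abs_mul, abs_of_nonneg (R.dens_nonneg n j _),
          abs_of_pos (R.q_pos j _)]
        rw [integral_prod_mul (fun z => R.q j z * |γ|) (R.dens n j),
          (R.integrable_dens n j).2, mul_one, integral_mul_const, R.q_integral, one_mul]
        exact hb t ht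
      have e3 : ∫ p, |F₃ j p| ∂(volume.prod volume) ≤ c := by
        rw [integral_prod _ (h3 j).abs]
        calc _ ≤ ∫ z, R.q j z * c :=
              integral_mono (h3 j).abs.integral_prod_left ((R.q_int j).mul_const c) (h3b j)
          _ = c := by rw [integral_mul_const, R.q_integral, one_mul]
      calc _ ≤ ∫ p, (|F₁ j p| + |F₂ j p|) + |F₃ j p| ∂(volume.prod volume) := by
            refine integral_mono (((h1 j).add (h2 j)).add (h3 j)).abs
              (((h1 j).abs.add (h2 j).abs).add (h3 j).abs) fun p => ?_
            exact (abs_add_le _ _).trans (add_le_add (abs_add_le _ _) le_rfl)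
        _ = (∫ p, |F₁ j p| ∂(volume.prod volume)) + (∫ p, |F₂ j p| ∂(volume.prod volume)) +
            ∫ p, |F₃ j p| ∂(volume.prod volume) := by
            have h12 : Integrable (fun p => |F₁ j p| + |F₂ j p|) (volume.prod volume) :=
              (h1 j).abs.add (h2 j).abs
            rw [integral_add h12 (h3 j).abs, integral_add (h1 j).abs (h2 j).abs]
        _ ≤ _ := by linarith
    have hP1 : ∀ j, R.P i j ≤ 1 := fun j => by
      rw [← R.P_sum i]
      exact Finset.single_le_sum (f := fun j => R.P i j) (fun j _ => (R.P_pos i j).le)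
        (Finset.mem_univ j)
    have hFa : ∀ j, Integrable (fun p => R.P i j * |F₁ j p + F₂ j p + F₃ j p|)
        (volume.prod volume) := fun j => (((h1 j).add (h2 j)).add (h3 j)).abs.const_mul _
    calc _ ≤ ∫ z : Fin (n + 1) → ℝ, ∑ j,
          (fun p => R.P i j * |F₁ j p + F₂ j p + F₃ j p|) (z 0, Fin.tail z) := by
          refine integral_mono ?_ ?_ fun z => ?_
          · simp only [heq]
            exact (integral_sum_head_tail hF).1.abs
          · exact (integral_sum_head_tail hFa).1
          · simp only [heq]
            refine (Finset.abs_sum_le_sum_abs _ _).trans (Finset.sum_le_sum fun j _ => ?_)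
            rw [abs_mul, abs_of_pos (R.P_pos i j)]
      _ = ∑ j, R.P i j * ∫ p, |F₁ j p + F₂ j p + F₃ j p| ∂(volume.prod volume) := by
          refine (integral_sum_head_tail hFa).2.trans (Finset.sum_congr rfl fun j _ => ?_)
          rw [integral_const_mul]
      _ ≤ ∑ j, R.P i j * ((∫ z, |R.q j z * Real.log (R.q I z)|) + b + c) :=
          Finset.sum_le_sum fun j _ => mul_le_mul_of_nonneg_left (habs j) (R.P_pos i j).le
      _ = ∑ j, R.P i j * (∫ z, |R.q j z * Real.log (R.q I z)|) + b + c := by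
          simp only [add_assoc, mul_add _ _ (b + c)]
          rw [Finset.sum_add_distrib, ← Finset.sum_mul, R.P_sum, one_mul]
      _ ≤ _ := by
          gcongr with j _
          exact mul_le_of_le_one_left (integral_nonneg fun _ => abs_nonneg _) (hP1 j)
  · simp only [← hqe]
    exact (h3 j).integral_prod_left
  · rw [expLogLik]
    simp only [heq]
    refine (integral_sum_head_tail hF).2.trans ?_
    have e : ∀ j, ∫ p, R.P i j * (F₁ j p + F₂ j p + F₃ j p) ∂(volume.prod volume) =
        R.P i j * γ + R.P i j * (∫ z, R.q j z * Real.log (R.q I z)) +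
          R.P i j * ∫ z, R.q j z * R.expLogLik n (realStep R.P R.q I z t) j := fun j => by
      have h12 : Integrable (fun p => F₁ j p + F₂ j p) (volume.prod volume) := (h1 j).add (h2 j)
      rw [integral_const_mul, integral_add h12 (h3 j),
        integral_add (h1 j) (h2 j), integral_prod _ (h3 j)]
      simp only [hqe]
      simp only [hF₁, hF₂]
      rw [integral_prod_mul (fun z => R.q j z * Real.log (R.q I z)) (R.dens n j),
        integral_prod_mul (fun z => R.q j z * γ) (R.dens n j),
        (R.integrable_dens n j).2, integral_mul_const, R.q_integral]
      ring
    simp only [e]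
    rw [Finset.sum_add_distrib, Finset.sum_add_distrib, ← Finset.sum_mul, R.P_sum, one_mul]

end RealModel

/-! ### The entropy rate as a limit of the contractive system -/

/-- The contractive system `S` at the parameter `w` is the complexification of `R`. -/
structure IsRealPoint {l : ℕ} {W : Type*} [NormedAddCommGroup W] [NormedSpace ℂ W] {I : Fin l}
    (S : ContractiveSystem l W) (w : W) (R : RealModel l I) : Prop where
  mem : w ∈ S.U
  weight : ∀ i j z, S.weight w i j z = ((R.P i j * R.q j z : ℝ) : ℂ)
  step : ∀ (t : Fin l → ℝ) z,
    S.step w z (fun i => (t i : ℂ)) = fun i => (realStep R.P R.q I z t i : ℂ)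
  start : ∀ (t : Fin l → ℝ) i, S.start w (fun i => (t i : ℂ)) i =
    ((realLogSum I (fun i => R.P i I) t +
      ∑ j, R.P i j * ∫ z, R.q j z * Real.log (R.q I z) : ℝ) : ℂ)

namespace IsRealPoint

variable {l : ℕ} {W : Type*} [NormedAddCommGroup W] [NormedSpace ℂ W] {I : Fin l}
  {S : ContractiveSystem l W} {w : W} {R : RealModel l I} (h : IsRealPoint S w R)
include h

theorem realStep_mem {t : Fin l → ℝ} (ht : (fun i => (t i : ℂ)) ∈ S.X) (z : ℝ) :
    (fun i => (realStep R.P R.q I z t i : ℂ)) ∈ S.X := by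
  rw [← h.step]
  exact S.step_mem w h.mem z _ ht

/-- The starting function is this quantity plus a constant independent of `t`, so its bound
transfers. -/
theorem exists_abs_realLogSum_le : ∃ b, ∀ t : Fin l → ℝ, (fun i => (t i : ℂ)) ∈ S.X →
    |realLogSum I (fun i => R.P i I) t| ≤ b := by
  set x := ∑ j, R.P I j * ∫ z, R.q j z * Real.log (R.q I z)
  refine ⟨S.B + |x|, fun t ht => ?_⟩
  have h1 := S.start_le w h.mem _ ht I
  rw [h.start, Complex.norm_real, Real.norm_eq_abs] at h1
  have h2 := abs_sub (realLogSum I (fun i => R.P i I) t + x) x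
  rw [add_sub_cancel_right] at h2
  linarith

omit h in
-- The sum `∑ i, exp (t i - t I)` is at least its term `i = I`, which is 1, and at most `l * exp M`.
theorem abs_logLik_zero_le {t : Fin l → ℝ} (ht : (fun i => (t i : ℂ)) ∈ S.X) (z : Fin 0 → ℝ) :
    |logLik R.P R.q I 0 t z| ≤ |Real.log (l * Real.exp S.M)| := by
  have h1 : ∀ i, t i - t I ≤ S.M := fun i => by
    have := S.norm_sub_le _ ht i I
    rw [← Complex.ofReal_sub, Complex.norm_real] at this
    exact (le_abs_self _).trans this
  have h2 : ∑ i, Real.exp (t i - t I) ≤ l * Real.exp S.M := by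
    refine (Finset.sum_le_sum fun i _ => Real.exp_le_exp.2 (h1 i)).trans ?_
    simp
  have h3 : 1 ≤ ∑ i, Real.exp (t i - t I) := by
    have := Finset.single_le_sum (f := fun i => Real.exp (t i - t I))
      (fun i _ => (Real.exp_pos _).le) (Finset.mem_univ I)
    simpa using this
  rw [logLik, outDensity, abs_of_nonneg (Real.log_nonneg h3)]
  exact (Real.log_le_log (by linarith) h2).trans (le_abs_self _)

omit h in
theorem dens_zero (i : Fin l) (z : Fin 0 → ℝ) : R.dens 0 i z = 1 := by
  simp [RealModel.dens, outDensity]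

theorem integrable_logLik (n : ℕ) : ∃ c, ∀ t : Fin l → ℝ, (fun i => (t i : ℂ)) ∈ S.X →
    ∀ i, (Integrable fun z => R.dens n i z * logLik R.P R.q I n t z) ∧
      ∫ z, |R.dens n i z * logLik R.P R.q I n t z| ≤ c := by
  induction n with
  | zero =>
    refine ⟨|Real.log (l * Real.exp S.M)|, fun t ht i => ?_⟩
    have hc : ∀ z : Fin 0 → ℝ, R.dens 0 i z * logLik R.P R.q I 0 t z =
        logLik R.P R.q I 0 t 0 := fun z => by
      rw [dens_zero, one_mul, Subsingleton.elim z 0]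
    simp only [hc]
    rw [volume_pi, Measure.pi_of_empty]
    refine ⟨integrable_const _, ?_⟩
    simpa using abs_logLik_zero_le ht 0
  | succ n ih =>
    obtain ⟨c, hc⟩ := ih
    obtain ⟨b, hb⟩ := h.exists_abs_realLogSum_le
    refine ⟨∑ j, (∫ z, |R.q j z * Real.log (R.q I z)|) + b + c, fun t ht i => ?_⟩
    have := R.expLogLik_succ (T := {t | (fun i => (t i : ℂ)) ∈ S.X})
      (fun t ht z => h.realStep_mem ht z) (fun t ht i => (hc t ht i).1)
      (fun t ht i => (hc t ht i).2) hb ht i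
    exact ⟨this.1, this.2.1⟩

/-- Both quantities obey the same recursion with the same source term. At a real point the averaging
has total mass 1, so the discrepancy present at `n = 0` is never amplified. -/
theorem norm_expLogLik_sub_le [FiniteDimensional ℂ W] (n : ℕ) :
    ∀ t : Fin l → ℝ, (fun i => (t i : ℂ)) ∈ S.X → ∀ i,
    ‖(R.expLogLik n t i : ℂ) - ∑ k ∈ Finset.range n, S.iter k w (fun i => (t i : ℂ)) i‖ ≤
      |Real.log (l * Real.exp S.M)| := by
  induction n with
  | zero =>
    intro t ht i
    have hc : ∀ z : Fin 0 → ℝ, R.dens 0 i z * logLik R.P R.q I 0 t z =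
        logLik R.P R.q I 0 t 0 := fun z => by
      rw [dens_zero, one_mul, Subsingleton.elim z 0]
    rw [RealModel.expLogLik]
    simp only [hc]
    rw [volume_pi, Measure.pi_of_empty]
    simpa using abs_logLik_zero_le ht 0
  | succ n ih =>
    intro t ht i
    set C := |Real.log (l * Real.exp S.M)|
    obtain ⟨c, hc⟩ := h.integrable_logLik n
    obtain ⟨b, hb⟩ := h.exists_abs_realLogSum_le
    obtain ⟨-, -, h3, h4⟩ := R.expLogLik_succ (T := {t | (fun i => (t i : ℂ)) ∈ S.X})
      (fun t ht z => h.realStep_mem ht z) (fun t ht i => (hc t ht i).1)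
      (fun t ht i => (hc t ht i).2) hb ht i
    have hk : ∀ k j, Integrable fun z => ((R.P i j * R.q j z : ℝ) : ℂ) *
        S.iter k w (fun i => (realStep R.P R.q I z t i : ℂ)) j := fun k j => by
      have := S.integrable_weight_mul_iter k h.mem ht i j
      simpa only [h.weight, h.step] using this
    have hsum : ∑ k ∈ Finset.range (n + 1), S.iter k w (fun i => (t i : ℂ)) i =
        S.start w (fun i => (t i : ℂ)) i + ∑ j, ∫ z, ((R.P i j * R.q j z : ℝ) : ℂ) *
          ∑ k ∈ Finset.range n, S.iter k w (fun i => (realStep R.P R.q I z t i : ℂ)) j := by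
      rw [Finset.sum_range_succ', S.iter_zero, add_comm]
      congr 1
      simp only [S.iter_succ, h.weight, h.step]
      rw [Finset.sum_comm]
      refine Finset.sum_congr rfl fun j _ => ?_
      rw [← integral_finsetSum _ fun k _ => hk k j]
      simp only [Finset.mul_sum]
    have hE : ∀ j, ((R.P i j * ∫ z, R.q j z * R.expLogLik n (realStep R.P R.q I z t) j : ℝ) : ℂ) =
        ∫ z, ((R.P i j * R.q j z : ℝ) : ℂ) * (R.expLogLik n (realStep R.P R.q I z t) j : ℂ) :=
      fun j => by
        rw [← integral_const_mul, ← integral_complex_ofReal]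
        refine integral_congr_ae (Eventually.of_forall fun z => ?_)
        push_cast
        ring
    have hEi : ∀ j, Integrable fun z => ((R.P i j * R.q j z : ℝ) : ℂ) *
        (R.expLogLik n (realStep R.P R.q I z t) j : ℂ) := fun j => by
      have := ((h3 j).const_mul (R.P i j)).ofReal (𝕜 := ℂ)
      refine this.congr (Eventually.of_forall fun z => ?_)
      simp only [Complex.coe_algebraMap, RCLike.ofReal_mul, Complex.ofReal_mul, mul_assoc]
    have hSi : ∀ j, Integrable fun z => ((R.P i j * R.q j z : ℝ) : ℂ) *
        ∑ k ∈ Finset.range n, S.iter k w (fun i => (realStep R.P R.q I z t i : ℂ)) j := fun j => by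
      simp only [Finset.mul_sum]
      exact integrable_finsetSum _ fun k _ => hk k j
    have hdiff : (R.expLogLik (n + 1) t i : ℂ) -
        ∑ k ∈ Finset.range (n + 1), S.iter k w (fun i => (t i : ℂ)) i =
        ∑ j, ∫ z, ((R.P i j * R.q j z : ℝ) : ℂ) *
          ((R.expLogLik n (realStep R.P R.q I z t) j : ℂ) -
          ∑ k ∈ Finset.range n, S.iter k w (fun i => (realStep R.P R.q I z t i : ℂ)) j) := by
      simp only [mul_sub]
      rw [Finset.sum_congr rfl fun j _ => integral_sub (hEi j) (hSi j), Finset.sum_sub_distrib,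
        hsum, h.start, h4, Complex.ofReal_add _ (∑ j, _), Complex.ofReal_sum,
        Finset.sum_congr rfl fun j _ => hE j]
      ring
    rw [hdiff]
    calc _ ≤ ∑ j, R.P i j * C := by
          refine (norm_sum_le _ _).trans (Finset.sum_le_sum fun j _ => ?_)
          have e : R.P i j * C = ∫ z, R.P i j * R.q j z * C := by
            rw [integral_mul_const, integral_const_mul, R.q_integral, mul_one]
          rw [e]
          refine norm_integral_le_of_norm_le (((R.q_int j).const_mul _).mul_const C)
            (Eventually.of_forall fun z => ?_)
          have hpos := mul_pos (R.P_pos i j) (R.q_pos j z)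
          rw [norm_mul, Complex.norm_real, Real.norm_of_nonneg hpos.le]
          exact mul_le_mul_of_nonneg_left (ih _ (h.realStep_mem ht z) j) hpos.le
      _ = C := by rw [← Finset.sum_mul, R.P_sum, one_mul]

omit h in
theorem stationary_eq {v : Fin l → ℝ} (hv : IsStationaryVector R.P v) :
    v = fun j => ∑ i, v i * R.P i j := by
  funext j
  conv_lhs => rw [← hv.2]
  rfl

omit h in
theorem stationary_pos {v : Fin l → ℝ} (hv : IsStationaryVector R.P v) (j : Fin l) : 0 < v j := by
  rw [stationary_eq hv]
  obtain ⟨i, hi⟩ : ∃ i, 0 < v i := by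
    by_contra! hcon
    have := Finset.sum_nonpos fun i (_ : i ∈ Finset.univ) => hcon i
    rw [hv.1.2] at this
    linarith
  exact Finset.sum_pos' (fun k _ => mul_nonneg (hv.1.1 k) (R.P_pos k j).le)
    ⟨i, Finset.mem_univ i, mul_pos hi (R.P_pos i j)⟩

omit h in
-- By stationarity the chain may be started one step earlier, and the density becomes a mixture over
-- that earlier state. Coordinates relative to `I` lose the scalar `v I`, whence the extra `log (v
-- I)`.
theorem blockDensity_mul_log {v : Fin l → ℝ} (hv : IsStationaryVector R.P v) (n : ℕ)
    (z : Fin (n + 1) → ℝ) :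
    blockDensity v R.P R.q n z * Real.log (blockDensity v R.P R.q n z) =
      ∑ i, (v i * (R.dens (n + 1) i z * logLik R.P R.q I (n + 1) (fun i => Real.log (v i)) z) +
        v i * Real.log (v I) * R.dens (n + 1) i z) := by
  have : Nonempty (Fin l) := ⟨I⟩
  have hpos := stationary_pos hv
  have h1 : blockDensity v R.P R.q n z = outDensity R.P R.q (n + 1) v z := by
    conv_lhs => rw [stationary_eq hv]
    exact blockDensity_vecMul n v z
  have h2 : outDensity R.P R.q (n + 1) v z = v I * outDensity R.P R.q (n + 1)
      (fun i => Real.exp (Real.log (v i) - Real.log (v I))) z := by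
    rw [← outDensity_smul]
    congr 1
    funext i
    rw [Real.exp_sub, Real.exp_log (hpos _), Real.exp_log (hpos _)]
    field_simp [(hpos I).ne']
  have h3 : Real.log (blockDensity v R.P R.q n z) = Real.log (v I) +
      logLik R.P R.q I (n + 1) (fun i => Real.log (v i)) z := by
    rw [h1, h2, Real.log_mul (hpos I).ne' (outDensity_pos R.P_pos R.q_pos _ _
      fun i => Real.exp_pos _).ne', logLik]
  rw [h3, h1, outDensity_eq_sum_single, Finset.sum_mul]
  refine Finset.sum_congr rfl fun i _ => ?_
  simp only [RealModel.dens]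
  ring

/-- The entropy rate exists and is given by the limit of the contractive system. -/
theorem hasEntropyRate [FiniteDimensional ℂ W] {v : Fin l → ℝ} (hv : IsStationaryVector R.P v)
    (hvX : (fun i => (Real.log (v i) : ℂ)) ∈ S.X) :
    HasEntropyRate v R.P R.q ∧
      entropyRate v R.P R.q = -(∑ i, (v i : ℂ) * S.limit w i).re := by
  set t : Fin l → ℝ := fun i => Real.log (v i) with ht
  set C := |Real.log (l * Real.exp S.M)|
  have hint : ∀ n i, Integrable fun z => v i * (R.dens (n + 1) i z *
      logLik R.P R.q I (n + 1) t z) + v i * Real.log (v I) * R.dens (n + 1) i z := fun n i => by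
    obtain ⟨c, hc⟩ := h.integrable_logLik (n + 1)
    exact ((hc t hvX i).1.const_mul _).add ((R.integrable_dens (n + 1) i).1.const_mul _)
  have hent : ∀ n, blockEntropy v R.P R.q n =
      -(∑ i, v i * R.expLogLik (n + 1) t i + Real.log (v I)) := fun n => by
    rw [blockEntropy]
    simp only [blockDensity_mul_log hv]
    rw [integral_finsetSum _ fun i _ => hint n i]
    congr 1
    have e : ∀ i, ∫ z, v i * (R.dens (n + 1) i z * logLik R.P R.q I (n + 1) t z) +
        v i * Real.log (v I) * R.dens (n + 1) i z =
        v i * R.expLogLik (n + 1) t i + v i * Real.log (v I) := fun i => by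
      obtain ⟨c, hc⟩ := h.integrable_logLik (n + 1)
      rw [integral_add ((hc t hvX i).1.const_mul _)
        ((R.integrable_dens (n + 1) i).1.const_mul _), integral_const_mul, integral_const_mul,
        (R.integrable_dens (n + 1) i).2, mul_one, RealModel.expLogLik]
    simp only [e]
    rw [Finset.sum_add_distrib, ← Finset.sum_mul, hv.1.2, one_mul]
  -- Cesàro means of the averaged iterates
  set a : ℕ → ℂ := fun k => ∑ i, (v i : ℂ) * S.iter k w (fun i => (t i : ℂ)) i with ha
  have hstat : ∀ j, ∑ i, (v i : ℂ) * ∫ z, S.weight w i j z = v j := fun j => by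
    have e : ∀ i, ∫ z, S.weight w i j z = (R.P i j : ℂ) := fun i => by
      simp only [h.weight]
      rw [integral_complex_ofReal, integral_const_mul, R.q_integral, mul_one]
    simp only [e]
    conv_rhs => rw [stationary_eq hv]
    push_cast
    rfl
  have hlim : Tendsto a atTop (𝓝 (∑ i, (v i : ℂ) * S.limit w i)) :=
    S.tendsto_sum_iter h.mem hstat hvX
  -- The shift accounts for the `n + 1` outputs of the block with index `n`.
  have hces := (hlim.cesaro_smul).comp (tendsto_add_atTop_nat 1)
  have hbound : ∀ n, ‖(blockEntropy v R.P R.q n : ℂ) + ∑ k ∈ Finset.range (n + 1), a k‖ ≤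
      C + |Real.log (v I)| := fun n => by
    have e : (blockEntropy v R.P R.q n : ℂ) + ∑ k ∈ Finset.range (n + 1), a k =
        -(∑ i, (v i : ℂ) * ((R.expLogLik (n + 1) t i : ℂ) -
          ∑ k ∈ Finset.range (n + 1), S.iter k w (fun i => (t i : ℂ)) i)) -
          (Real.log (v I) : ℂ) := by
      rw [hent, ha, Finset.sum_comm]
      simp only [← Finset.mul_sum, mul_sub, Finset.sum_sub_distrib]
      push_cast
      ring
    rw [e]
    refine (norm_sub_le _ _).trans (add_le_add ?_ (by rw [Complex.norm_real, Real.norm_eq_abs]))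
    rw [norm_neg]
    calc _ ≤ ∑ i, v i * C := by
          refine (norm_sum_le _ _).trans (Finset.sum_le_sum fun i _ => ?_)
          rw [norm_mul, Complex.norm_real, Real.norm_of_nonneg (hv.1.1 i)]
          exact mul_le_mul_of_nonneg_left (h.norm_expLogLik_sub_le (n + 1) t hvX i) (hv.1.1 i)
      _ = C := by rw [← Finset.sum_mul, hv.1.2, one_mul]
  have hmain : Tendsto (fun n : ℕ => ((blockEntropy v R.P R.q n / ((n : ℝ) + 1) : ℝ) : ℂ)) atTop
      (𝓝 (-∑ i, (v i : ℂ) * S.limit w i)) := by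
    have hz : Tendsto (fun n : ℕ => ((n : ℝ) + 1)⁻¹ •
        ((blockEntropy v R.P R.q n : ℂ) + ∑ k ∈ Finset.range (n + 1), a k)) atTop (𝓝 0) := by
      have h0 : Tendsto (fun n : ℕ => ((n : ℝ) + 1)⁻¹ * (C + |Real.log (v I)|)) atTop (𝓝 0) := by
        have : Tendsto (fun n : ℕ => ((n : ℝ) + 1)⁻¹) atTop (𝓝 0) := by
          simpa using tendsto_one_div_add_atTop_nhds_zero_nat (𝕜 := ℝ)
        simpa using this.mul_const (C + |Real.log (v I)|)
      refine squeeze_zero_norm (fun n => ?_) h0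
      have hn : (0 : ℝ) ≤ ((n : ℝ) + 1)⁻¹ := by positivity
      rw [norm_smul, Real.norm_of_nonneg hn]
      exact mul_le_mul_of_nonneg_left (hbound n) hn
    have := hz.sub hces
    rw [zero_sub] at this
    refine this.congr fun n => ?_
    simp only [Function.comp_apply, smul_add, Nat.cast_add, Nat.cast_one, add_sub_cancel_right]
    rw [Complex.real_smul]
    push_cast
    field_simp
  have hre : Tendsto (fun n : ℕ => blockEntropy v R.P R.q n / ((n : ℝ) + 1)) atTop
      (𝓝 (-(∑ i, (v i : ℂ) * S.limit w i).re)) := by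
    have := (Complex.continuous_re.tendsto _).comp hmain
    simpa only [Function.comp_def, Complex.ofReal_re, Complex.neg_re] using this
  refine ⟨⟨fun n => ?_, _, hre⟩, hre.limUnder_eq⟩
  simp only [blockDensity_mul_log hv]
  exact integrable_finsetSum _ fun i _ => hint n i

end IsRealPoint

/-! ### Analyticity of the stationary vector -/

theorem analyticAt_det {F : Type*} [NormedAddCommGroup F] [NormedSpace ℝ F] {l : ℕ}
    {A : F → Matrix (Fin l) (Fin l) ℝ} {x : F} (hA : ∀ i j, AnalyticAt ℝ (fun y => A y i j) x) :
    AnalyticAt ℝ (fun y => (A y).det) x := by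
  simp only [Matrix.det_apply']
  refine Finset.analyticAt_fun_sum _ fun σ _ => analyticAt_const.mul ?_
  exact Finset.analyticAt_fun_prod _ fun i _ => hA _ _

/-- Cramer's rule: entries of the inverse are quotients of determinants. -/
theorem analyticAt_inv_apply {F : Type*} [NormedAddCommGroup F] [NormedSpace ℝ F] {l : ℕ}
    {A : F → Matrix (Fin l) (Fin l) ℝ} {x : F} (hA : ∀ i j, AnalyticAt ℝ (fun y => A y i j) x)
    (hdet : (A x).det ≠ 0) (i j : Fin l) : AnalyticAt ℝ (fun y => (A y)⁻¹ i j) x := by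
  simp only [Matrix.inv_def, Ring.inverse_eq_inv', Matrix.smul_apply, smul_eq_mul,
    Matrix.adjugate_apply]
  refine ((analyticAt_det hA).inv hdet).mul (analyticAt_det fun a b => ?_)
  simp only [Matrix.updateRow_apply]
  split_ifs
  · exact analyticAt_const
  · exact hA a b

/-- The matrix that determines the stationary vector of a stochastic matrix. -/
def stationaryMatrix {l : ℕ} (P : Matrix (Fin l) (Fin l) ℝ) : Matrix (Fin l) (Fin l) ℝ :=
  1 - P + Matrix.of fun _ _ => 1

theorem vecMul_stationaryMatrix {l : ℕ} {P : Matrix (Fin l) (Fin l) ℝ} {v : Fin l → ℝ}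
    (hv : IsStationaryVector P v) : Matrix.vecMul v (stationaryMatrix P) = fun _ => 1 := by
  rw [stationaryMatrix, Matrix.vecMul_add, Matrix.vecMul_sub, Matrix.vecMul_one, hv.2, sub_self,
    zero_add]
  funext j
  simp [Matrix.vecMul, dotProduct, hv.1.2]

/-- A kernel vector has zero sum, as seen by pairing with `v`; it is then fixed by `P`. By the
maximum principle for positive rows it is constant, hence zero. -/
theorem det_stationaryMatrix_ne_zero {l : ℕ} {P : Matrix (Fin l) (Fin l) ℝ} {v : Fin l → ℝ}
    (hP : ∀ i j, 0 < P i j) (hP1 : ∀ i, ∑ j, P i j = 1) (hv : IsStationaryVector P v) :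
    (stationaryMatrix P).det ≠ 0 := by
  intro hdet
  obtain ⟨y, hy0, hy⟩ := Matrix.exists_mulVec_eq_zero_iff.2 hdet
  have hsum : ∑ i, y i = 0 := by
    have h1 := Matrix.dotProduct_mulVec v (stationaryMatrix P) y
    rw [hy, vecMul_stationaryMatrix hv, dotProduct_zero] at h1
    simpa [dotProduct] using h1.symm
  have hfix : ∀ i, ∑ k, P i k * y k = y i := fun i => by
    have h1 := congrFun hy i
    rw [stationaryMatrix, Matrix.add_mulVec, Matrix.sub_mulVec, Matrix.one_mulVec] at h1
    simp only [Pi.add_apply, Pi.sub_apply, Matrix.mulVec, dotProduct, Matrix.of_apply, one_mul,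
      hsum, add_zero, Pi.zero_apply] at h1
    linarith
  refine hy0 (funext fun k₀ => ?_)
  have : Nonempty (Fin l) := ⟨k₀⟩
  obtain ⟨i, hi⟩ := Finite.exists_max y
  have hconst : ∀ k, y k = y i := by
    have h0 : ∑ k, P i k * (y i - y k) = 0 := by
      simp only [mul_sub, Finset.sum_sub_distrib, hfix, ← Finset.sum_mul, hP1, one_mul, sub_self]
    intro k
    have h1 := (Finset.sum_eq_zero_iff_of_nonneg fun k _ =>
      mul_nonneg (hP i k).le (sub_nonneg.2 (hi k))).1 h0 k (Finset.mem_univ k)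
    have := (mul_eq_zero.1 h1).resolve_left (hP i k).ne'
    linarith
  have hl : (l : ℝ) * y i = 0 := by
    rw [← hsum, Finset.sum_congr rfl fun k _ => hconst k]
    simp
  have hl0 : (l : ℝ) ≠ 0 := by
    have := k₀.pos
    positivity
  rw [hconst k₀, (mul_eq_zero.1 hl).resolve_left hl0, Pi.zero_apply]

/-- Near `x`, the stationary vector is the all-ones row times the inverse of `stationaryMatrix`. -/
theorem analyticAt_stationary {F : Type*} [NormedAddCommGroup F] [NormedSpace ℝ F] {l : ℕ}
    {P : F → Matrix (Fin l) (Fin l) ℝ} {v : F → Fin l → ℝ} {x : F}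
    (hPan : ∀ i j, AnalyticAt ℝ (fun y => P y i j) x) (hP : ∀ i j, 0 < P x i j)
    (hP1 : ∀ i, ∑ j, P x i j = 1) (hv : ∀ᶠ y in 𝓝 x, IsStationaryVector (P y) (v y))
    (i : Fin l) : AnalyticAt ℝ (fun y => v y i) x := by
  have hA : ∀ i j, AnalyticAt ℝ (fun y => stationaryMatrix (P y) i j) x := fun i j =>
    (analyticAt_const.sub (hPan i j)).add analyticAt_const
  have hdet := det_stationaryMatrix_ne_zero hP hP1 hv.self_of_nhds
  have hinv : AnalyticAt ℝ (fun y => ∑ k, (stationaryMatrix (P y))⁻¹ k i) x :=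
    Finset.analyticAt_fun_sum _ fun k _ => analyticAt_inv_apply hA hdet k i
  refine hinv.congr ?_
  filter_upwards [hv, (analyticAt_det hA).continuousAt.eventually_ne hdet] with y hy hdy
  have h1 : Matrix.vecMul (fun _ => 1) (stationaryMatrix (P y))⁻¹ = v y := by
    rw [← vecMul_stationaryMatrix hy, Matrix.vecMul_vecMul,
      Matrix.mul_nonsing_inv _ (isUnit_iff_ne_zero.2 hdy), Matrix.vecMul_one]
  rw [← h1]
  simp [Matrix.vecMul, dotProduct]

/-! ### Analyticity of the entropy rate -/

theorem abs_log_sub_log_lt {m a b : ℝ} (hm : 0 < m) (ha : m ≤ a) (ha1 : a ≤ 1) (hb : m ≤ b)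
    (hb1 : b ≤ 1) : |Real.log a - Real.log b| < 1 - Real.log m := by
  have h1 := Real.log_le_log hm ha
  have h2 := Real.log_le_log hm hb
  have h3 := Real.log_nonpos (hm.le.trans ha) ha1
  have h4 := Real.log_nonpos (hm.le.trans hb) hb1
  rw [abs_lt]
  constructor <;> linarith

/-- The entropy rate of a hidden Markov chain with a regular channel is analytic. -/
theorem entropyRateAnalyticAt_of_regularChannel {l : ℕ} {F₁ F₂ E : Type*}
    [NormedAddCommGroup F₁] [NormedSpace ℝ F₁] [NormedAddCommGroup F₂] [NormedSpace ℝ F₂]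
    [NormedAddCommGroup E] [NormedSpace ℂ E] [NormedSpace ℝ E] [IsScalarTower ℝ ℂ E]
    [FiniteDimensional ℂ E] {I : Fin l} {ε₀ : F₁} {θ₀ : F₂}
    {P : F₁ → Matrix (Fin l) (Fin l) ℝ} {v : F₁ → Fin l → ℝ}
    (hP : ∀ᶠ ε in 𝓝 ε₀, P ε ∈ Matrix.rowStochastic ℝ (Fin l))
    (hPan : ∀ i j, AnalyticAt ℝ (fun ε => P ε i j) ε₀)
    (hv : ∀ᶠ ε in 𝓝 ε₀, IsStationaryVector (P ε) (v ε))
    (hPpos : ∀ i j, 0 < P ε₀ i j)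
    {q : F₂ → Fin l → ℝ → ℝ} (ι : F₂ →L[ℝ] E) (Q : RegularChannel l E I (ι θ₀))
    (hq : ∀ᶠ θ in 𝓝 θ₀, (∀ j, IsProbDensity (q θ j)) ∧ ∀ z, (∀ j, 0 < q θ j z ∧
      Q.q (ι θ) j z = q θ j z) ∧ Q.L (ι θ) z = Real.log (q θ I z)) :
    EntropyRateAnalyticAt (fun x : F₁ × F₂ => v x.1) (fun x => P x.1) (fun x => q x.2)
      (ε₀, θ₀) := by
  have : Nonempty (Fin l) := ⟨I⟩
  have hsum : ∀ {A : Matrix (Fin l) (Fin l) ℝ}, A ∈ Matrix.rowStochastic ℝ (Fin l) →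
      ∀ i, ∑ j, A i j = 1 := fun hA i => Matrix.sum_row_of_mem_rowStochastic hA i
  have hP1 := hsum hP.self_of_nhds
  obtain ⟨⟨i₁, j₁⟩, hmin⟩ := Finite.exists_min fun p : Fin l × Fin l => P ε₀ p.1 p.2
  -- Halving keeps all entries above `m` nearby. Then `v = vP` has entries in `[m, 1]`, so its
  -- logarithms oscillate by less than `1 - log m`.
  set m := P ε₀ i₁ j₁ / 2 with hm
  have hm0 : 0 < m := half_pos (hPpos _ _)
  obtain ⟨S, hSw, hSs, hSst, hSU, hSV, hSX⟩ :=
    Q.exists_contractiveSystem hPpos hP1 (1 - Real.log m)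
  let Φ : F₁ × F₂ → (Fin l → Fin l → ℂ) × E := fun x => (fun i j => (P x.1 i j : ℂ), ι x.2)
  have hPfst : ∀ i j, AnalyticAt ℝ (fun x : F₁ × F₂ => P x.1 i j) (ε₀, θ₀) := fun i j =>
    AnalyticAt.fun_comp (g := fun ε => P ε i j) (hPan i j) analyticAt_fst
  have hΦ : AnalyticAt ℝ Φ (ε₀, θ₀) := by
    refine AnalyticAt.prod ?_ ((ι.analyticAt _).fun_comp analyticAt_snd)
    refine AnalyticAt.pi fun i => AnalyticAt.pi fun j => ?_
    exact (Complex.ofRealCLM.analyticAt _).fun_comp (hPfst i j)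
  have hPm : ∀ᶠ ε in 𝓝 ε₀, ∀ i j, m < P ε i j := by
    simp only [eventually_all]
    intro i j
    refine (hPan i j).continuousAt.eventually (lt_mem_nhds ?_)
    have := hmin (i, j)
    have := hPpos i₁ j₁
    simp only at *
    linarith
  have hreal : ∀ᶠ x : F₁ × F₂ in 𝓝 (ε₀, θ₀),
      HasEntropyRate (v x.1) (P x.1) (q x.2) ∧ entropyRate (v x.1) (P x.1) (q x.2) =
        -(∑ i, (v x.1 i : ℂ) * S.limit (Φ x) i).re := by
    have hfst := (continuousAt_fst (p := ((ε₀, θ₀) : F₁ × F₂))).tendsto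
    have hsnd := (continuousAt_snd (p := ((ε₀, θ₀) : F₁ × F₂))).tendsto
    filter_upwards [hfst.eventually hP, hfst.eventually hv, hfst.eventually hPm,
      hsnd.eventually hq, hΦ.continuousAt.eventually (S.isOpen_U.mem_nhds hSU)]
      with ⟨ε, θ⟩ hPε hvε hPmε hqθ hU
    simp only at hPε hvε hPmε hqθ
    have hint : ∀ j, ∫ z, q θ j z = 1 := fun j => by
      rw [integral_eq_lintegral_of_nonneg_ae (Eventually.of_forall (hqθ.1 j).2.1)
        (hqθ.1 j).1.aestronglyMeasurable, (hqθ.1 j).2.2, ENNReal.toReal_one]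
    have hposε : ∀ i j, 0 < P ε i j := fun i j => hm0.trans (hPmε i j)
    let R : RealModel l I :=
      { P := P ε
        q := q θ
        P_pos := hposε
        P_sum := hsum hPε
        q_pos := fun j z => ((hqθ.2 z).1 j).1
        q_meas := fun j => (hqθ.1 j).1
        q_int := fun j => integrable_of_integral_eq_one (hint j)
        q_integral := hint
        q_log := fun j => by
          refine Q.integrable_H.mono' ((hqθ.1 j).1.mul
            (Real.measurable_log.comp (hqθ.1 I).1)).aestronglyMeasurable ?_
          filter_upwards [Q.qL_le] with z hz
          have := hz (ι θ) (hSV _ hU) j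
          rwa [((hqθ.2 z).1 j).2, (hqθ.2 z).2, ← Complex.ofReal_mul, Complex.norm_real] at this }
    have hlog : ∀ j (t : Fin l → ℝ), logSum I (fun i => (P ε i j : ℂ)) (fun i => (t i : ℂ)) =
        realLogSum I (fun i => P ε i j) t := fun j t => logSum_ofReal (fun i => hposε i j) t
    have hpt : IsRealPoint S (Φ (ε, θ)) R :=
      { mem := hU
        weight := fun i j z => by
          rw [hSw, RegularChannel.weight, ((hqθ.2 z).1 j).2, ← Complex.ofReal_mul]
        step := fun t z => by
          funext j
          rw [hSs, RegularChannel.step, ((hqθ.2 z).1 j).2, ((hqθ.2 z).1 I).2,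
            ← Complex.ofReal_div, ← Complex.ofReal_log
              (div_pos ((hqθ.2 z).1 j).1 ((hqθ.2 z).1 I).1).le, hlog, hlog, realStep]
          push_cast
          rfl
        start := fun t i => by
          have e : ∀ j, ∫ z, Q.q (ι θ) j z * Q.L (ι θ) z =
              ((∫ z, q θ j z * Real.log (q θ I z) : ℝ) : ℂ) := fun j => by
            rw [← integral_complex_ofReal]
            refine integral_congr_ae (Eventually.of_forall fun z => ?_)
            simp only
            rw [((hqθ.2 z).1 j).2, (hqθ.2 z).2, Complex.ofReal_mul]
          rw [hSst, RegularChannel.start, hlog]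
          simp only [Φ, e, R]
          push_cast
          rfl }
    refine hpt.hasEntropyRate hvε (hSX _ fun i j => ?_)
    have hle : ∀ i, v ε i ≤ 1 := fun i => by
      rw [← hvε.1.2]
      exact Finset.single_le_sum (f := v ε) (fun i _ => hvε.1.1 i) (Finset.mem_univ i)
    have hge : ∀ i, m ≤ v ε i := fun i => by
      rw [IsRealPoint.stationary_eq (R := R) hvε]
      calc m = ∑ k, v ε k * m := by rw [← Finset.sum_mul, hvε.1.2, one_mul]
        _ ≤ _ := Finset.sum_le_sum fun k _ =>
          mul_le_mul_of_nonneg_left (hPmε k i).le (hvε.1.1 k)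
    exact abs_log_sub_log_lt hm0 (hge i) (hle i) (hge j) (hle j)
  refine ⟨hreal.mono fun x hx => hx.1, ?_⟩
  have han : AnalyticAt ℝ (fun x : F₁ × F₂ => -(∑ i, (v x.1 i : ℂ) * S.limit (Φ x) i).re)
      (ε₀, θ₀) := by
    refine AnalyticAt.neg ((Complex.reCLM.analyticAt _).fun_comp
      (Finset.analyticAt_fun_sum _ fun i _ => AnalyticAt.mul ?_ ?_))
    · exact (Complex.ofRealCLM.analyticAt _).fun_comp (AnalyticAt.fun_comp
        (g := fun ε => v ε i) (analyticAt_stationary hPan hPpos hP1 hv i) analyticAt_fst)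
    · exact AnalyticAt.fun_comp (g := fun w => S.limit w i)
        (S.analyticAt_limit hSU i).restrictScalars hΦ
  exact han.congr (hreal.mono fun x hx => hx.2.symm)

/-! ### Real points of complex parameter spaces -/

/-- The inclusion of `ℝᵐ` in `ℂᵐ` as a continuous linear map. -/
def toComplexCLM (m : ℕ) : EuclideanSpace ℝ (Fin m) →L[ℝ] EuclideanSpace ℂ (Fin m) :=
  LinearMap.toContinuousLinearMap
    { toFun := toComplex
      map_add' := fun x y => by ext i; simp [toComplex]
      map_smul' := fun c x => by ext i; simp [toComplex] }

theorem toComplexCLM_apply {m : ℕ} (x : EuclideanSpace ℝ (Fin m)) :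
    toComplexCLM m x = toComplex x := rfl

theorem norm_toComplexCLM {m : ℕ} (x : EuclideanSpace ℝ (Fin m)) : ‖toComplexCLM m x‖ = ‖x‖ := by
  simp [toComplexCLM_apply, toComplex, EuclideanSpace.norm_eq]

theorem toComplexCLM_mem_ball {m : ℕ} {x y : EuclideanSpace ℝ (Fin m)} {r : ℝ} :
    toComplexCLM m x ∈ Metric.ball (toComplexCLM m y) r ↔ x ∈ Metric.ball y r := by
  rw [mem_ball_iff_norm, mem_ball_iff_norm, ← map_sub, norm_toComplexCLM]

/-- A holomorphic function on a complex ball that vanishes at the real points vanishes. -/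
theorem eq_zero_of_eq_zero_on_real {m : ℕ} {x₀ : EuclideanSpace ℝ (Fin m)} {r : ℝ}
    {f : EuclideanSpace ℂ (Fin m) → ℂ}
    (hf : AnalyticOnNhd ℂ f (Metric.ball (toComplexCLM m x₀) r))
    (h0 : ∀ x ∈ Metric.ball x₀ r, f (toComplexCLM m x) = 0) :
    ∀ θ ∈ Metric.ball (toComplexCLM m x₀) r, f θ = 0 := by
  intro θ hθ
  set c := toComplexCLM m x₀
  -- On the complex line `ζ ↦ c + a + ζ b`, real `ζ` give real points and `ζ = I` gives `θ`. The
  -- line meets the ball in a convex set containing `0` and `I`, so the one-variable identity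
  -- theorem applies.
  let a : EuclideanSpace ℝ (Fin m) := WithLp.toLp 2 fun i => ((θ - c) i).re
  let b : EuclideanSpace ℝ (Fin m) := WithLp.toLp 2 fun i => ((θ - c) i).im
  have hab : θ - c = toComplexCLM m a + Complex.I • toComplexCLM m b := by
    ext i
    simp only [toComplexCLM_apply, toComplex, PiLp.add_apply, PiLp.smul_apply, smul_eq_mul, a, b]
    rw [mul_comm]
    exact (Complex.re_add_im _).symm
  have ha : ‖a‖ ≤ ‖θ - c‖ := by
    rw [EuclideanSpace.norm_eq, EuclideanSpace.norm_eq]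
    refine Real.sqrt_le_sqrt (Finset.sum_le_sum fun i _ => ?_)
    have h1 := Complex.abs_re_le_norm ((θ - c) i)
    have h2 : ‖a i‖ = |((θ - c) i).re| := rfl
    rw [h2]
    exact pow_le_pow_left₀ (abs_nonneg _) h1 2
  let D : Set ℂ := (fun ζ : ℂ => c + (toComplexCLM m a + ζ • toComplexCLM m b)) ⁻¹' Metric.ball c r
  have hD : IsPreconnected D := by
    refine Convex.isPreconnected fun x hx y hy s t hs ht hst => ?_
    have hb := convex_ball c r hx hy hs ht hst
    change _ ∈ Metric.ball c r
    convert hb using 1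
    have e : (1 : ℂ) = (s : ℂ) + (t : ℂ) := by exact_mod_cast hst.symm
    have e1 : c + toComplexCLM m a = (s + t : ℝ) • (c + toComplexCLM m a) := by rw [hst, one_smul]
    simp only [← add_assoc]
    conv_lhs => rw [e1]
    simp only [smul_add, add_smul, smul_assoc]
    abel
  have hmem : ∀ ζ : ℂ, ζ ∈ D ↔ ‖toComplexCLM m a + ζ • toComplexCLM m b‖ < r := fun ζ => by
    change _ ∈ Metric.ball c r ↔ _
    rw [mem_ball_iff_norm, add_sub_cancel_left]
  have h0D : (0 : ℂ) ∈ D := by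
    rw [hmem, zero_smul, add_zero, norm_toComplexCLM]
    exact ha.trans_lt (mem_ball_iff_norm.1 hθ)
  have hID : Complex.I ∈ D := by
    rw [hmem, ← hab]
    exact mem_ball_iff_norm.1 hθ
  have hg : AnalyticOnNhd ℂ
      (fun ζ : ℂ => f (c + (toComplexCLM m a + ζ • toComplexCLM m b))) D := by
    intro ζ hζ
    refine AnalyticAt.fun_comp (hf _ hζ) ?_
    exact analyticAt_const.add (analyticAt_const.add (analyticAt_id.smul analyticAt_const))
  have hDo : D ∈ 𝓝 (0 : ℂ) := by
    refine IsOpen.mem_nhds (Metric.isOpen_ball.preimage ?_) h0D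
    fun_prop
  have hfreq : ∃ᶠ ζ in 𝓝[≠] (0 : ℂ), f (c + (toComplexCLM m a + ζ • toComplexCLM m b)) = 0 := by
    have hreal : Tendsto (fun n : ℕ => (((n : ℝ) + 1)⁻¹ : ℂ)) atTop (𝓝[≠] 0) := by
      refine tendsto_nhdsWithin_iff.2 ⟨?_, Eventually.of_forall fun n => ?_⟩
      · simpa using tendsto_one_div_add_atTop_nhds_zero_nat (𝕜 := ℂ)
      · have : ((n : ℂ) + 1) ≠ 0 := Nat.cast_add_one_ne_zero n
        simpa using this
    refine hreal.frequently (Eventually.frequently ?_)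
    filter_upwards [(hreal.mono_right nhdsWithin_le_nhds).eventually hDo] with n hn
    have e : c + (toComplexCLM m a + (((n : ℝ) + 1)⁻¹ : ℂ) • toComplexCLM m b) =
        toComplexCLM m (x₀ + (a + ((n : ℝ) + 1)⁻¹ • b)) := by
      simp only [map_add, map_smul, c]
      congr 2
      rw [← Complex.coe_smul]
      push_cast
      rfl
    rw [e]
    refine h0 _ (toComplexCLM_mem_ball.1 ?_)
    rw [← e]
    exact hn
  have := hg.eqOn_zero_of_preconnected_of_frequently_eq_zero hD h0D hfreq hID
  simp only [← hab, add_sub_cancel, Pi.zero_apply] at this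
  exact this

/-! ### Measurable majorants and logarithms -/

/-- A family with an integrable supremum is dominated by an integrable function. -/
theorem exists_integrable_majorant {E : Type*} [TopologicalSpace E]
    [SecondCountableTopology E] {B : Set E} {f : E → ℝ → ℂ}
    (hm : ∀ θ ∈ B, Measurable (f θ)) (hc : ∀ z, ContinuousOn (fun θ => f θ z) B)
    (hfin : ∫⁻ z, ⨆ θ ∈ B, ‖f θ z‖ₑ < ∞) :
    ∃ H : ℝ → ℝ, Integrable H ∧ (∀ z, 0 ≤ H z) ∧ ∀ᵐ z, ∀ θ ∈ B, ‖f θ z‖ ≤ H z := by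
  -- An uncountable supremum need not be measurable; a countable dense subset gives a measurable
  -- one, and continuity extends the bound to all of `B`.
  obtain ⟨D, hDc, hDd⟩ := TopologicalSpace.exists_countable_dense B
  have hmeas : Measurable fun z => ⨆ d ∈ D, ‖f d.1 z‖ₑ :=
    Measurable.biSup D hDc fun d _ => (hm d.1 d.2).enorm
  have hle : ∀ z, ⨆ d ∈ D, ‖f d.1 z‖ₑ ≤ ⨆ θ ∈ B, ‖f θ z‖ₑ := fun z =>
    iSup₂_le fun d _ => le_iSup₂ (f := fun θ (_ : θ ∈ B) => ‖f θ z‖ₑ) d.1 d.2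
  have hlt : ∫⁻ z, ⨆ d ∈ D, ‖f d.1 z‖ₑ < ∞ := (lintegral_mono hle).trans_lt hfin
  refine ⟨fun z => (⨆ d ∈ D, ‖f d.1 z‖ₑ).toReal,
    integrable_toReal_of_lintegral_ne_top hmeas.aemeasurable hlt.ne,
    fun z => ENNReal.toReal_nonneg, ?_⟩
  filter_upwards [ae_lt_top hmeas hlt.ne] with z hz θ hθ
  have hcont : Continuous fun d : B => ‖f d.1 z‖ₑ :=
    (continuousOn_iff_continuous_domRestrict.1 (hc z)).enorm
  have hclosed : IsClosed {d : B | ‖f d.1 z‖ₑ ≤ ⨆ d ∈ D, ‖f d.1 z‖ₑ} :=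
    isClosed_le hcont continuous_const
  have hsub : D ⊆ {d : B | ‖f d.1 z‖ₑ ≤ ⨆ d ∈ D, ‖f d.1 z‖ₑ} := fun d hd =>
    le_iSup₂ (f := fun (d : B) (_ : d ∈ D) => ‖f d.1 z‖ₑ) d hd
  have hall := hclosed.closure_subset_iff.2 hsub (hDd ⟨θ, hθ⟩)
  have := ENNReal.toReal_mono hz.ne hall
  simpa using this

/-- An almost everywhere bound of a pointwise bounded family can be made to hold everywhere. -/
theorem exists_integrable_bound {ι : Type*} {B : Set ι} {f : ι → ℝ → ℂ} {H : ℝ → ℝ}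
    (hH : Integrable H) (hae : ∀ᵐ z, ∀ θ ∈ B, ‖f θ z‖ ≤ H z)
    (hb : ∀ z, ∃ c, ∀ θ ∈ B, ‖f θ z‖ ≤ c) :
    ∃ G : ℝ → ℝ, Integrable G ∧ ∀ θ ∈ B, ∀ z, ‖f θ z‖ ≤ G z := by
  classical
  choose c hc using hb
  -- The majorant is changed only on the null set where its bound fails.
  refine ⟨fun z => if ∀ θ ∈ B, ‖f θ z‖ ≤ H z then H z else c z, ?_, fun θ hθ z => ?_⟩
  · refine hH.congr ?_
    filter_upwards [hae] with z hz
    rw [if_pos hz]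
  · by_cases h : ∀ θ ∈ B, ‖f θ z‖ ≤ H z
    · simpa only [if_pos h] using h θ hθ
    · simpa only [if_neg h] using hc z θ hθ

/-- A continuous logarithm along a segment is measurable, if the functions are. -/
theorem measurable_log_lift {E : Type*} [NormedAddCommGroup E] [NormedSpace ℝ E] {B : Set E}
    (hB : Convex ℝ B) {f g : E → ℝ → ℂ} (hf : ∀ θ ∈ B, Measurable (f θ))
    (hg : ∀ z, ContinuousOn (fun θ => g θ z) B)
    (hexp : ∀ θ ∈ B, ∀ z, Complex.exp (g θ z) = f θ z) {θ₀ θ : E} (h₀ : θ₀ ∈ B) (hθ : θ ∈ B)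
    (hg₀ : Measurable (g θ₀)) : Measurable (g θ) := by
  set γ : ℝ → E := fun s => θ₀ + s • (θ - θ₀) with hγ
  have hγc : Continuous γ := by fun_prop
  have hγB : ∀ s ∈ Icc (0 : ℝ) 1, γ s ∈ B := fun s hs => hB.add_smul_sub_mem h₀ hθ hs
  have hmemIcc : ∀ {n k : ℕ}, k ≤ n + 1 → (k : ℝ) / ((n : ℝ) + 1) ∈ Icc (0 : ℝ) 1 := by
    intro n k hk
    refine ⟨by positivity, (div_le_one (by positivity)).2 ?_⟩
    exact_mod_cast hk
  -- On a fine subdivision the increments of `g` are principal logarithms of successive ratios of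
  -- `f`, so they telescope to `g θ`. The fineness required depends on `z`, hence the limit in `n`.
  refine measurable_of_tendsto_metrizable (f := fun (n : ℕ) z => g θ₀ z +
    ∑ k ∈ Finset.range (n + 1), Complex.log (f (γ (((k + 1 : ℕ) : ℝ) / ((n : ℝ) + 1))) z /
      f (γ ((k : ℝ) / ((n : ℝ) + 1))) z)) (fun n => ?_) (tendsto_pi_nhds.2 fun z => ?_)
  · refine hg₀.add (Finset.measurable_sum _ fun k hk => ?_)
    have hk' := Finset.mem_range.1 hk
    exact ((hf _ (hγB _ (hmemIcc hk'))).div (hf _ (hγB _ (hmemIcc hk'.le)))).clog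
  · have hu : UniformContinuousOn (fun s => g (γ s) z) (Icc 0 1) :=
      isCompact_Icc.uniformContinuousOn_of_continuous
        ((hg z).comp hγc.continuousOn fun s hs => hγB s hs)
    -- Increments of norm below `π` lie in the strip where `log` inverts `exp`.
    obtain ⟨δ, hδ, hδu⟩ := Metric.uniformContinuousOn_iff.1 hu Real.pi Real.pi_pos
    obtain ⟨N, hN⟩ := exists_nat_gt δ⁻¹
    refine tendsto_const_nhds.congr' ?_
    filter_upwards [eventually_ge_atTop N] with n hn
    have hstep : ∀ k ∈ Finset.range (n + 1),
        Complex.log (f (γ (((k + 1 : ℕ) : ℝ) / ((n : ℝ) + 1))) z /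
          f (γ ((k : ℝ) / ((n : ℝ) + 1))) z) =
        g (γ (((k + 1 : ℕ) : ℝ) / ((n : ℝ) + 1))) z - g (γ ((k : ℝ) / ((n : ℝ) + 1))) z := by
      intro k hk
      have hk' := Finset.mem_range.1 hk
      have h1 := hmemIcc (n := n) (k := k + 1) hk'
      have h2 := hmemIcc (n := n) (k := k) hk'.le
      rw [← hexp _ (hγB _ h1), ← hexp _ (hγB _ h2), ← Complex.exp_sub]
      have hd : dist (((k + 1 : ℕ) : ℝ) / ((n : ℝ) + 1)) ((k : ℝ) / ((n : ℝ) + 1)) < δ := by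
        rw [Real.dist_eq, ← sub_div]
        push_cast
        rw [add_sub_cancel_left, abs_of_pos (by positivity), div_lt_iff₀ (by positivity)]
        have : (N : ℝ) ≤ n := by exact_mod_cast hn
        have h3 : δ⁻¹ * δ = 1 := inv_mul_cancel₀ hδ.ne'
        nlinarith
      have h3 := hδu _ h1 _ h2 hd
      rw [dist_eq_norm] at h3
      have h4 := abs_lt.1 ((Complex.abs_im_le_norm _).trans_lt h3)
      exact Complex.log_exp h4.1 h4.2.le
    rw [Finset.sum_congr rfl hstep,
      Finset.sum_range_sub (fun k : ℕ => g (γ ((k : ℝ) / ((n : ℝ) + 1))) z)]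
    have e1 : γ (((n + 1 : ℕ) : ℝ) / ((n : ℝ) + 1)) = θ := by
      have : (((n + 1 : ℕ) : ℝ) / ((n : ℝ) + 1)) = 1 := by
        push_cast
        exact div_self (by positivity)
      rw [this]
      simp [hγ]
    have e0 : γ (((0 : ℕ) : ℝ) / ((n : ℝ) + 1)) = θ₀ := by simp [hγ]
    rw [e1, e0, add_sub_cancel]

/-! ### General channels -/

/-- A holomorphic function extending the germ of a real-analytic function extends the function. -/
theorem eq_ofReal_of_eventually_eq {m : ℕ} {x₀ : EuclideanSpace ℝ (Fin m)} {r : ℝ} (hr : 0 < r)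
    {f : EuclideanSpace ℝ (Fin m) → ℝ} {g : EuclideanSpace ℂ (Fin m) → ℂ}
    (hf : AnalyticOnNhd ℝ f (Metric.ball x₀ r))
    (hg : AnalyticOnNhd ℂ g (Metric.ball (toComplexCLM m x₀) r))
    (h : ∀ᶠ x in 𝓝 x₀, g (toComplexCLM m x) = f x) :
    ∀ x ∈ Metric.ball x₀ r, g (toComplexCLM m x) = f x := by
  have h1 : AnalyticOnNhd ℝ (fun x => g (toComplexCLM m x)) (Metric.ball x₀ r) := fun x hx =>
    AnalyticAt.fun_comp (hg _ (toComplexCLM_mem_ball.2 hx)).restrictScalars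
      ((toComplexCLM m).analyticAt x)
  have h2 : AnalyticOnNhd ℝ (fun x => (f x : ℂ)) (Metric.ball x₀ r) := fun x hx =>
    (Complex.ofRealCLM.analyticAt _).fun_comp (hf x hx)
  exact h1.eqOn_of_preconnected_of_eventuallyEq h2 (convex_ball x₀ r).isPreconnected
    (Metric.mem_ball_self hr) h

/-- The extended logarithm of a positive channel density stays its logarithm. -/
theorem log_extension {m : ℕ} {x₀ : EuclideanSpace ℝ (Fin m)} {r : ℝ} (hr : 0 < r)
    {f : EuclideanSpace ℝ (Fin m) → ℝ} {g L : EuclideanSpace ℂ (Fin m) → ℂ}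
    (hf : AnalyticOnNhd ℝ f (Metric.ball x₀ r)) (hf₀ : 0 < f x₀)
    (hg : AnalyticOnNhd ℂ g (Metric.ball (toComplexCLM m x₀) r))
    (hL : AnalyticOnNhd ℂ L (Metric.ball (toComplexCLM m x₀) r))
    (hgf : ∀ᶠ x in 𝓝 x₀, g (toComplexCLM m x) = f x)
    (hLf : ∀ᶠ x in 𝓝 x₀, L (toComplexCLM m x) = Real.log (f x)) :
    (∀ x ∈ Metric.ball x₀ r, 0 < f x ∧ L (toComplexCLM m x) = Real.log (f x)) ∧
      ∀ θ ∈ Metric.ball (toComplexCLM m x₀) r, Complex.exp (L θ) = g θ := by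
  have hexpL : AnalyticOnNhd ℂ (fun θ => Complex.exp (L θ))
      (Metric.ball (toComplexCLM m x₀) r) := fun θ hθ => (hL θ hθ).cexp
  -- Positivity is only known at `x₀`. The identity `exp L = f` and the reality of `L` both
  -- propagate over the real ball, so `f` is there the exponential of a real number.
  have hexp : ∀ x ∈ Metric.ball x₀ r, Complex.exp (L (toComplexCLM m x)) = f x := by
    refine eq_ofReal_of_eventually_eq hr hf hexpL ?_
    filter_upwards [hLf, (hf _ (Metric.mem_ball_self hr)).continuousAt.eventually_const_lt hf₀]
      with x hx hpos
    rw [hx, ← Complex.ofReal_exp, Real.exp_log hpos]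
  have hre : ∀ x ∈ Metric.ball x₀ r,
      L (toComplexCLM m x) = ((L (toComplexCLM m x)).re : ℂ) := by
    refine eq_ofReal_of_eventually_eq (f := fun x => (L (toComplexCLM m x)).re) hr
      (fun x hx => ?_) hL ?_
    · exact (Complex.reCLM.analyticAt _).fun_comp
        (AnalyticAt.fun_comp (hL _ (toComplexCLM_mem_ball.2 hx)).restrictScalars
          ((toComplexCLM m).analyticAt x))
    · filter_upwards [hLf] with x hx
      rw [hx, Complex.ofReal_re]
  refine ⟨fun x hx => ?_, fun θ hθ => ?_⟩
  · have h1 : f x = Real.exp (L (toComplexCLM m x)).re := by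
      have := hexp x hx
      rw [hre x hx, ← Complex.ofReal_exp] at this
      exact_mod_cast this.symm
    refine ⟨h1 ▸ Real.exp_pos _, ?_⟩
    rw [h1, Real.log_exp]
    exact hre x hx
  · refine sub_eq_zero.1 (eq_zero_of_eq_zero_on_real
      (f := fun θ => Complex.exp (L θ) - g θ) (fun θ hθ => (hexpL θ hθ).sub (hg θ hθ))
      (fun x hx => ?_) θ hθ)
    rw [hexp x hx, eq_ofReal_of_eventually_eq hr hf hg hgf x hx, sub_self]

/-- A uniformly convergent family whose limit is bounded away from zero converges relatively. -/
theorem tendsto_div_of_forall_eventually {E : Type*} {F : Filter E} {f : E → ℝ → ℂ} {f₀ : ℝ → ℝ}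
    {c : ℝ} (hc : 0 < c) (hf₀ : ∀ z, c ≤ f₀ z)
    (h : ∀ δ > 0, ∀ᶠ θ in F, ∀ z, ‖f θ z - f₀ z‖ < δ) :
    Tendsto (fun p : E × ℝ => f p.1 p.2 / (f₀ p.2 : ℂ)) (F ×ˢ ⊤) (𝓝 1) := by
  refine Metric.tendsto_nhds.2 fun δ hδ => ?_
  filter_upwards [(h (δ * c) (by positivity)).prod_inl ⊤] with p hp
  have hpos : 0 < f₀ p.2 := hc.trans_le (hf₀ p.2)
  have hne : (f₀ p.2 : ℂ) ≠ 0 := by exact_mod_cast hpos.ne'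
  rw [dist_eq_norm, div_sub_one hne, norm_div, Complex.norm_real, Real.norm_of_nonneg hpos.le,
    div_lt_iff₀ hpos]
  exact (hp p.2).trans_le (mul_le_mul_of_nonneg_left (hf₀ p.2) hδ.le)

/-- The logarithm of a number between two positive bounds. -/
theorem abs_log_le_max {a b x : ℝ} (ha : 0 < a) (hax : a ≤ x) (hxb : x ≤ b) :
    |Real.log x| ≤ max |Real.log a| |Real.log b| := by
  have h1 := Real.log_le_log ha hax
  have h2 := Real.log_le_log (ha.trans_le hax) hxb
  rw [max_comm]
  exact (abs_le_max_abs_abs h1 h2).trans_eq (max_comm _ _)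

/-- The entropy rate of a hidden Markov chain whose channel satisfies the analyticity,
integrability and comparability conditions is analytic. -/
theorem entropyRateAnalyticAt_of_conditions {l m₁ m₂ : ℕ}
    {P : EuclideanSpace ℝ (Fin m₁) → Matrix (Fin l) (Fin l) ℝ}
    {v : EuclideanSpace ℝ (Fin m₁) → Fin l → ℝ} {ε₀ : EuclideanSpace ℝ (Fin m₁)}
    (hP : ∀ᶠ ε in 𝓝 ε₀, P ε ∈ Matrix.rowStochastic ℝ (Fin l))
    (hPan : ∀ i j, AnalyticAt ℝ (fun ε => P ε i j) ε₀)
    (hv : ∀ᶠ ε in 𝓝 ε₀, IsStationaryVector (P ε) (v ε))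
    (hPpos : ∀ i j, 0 < P ε₀ i j)
    {Ω : Set (EuclideanSpace ℝ (Fin m₂))} (hΩ : IsOpen Ω)
    {q : EuclideanSpace ℝ (Fin m₂) → Fin l → ℝ → ℝ}
    (hqd : ∀ θ ∈ Ω, ∀ y, IsProbDensity (q θ y))
    (hqan : ∀ y z, AnalyticOnNhd ℝ (fun θ => q θ y z) Ω)
    {θ₀ : EuclideanSpace ℝ (Fin m₂)} (hθ₀ : θ₀ ∈ Ω) (hqpos : ∀ y z, 0 < q θ₀ y z)
    {qc : EuclideanSpace ℂ (Fin m₂) → Fin l → ℝ → ℂ} (hext : ExtendsChannel q qc θ₀)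
    (hC : ConditionC qc θ₀) {I : Fin l} (hD1 : ConditionD1 qc θ₀ I)
    (hD2 : ConditionD2 q qc θ₀ I) {a b : ℝ} (ha : 0 < a)
    (hab : ∀ i j z, a ≤ |q θ₀ j z / q θ₀ i z| ∧ |q θ₀ j z / q θ₀ i z| ≤ b) :
    EntropyRateAnalyticAt
      (fun x : EuclideanSpace ℝ (Fin m₁) × EuclideanSpace ℝ (Fin m₂) => v x.1)
      (fun x => P x.1) (fun x => q x.2) (ε₀, θ₀) := by
  obtain ⟨rC, hrC, hCan, hCcont, hCint, -, -⟩ := hC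
  obtain ⟨rE, hrE, hne, hequi⟩ := hD1
  obtain ⟨rL, hrL, L, hLan, hLlog, hLint⟩ := hD2
  obtain ⟨rΩ, hrΩ, hballΩ⟩ := Metric.isOpen_iff.1 hΩ θ₀ hθ₀
  set c := toComplexCLM m₂ θ₀ with hc
  change ∀ y z, AnalyticOnNhd ℂ (fun θ => qc θ y z) (Metric.ball c rC) at hCan
  change ∀ y, ContinuousOn _ (univ ×ˢ Metric.ball c rC) at hCcont
  change ∀ z : ℝ, ∀ θ ∈ Metric.ball c rE, qc θ I z ≠ 0 at hne
  change ∀ z, AnalyticOnNhd ℂ _ (Metric.ball c rL) at hLan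
  -- Strict inequality with `rC` puts the closed ball inside the domain of analyticity; compactness
  -- then gives, for each `z`, the bound that repairs the majorant on its null set.
  obtain ⟨r, hr, hrC', hrE', hrL', hrΩ'⟩ :
      ∃ r > 0, r < rC ∧ r ≤ rE ∧ r ≤ rL ∧ r ≤ rΩ := by
    refine ⟨min (min (rC / 2) rE) (min rL rΩ), by positivity, ?_, ?_, ?_, ?_⟩
    · exact ((min_le_left _ _).trans (min_le_left _ _)).trans_lt (half_lt_self hrC)
    · exact (min_le_left _ _).trans (min_le_right _ _)
    · exact (min_le_right _ _).trans (min_le_left _ _)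
    · exact (min_le_right _ _).trans (min_le_right _ _)
  have hVC : Metric.ball c r ⊆ Metric.ball c rC := Metric.ball_subset_ball hrC'.le
  have hVE : Metric.ball c r ⊆ Metric.ball c rE := Metric.ball_subset_ball hrE'
  have hVL : Metric.ball c r ⊆ Metric.ball c rL := Metric.ball_subset_ball hrL'
  have hVΩ : Metric.ball θ₀ r ⊆ Ω := (Metric.ball_subset_ball hrΩ').trans hballΩ
  have hcV : c ∈ Metric.ball c r := Metric.mem_ball_self hr
  have hqc : ∀ y z, ∀ θ ∈ Metric.ball θ₀ r, qc (toComplexCLM m₂ θ) y z = q θ y z := fun y z =>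
    eq_ofReal_of_eventually_eq (f := fun θ => q θ y z) (g := fun θ => qc θ y z) hr
      ((hqan y z).mono hVΩ) ((hCan y z).mono hVC) (hext y z)
  have hlog := fun z => log_extension (f := fun θ => q θ I z) (g := fun θ => qc θ I z)
    (L := fun θ => L θ z) hr ((hqan I z).mono hVΩ) (hqpos I z) ((hCan I z).mono hVC)
    ((hLan z).mono hVL) (hext I z) (hLlog z)
  have hbase : ∀ y z, qc c y z = q θ₀ y z := fun y z => hqc y z θ₀ (Metric.mem_ball_self hr)
  have hqcm : ∀ θ ∈ Metric.ball c r, ∀ j, Measurable (qc θ j) := fun θ hθ j => by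
    have : Continuous (qc θ j) := by
      rw [← continuousOn_univ]
      exact (hCcont j).comp (f := fun z : ℝ => (z, θ)) (by fun_prop)
        fun z _ => ⟨mem_univ _, hVC hθ⟩
    exact this.measurable
  have hqcc : ∀ j z, ContinuousOn (fun θ => qc θ j z) (Metric.ball c r) := fun j z =>
    ((hCan j z).mono hVC).continuousOn
  have hLc : ∀ z, ContinuousOn (fun θ => L θ z) (Metric.ball c r) := fun z =>
    ((hLan z).mono hVL).continuousOn
  have hLm : ∀ θ ∈ Metric.ball c r, Measurable (L θ) := fun θ hθ => by
    refine measurable_log_lift (convex_ball c r) (f := fun θ => qc θ I)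
      (fun θ hθ => hqcm θ hθ I) hLc (fun θ hθ z => (hlog z).2 θ hθ) hcV hθ ?_
    have : L c = fun z => (Real.log (q θ₀ I z) : ℂ) :=
      funext fun z => ((hlog z).1 θ₀ (Metric.mem_ball_self hr)).2
    rw [this]
    exact Complex.measurable_ofReal.comp (Real.measurable_log.comp (hqd θ₀ hθ₀ I).1)
  have hG : ∀ j, ∃ G : ℝ → ℝ, Integrable G ∧
      ∀ θ ∈ Metric.ball c r, ∀ z, ‖qc θ j z‖ ≤ G z := fun j => by
    obtain ⟨G, hGi, -, hGle⟩ := exists_integrable_majorant (f := fun θ => qc θ j)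
      (fun θ hθ => hqcm θ hθ j) (hqcc j) ((lintegral_mono fun z =>
        (biSup_mono fun θ hθ => hVC hθ).trans (le_iSup
          (fun y => ⨆ θ ∈ Metric.ball (toComplex θ₀) rC, ‖qc θ y z‖ₑ) j)).trans_lt hCint)
    refine exists_integrable_bound hGi hGle fun z => ?_
    obtain ⟨k, hk⟩ := (isCompact_closedBall c r).exists_bound_of_continuousOn
      (f := fun θ => qc θ j z) ((hCan j z).continuousOn.mono
        (Metric.closedBall_subset_ball hrC'))
    exact ⟨k, fun θ hθ => hk θ (Metric.ball_subset_closedBall hθ)⟩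
  have hH : ∀ j, ∃ H : ℝ → ℝ, Integrable H ∧ (∀ z, 0 ≤ H z) ∧
      ∀ᵐ z, ∀ θ ∈ Metric.ball c r, ‖qc θ j z * L θ z‖ ≤ H z := fun j =>
    exists_integrable_majorant (f := fun θ z => qc θ j z * L θ z)
      (fun θ hθ => (hqcm θ hθ j).mul (hLm θ hθ)) (fun z => (hqcc j z).mul (hLc z))
      ((lintegral_mono fun z => biSup_mono fun θ hθ => hVL hθ).trans_lt (hLint j))
  choose G hGi hGle using hG
  choose H hHi hH0 hHle using hH
  have hG0 : ∀ j z, 0 ≤ G j z := fun j z => (norm_nonneg _).trans (hGle j c hcV z)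
  have hratio : ∀ j z, |q θ₀ j z / q θ₀ I z| = q θ₀ j z / q θ₀ I z := fun j z =>
    abs_of_pos (div_pos (hqpos j z) (hqpos I z))
  have hunif : ∀ j, ∀ δ > 0, ∀ᶠ θ in 𝓝 c, ∀ z : ℝ,
      ‖qc θ j z / qc θ I z - (q θ₀ j z / q θ₀ I z : ℝ)‖ < δ := fun j δ hδ => by
    have h := hequi j c (Metric.mem_ball_self hrE) _ (Metric.dist_mem_uniformity hδ)
    have hn : 𝓝[Metric.ball (toComplex θ₀) rE] c = 𝓝 c :=
      Metric.isOpen_ball.nhdsWithin_eq (Metric.mem_ball_self hrE)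
    rw [hn] at h
    filter_upwards [h] with θ hθ z
    have := hθ z
    rw [dist_eq_norm', hbase, hbase, ← Complex.ofReal_div] at this
    exact this
  let Q : RegularChannel l (EuclideanSpace ℂ (Fin m₂)) I (toComplexCLM m₂ θ₀) :=
    { V := Metric.ball c r
      isOpen_V := Metric.isOpen_ball
      mem_V := hcV
      q := qc
      L := L
      G := fun z => ∑ j, G j z
      integrable_G := integrable_finsetSum _ fun j _ => hGi j
      H := fun z => ∑ j, H j z
      integrable_H := integrable_finsetSum _ fun j _ => hHi j
      q_diff := fun j z => ((hCan j z).mono hVC).differentiableOn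
      q_meas := hqcm
      q_le := fun θ hθ j z => (hGle j θ hθ z).trans
        (Finset.single_le_sum (f := fun j => G j z) (fun j _ => hG0 j z) (Finset.mem_univ j))
      q_ne := fun θ hθ z => hne z θ (hVE hθ)
      L_diff := fun z => ((hLan z).mono hVL).differentiableOn
      L_meas := hLm
      qL_le := by
        filter_upwards [ae_all_iff.2 hHle] with z hz θ hθ j
        exact (hz j θ hθ).trans
          (Finset.single_le_sum (f := fun j => H j z) (fun j _ => hH0 j z) (Finset.mem_univ j))
      q₀ := q θ₀
      q_base := hbase
      q₀_pos := hqpos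
      q₀_integral := fun j => by
        have h := hqd θ₀ hθ₀ j
        rw [integral_eq_lintegral_of_nonneg_ae (Eventually.of_forall h.2.1)
          h.1.aestronglyMeasurable, h.2.2, ENNReal.toReal_one]
      C := max |Real.log a| |Real.log b|
      ratio_le := fun j z => by
        have h := hab I j z
        rw [hratio] at h
        exact abs_log_le_max ha h.1 h.2
      ratio_tendsto := fun j => tendsto_div_of_forall_eventually
        (f := fun θ z => qc θ j z / qc θ I z) (f₀ := fun z => q θ₀ j z / q θ₀ I z) ha
        (fun z => by have h := (hab I j z).1; rwa [hratio] at h) (hunif j) }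
  refine entropyRateAnalyticAt_of_regularChannel hP hPan hv hPpos (toComplexCLM m₂) Q ?_
  -- All ratios at `θ₀` are at least `a`, so with tolerance `a` the nearby ratios stay positive, for
  -- all outputs at once.
  have hev := (toComplexCLM m₂).continuous.continuousAt.eventually
    (eventually_all.2 fun j => hunif j a ha)
  filter_upwards [Metric.ball_mem_nhds θ₀ hr, hev] with θ hθ hθr
  refine ⟨hqd θ (hVΩ hθ), fun z => ⟨fun j => ⟨?_, hqc j z θ hθ⟩, ((hlog z).1 θ hθ).2⟩⟩
  have h1 := hθr j z
  rw [hqc j z θ hθ, hqc I z θ hθ, ← Complex.ofReal_div, ← Complex.ofReal_sub, Complex.norm_real,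
    Real.norm_eq_abs] at h1
  have h2 := (hab I j z).1
  rw [hratio] at h2
  have h3 : 0 < q θ j z / q θ I z := by linarith [(abs_lt.1 h1).1]
  exact (div_pos_iff_of_pos_right ((hlog z).1 θ hθ).1).1 h3

/-! ### The additive Cauchy channel -/

theorem abs_log_sub_log_le {x u c : ℝ} (hx : 0 < x) (hu : 0 < u) (h1 : x ≤ c * u)
    (h2 : u ≤ c * x) : |Real.log x - Real.log u| ≤ Real.log c := by
  have hc : 0 < c := pos_of_mul_pos_left (hx.trans_le h1) hu.le
  have e1 := Real.log_le_log hx h1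
  have e2 := Real.log_le_log hu h2
  rw [Real.log_mul hc.ne' hu.ne'] at e1
  rw [Real.log_mul hc.ne' hx.ne'] at e2
  exact abs_le.2 ⟨by linarith, by linarith⟩

theorem norm_clog_le (w : ℂ) : ‖Complex.log w‖ ≤ |Real.log ‖w‖| + Real.pi := by
  refine (Complex.norm_le_abs_re_add_abs_im _).trans ?_
  rw [Complex.log_re, Complex.log_im]
  exact add_le_add le_rfl (Complex.abs_arg_le_pi w)

/-- The logarithm is at most `4 * (1 + z ^ 2) ^ (1 / 4)`, which leaves the integrable power `(1 + z
^ 2) ^ (-3 / 4)`. -/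
theorem integrable_inv_mul_log (a b : ℝ) :
    Integrable fun z : ℝ => (1 + z ^ 2)⁻¹ * (a + b * Real.log (1 + z ^ 2)) := by
  have hlog : Integrable fun z : ℝ => (1 + z ^ 2)⁻¹ * Real.log (1 + z ^ 2) := by
    have h := (integrable_rpow_neg_one_add_norm_sq (E := ℝ) (μ := volume) (r := 3 / 2)
      (by simp; norm_num)).const_mul 4
    refine h.mono' (by fun_prop) (Eventually.of_forall fun z => ?_)
    have h1 : (1 : ℝ) ≤ 1 + z ^ 2 := by nlinarith [sq_nonneg z]
    have h0 : (0 : ℝ) < 1 + z ^ 2 := by linarith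
    have hl := Real.log_le_rpow_div h0.le (ε := 1 / 4) (by norm_num)
    rw [Real.norm_of_nonneg (mul_nonneg (inv_nonneg.2 h0.le) (Real.log_nonneg h1)),
      Real.norm_eq_abs, sq_abs]
    calc (1 + z ^ 2)⁻¹ * Real.log (1 + z ^ 2)
        ≤ (1 + z ^ 2)⁻¹ * ((1 + z ^ 2) ^ (1 / 4 : ℝ) / (1 / 4)) :=
          mul_le_mul_of_nonneg_left hl (inv_nonneg.2 h0.le)
      _ = 4 * ((1 + z ^ 2) ^ (-1 : ℝ) * (1 + z ^ 2) ^ (1 / 4 : ℝ)) := by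
          rw [Real.rpow_neg_one]
          ring
      _ = 4 * (1 + z ^ 2) ^ (-(3 / 2 : ℝ) / 2) := by
          rw [← Real.rpow_add h0]
          norm_num
  have h2 := (integrable_inv_one_add_sq.mul_const a).add (hlog.mul_const b)
  refine h2.congr (Eventually.of_forall fun z => ?_)
  simp only [Pi.add_apply]
  ring

/-- Both linear factors of a Cauchy denominator, for `σ = 1` and `σ = -1`. -/
def cauchyFactor (σ : ℝ) (g m : ℂ) (z : ℝ) : ℂ := z - m + σ * Complex.I * g

theorem cauchyFactor_mul (g m : ℂ) (z : ℝ) :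
    cauchyFactor 1 g m z * cauchyFactor (-1) g m z = (z - m) ^ 2 + g ^ 2 := by
  simp only [cauchyFactor]
  push_cast
  linear_combination -g ^ 2 * Complex.I_sq

theorem norm_cauchyFactor_sub_le {σ : ℝ} (hσ : |σ| = 1) (g m g₀ m₀ : ℂ) (z : ℝ) :
    ‖cauchyFactor σ g m z - cauchyFactor σ g₀ m₀ z‖ ≤ ‖m - m₀‖ + ‖g - g₀‖ := by
  have e : cauchyFactor σ g m z - cauchyFactor σ g₀ m₀ z =
      -(m - m₀) + σ * Complex.I * (g - g₀) := by
    simp only [cauchyFactor]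
    ring
  rw [e]
  refine (norm_add_le _ _).trans_eq ?_
  rw [norm_neg, norm_mul, norm_mul, Complex.norm_I, Complex.norm_real, Real.norm_eq_abs, hσ,
    mul_one, one_mul]

theorem norm_cauchyFactor_sq {σ : ℝ} (hσ : |σ| = 1) (g₀ m₀ z : ℝ) :
    ‖cauchyFactor σ g₀ m₀ z‖ ^ 2 = (z - m₀) ^ 2 + g₀ ^ 2 := by
  have h1 : σ ^ 2 = 1 := by rw [← sq_abs, hσ, one_pow]
  have e : cauchyFactor σ g₀ m₀ z = ((z - m₀ : ℝ) : ℂ) + ((σ * g₀ : ℝ) : ℂ) * Complex.I := by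
    simp only [cauchyFactor]
    push_cast
    ring
  rw [e, ← Complex.normSq_eq_norm_sq, Complex.normSq_add_mul_I, mul_pow, h1, one_mul]

theorem le_norm_cauchyFactor {σ : ℝ} (hσ : |σ| = 1) {g₀ : ℝ} (hg₀ : 0 < g₀) (m₀ z : ℝ) :
    g₀ ≤ ‖cauchyFactor σ g₀ m₀ z‖ := by
  refine (pow_le_pow_iff_left₀ hg₀.le (norm_nonneg _) two_ne_zero).1 ?_
  rw [norm_cauchyFactor_sq hσ]
  nlinarith [sq_nonneg (z - m₀)]

/-- The factor moves by less than `g₀ / 2`, which is at most half of its norm at the base parameter.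
-/
theorem norm_cauchyFactor_bounds {σ : ℝ} (hσ : |σ| = 1) {g₀ m₀ : ℝ} {g m : ℂ}
    (hg : ‖g - g₀‖ < g₀ / 4)
    (hm : ‖m - m₀‖ < g₀ / 4) (z : ℝ) :
    ‖cauchyFactor σ g₀ m₀ z‖ / 2 ≤ ‖cauchyFactor σ g m z‖ ∧
      ‖cauchyFactor σ g m z‖ ≤ 2 * ‖cauchyFactor σ g₀ m₀ z‖ := by
  have hg₀ : 0 < g₀ := by linarith [norm_nonneg (g - g₀)]
  have h1 := norm_cauchyFactor_sub_le hσ g m g₀ m₀ z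
  have h2 := le_norm_cauchyFactor hσ hg₀ m₀ z
  have h3 := norm_sub_norm_le (cauchyFactor σ g₀ m₀ z) (cauchyFactor σ g m z)
  have h4 := norm_sub_norm_le (cauchyFactor σ g m z) (cauchyFactor σ g₀ m₀ z)
  rw [norm_sub_rev] at h3
  constructor <;> linarith

/-- The imaginary part is `σ * g.re - m.im`, where `g.re` exceeds `3 * g₀ / 4` and `|m.im|` is below
`g₀ / 4`; it never vanishes, whatever `z` is. -/
theorem cauchyFactor_mem_slitPlane {σ : ℝ} (hσ : |σ| = 1) {g₀ m₀ : ℝ} {g m : ℂ}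
    (hg : ‖g - g₀‖ < g₀ / 4)
    (hm : ‖m - m₀‖ < g₀ / 4) (z : ℝ) : cauchyFactor σ g m z ∈ Complex.slitPlane := by
  refine Complex.mem_slitPlane_iff.2 (Or.inr ?_)
  have hre := abs_lt.1 ((Complex.abs_re_le_norm _).trans_lt hg)
  have him := abs_lt.1 ((Complex.abs_im_le_norm _).trans_lt hm)
  rw [Complex.sub_re, Complex.ofReal_re] at hre
  rw [Complex.sub_im, Complex.ofReal_im] at him
  have e : (cauchyFactor σ g m z).im = -m.im + σ * g.re := by simp [cauchyFactor]
  rw [e]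
  rcases eq_or_eq_neg_of_abs_eq hσ with h | h <;> subst h
  · have : 0 < -m.im + 1 * g.re := by linarith
    exact this.ne'
  · have : -m.im + -1 * g.re < 0 := by linarith
    exact this.ne

/-- The displacement is independent of `z` and the denominator is at least `g₀` in norm, so
convergence is uniform in `z`. -/
theorem tendsto_cauchyFactor_div {σ : ℝ} (hσ : |σ| = 1) {E : Type*} {F : Filter E}
    {g m : E → ℂ} {g₀ m₀ : ℝ} (hg₀ : 0 < g₀) (hg : Tendsto g F (𝓝 g₀)) (hm : Tendsto m F (𝓝 m₀)) :
    Tendsto (fun p : E × ℝ => cauchyFactor σ (g p.1) (m p.1) p.2 / cauchyFactor σ g₀ m₀ p.2)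
      (F ×ˢ ⊤) (𝓝 1) := by
  rw [tendsto_iff_norm_sub_tendsto_zero]
  have h0 : Tendsto (fun p : E × ℝ => (‖m p.1 - m₀‖ + ‖g p.1 - g₀‖) / g₀) (F ×ˢ ⊤) (𝓝 0) := by
    have := (((tendsto_iff_norm_sub_tendsto_zero.1 hm).add
      (tendsto_iff_norm_sub_tendsto_zero.1 hg)).div_const g₀).comp
      (tendsto_fst (f := F) (g := (⊤ : Filter ℝ)))
    simpa [Function.comp_def] using this
  refine squeeze_zero (fun _ => norm_nonneg _) (fun p => ?_) h0
  have hle := le_norm_cauchyFactor hσ hg₀ m₀ p.2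
  have hne : cauchyFactor σ g₀ m₀ p.2 ≠ 0 := norm_pos_iff.1 (hg₀.trans_le hle)
  rw [div_sub_one hne, norm_div]
  exact div_le_div₀ (by positivity) (norm_cauchyFactor_sub_le hσ _ _ _ _ _) hg₀ hle

/-- The complexified Cauchy density. -/
def cauchyExtension (g m : ℂ) (z : ℝ) : ℂ :=
  g / (Real.pi * (cauchyFactor 1 g m z * cauchyFactor (-1) g m z))

/-- The analytic logarithm of the complexified Cauchy density. -/
def cauchyLog (g m : ℂ) (z : ℝ) : ℂ :=
  Complex.log g - Real.log Real.pi -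
    (Complex.log (cauchyFactor 1 g m z) + Complex.log (cauchyFactor (-1) g m z))

theorem cauchyChannel_eq {l : ℕ} {γ μ : Fin l → ℝ} {j : Fin l} (h : 0 < γ j) (z : ℝ) :
    cauchyChannel γ μ j z = γ j / (Real.pi * ((z - μ j) ^ 2 + γ j ^ 2)) := by
  rw [cauchyChannel, ProbabilityTheory.cauchyPDFReal_def, Real.coe_toNNReal _ h.le,
    div_eq_mul_inv, mul_inv]
  ring

theorem isProbDensity_cauchyChannel {l : ℕ} {γ μ : Fin l → ℝ} {j : Fin l} (h : 0 < γ j) :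
    IsProbDensity (cauchyChannel γ μ j) := by
  have h' : Real.toNNReal (γ j) ≠ 0 := (Real.toNNReal_pos.2 h).ne'
  exact ⟨ProbabilityTheory.measurable_cauchyPDFReal _ _,
    fun z => (ProbabilityTheory.cauchyPDF_pos _ h' z).le,
    ProbabilityTheory.lintegral_cauchyPDF_eq_one _ h'⟩

theorem cauchyChannel_pos {l : ℕ} {γ μ : Fin l → ℝ} {j : Fin l} (h : 0 < γ j) (z : ℝ) :
    0 < cauchyChannel γ μ j z :=
  ProbabilityTheory.cauchyPDF_pos _ (Real.toNNReal_pos.2 h).ne' z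

theorem cauchyExtension_ofReal {l : ℕ} {γ μ : Fin l → ℝ} {j : Fin l} (h : 0 < γ j) (z : ℝ) :
    cauchyExtension (γ j) (μ j) z = cauchyChannel γ μ j z := by
  rw [cauchyChannel_eq h, cauchyExtension, cauchyFactor_mul]
  push_cast
  rfl

theorem log_cauchyChannel {l : ℕ} {γ μ : Fin l → ℝ} {j : Fin l} (h : 0 < γ j) (z : ℝ) :
    Real.log (cauchyChannel γ μ j z) =
      Real.log (γ j) - Real.log Real.pi - Real.log ((z - μ j) ^ 2 + γ j ^ 2) := by
  have : (0 : ℝ) < (z - μ j) ^ 2 + γ j ^ 2 := by positivity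
  rw [cauchyChannel_eq h, Real.log_div h.ne' (mul_pos Real.pi_pos this).ne',
    Real.log_mul Real.pi_ne_zero this.ne']
  ring

/-- At real parameters the two factors are conjugate, so their logarithms add up to the real
logarithm of the denominator. -/
theorem cauchyLog_ofReal {l : ℕ} {γ μ : Fin l → ℝ} {j : Fin l} (h : 0 < γ j) (z : ℝ) :
    cauchyLog (γ j) (μ j) z = Real.log (cauchyChannel γ μ j z) := by
  have hs : cauchyFactor 1 (γ j) (μ j) z ∈ Complex.slitPlane :=
    cauchyFactor_mem_slitPlane abs_one (g₀ := γ j) (m₀ := μ j) (by simpa using h)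
      (by simpa using h) z
  have hc : cauchyFactor (-1) (γ j) (μ j) z =
      (starRingEnd ℂ) (cauchyFactor 1 (γ j) (μ j) z) := by
    simp [cauchyFactor]
  rw [cauchyLog, hc, Complex.log_conj _ (Complex.slitPlane_arg_ne_pi hs), Complex.add_conj,
    Complex.log_re, log_cauchyChannel h, ← norm_cauchyFactor_sq abs_one (γ j) (μ j) z,
    Real.log_pow, ← Complex.ofReal_log h.le]
  push_cast
  ring

/-- Translated and scaled Cauchy denominators are comparable to the standard one. -/
theorem eventually_cauchy_comparable {g : ℝ} (hg : 0 < g) (m : ℝ) :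
    ∀ᶠ k : ℝ in atTop, ∀ z : ℝ, (z - m) ^ 2 + g ^ 2 ≤ k * (1 + z ^ 2) ∧
      1 + z ^ 2 ≤ k * ((z - m) ^ 2 + g ^ 2) := by
  filter_upwards [eventually_ge_atTop (2 + 2 * m ^ 2 + g ^ 2),
    eventually_ge_atTop (2 + (1 + 2 * m ^ 2) / g ^ 2)] with k h1 h2 z
  constructor
  · refine le_trans ?_ (mul_le_mul_of_nonneg_right h1 (by positivity))
    nlinarith [sq_nonneg (z + m), sq_nonneg (z * m), sq_nonneg (z * g)]
  · refine le_trans ?_ (mul_le_mul_of_nonneg_right h2 (by positivity))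
    have e : (1 + 2 * m ^ 2) / g ^ 2 * g ^ 2 = 1 + 2 * m ^ 2 := div_mul_cancel₀ _ (by positivity)
    have e' : 0 ≤ (1 + 2 * m ^ 2) / g ^ 2 * (z - m) ^ 2 := by positivity
    nlinarith [sq_nonneg (z - 2 * m), sq_nonneg g]

/-- The complexified Cauchy density near a real parameter is bounded by a Cauchy tail, also
after multiplication with a logarithm of another one. -/
theorem norm_cauchyExtension_le {g₀ m₀ k M : ℝ} {g m : ℂ} (hg : ‖g - g₀‖ < g₀ / 4)
    (hm : ‖m - m₀‖ < g₀ / 4) (hM : g₀ ≤ M) {z : ℝ}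
    (hk : 1 + z ^ 2 ≤ k * ((z - m₀) ^ 2 + g₀ ^ 2)) :
    ‖cauchyExtension g m z‖ ≤ 8 * M * k * (1 + z ^ 2)⁻¹ := by
  have hg₀ : 0 < g₀ := by linarith [norm_nonneg (g - g₀)]
  have hgn : ‖g‖ ≤ 2 * M := by
    have := norm_sub_norm_le g g₀
    rw [Complex.norm_real, Real.norm_of_nonneg hg₀.le] at this
    linarith
  have h1 := (norm_cauchyFactor_bounds abs_one hg hm z).1
  have h2 := (norm_cauchyFactor_bounds (σ := -1) (by simp) hg hm z).1
  have e1 := norm_cauchyFactor_sq abs_one g₀ m₀ z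
  have e2 := norm_cauchyFactor_sq (σ := -1) (by simp) g₀ m₀ z
  have e3 : ‖cauchyFactor 1 g₀ m₀ z‖ = ‖cauchyFactor (-1) g₀ m₀ z‖ :=
    (pow_left_inj₀ (norm_nonneg _) (norm_nonneg _) two_ne_zero).1 (e1.trans e2.symm)
  have hN : 0 < (z - m₀) ^ 2 + g₀ ^ 2 := by positivity
  have hk0 : 0 < k := pos_of_mul_pos_left
    (lt_of_lt_of_le (by positivity : (0 : ℝ) < 1 + z ^ 2) hk) hN.le
  have hprod : ((z - m₀) ^ 2 + g₀ ^ 2) / 4 ≤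
      ‖cauchyFactor 1 g m z‖ * ‖cauchyFactor (-1) g m z‖ := by
    have := mul_le_mul h1 h2 (by positivity) (norm_nonneg _)
    rw [← e3] at this
    refine le_trans (le_of_eq ?_) this
    rw [← e1]
    ring
  have hprod' : (1 + z ^ 2) / (4 * k) ≤
      ‖cauchyFactor 1 g m z‖ * ‖cauchyFactor (-1) g m z‖ := by
    refine le_trans ?_ hprod
    rw [div_le_div_iff₀ (by positivity) (by norm_num)]
    nlinarith
  have hpi : (1 : ℝ) ≤ Real.pi := by linarith [Real.pi_gt_three]
  rw [cauchyExtension, norm_div, norm_mul, norm_mul, Complex.norm_real,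
    Real.norm_of_nonneg Real.pi_pos.le]
  have hden : (1 + z ^ 2) / (4 * k) ≤
      Real.pi * (‖cauchyFactor 1 g m z‖ * ‖cauchyFactor (-1) g m z‖) :=
    hprod'.trans (le_mul_of_one_le_left (by positivity) hpi)
  refine (div_le_div₀ ((norm_nonneg g).trans hgn) hgn (by positivity) hden).trans_eq ?_
  field_simp
  ring

/-- The squared norm of the factor is comparable to `1 + z ^ 2` with constant `4 * k`, and the
argument adds at most `π`. -/
theorem norm_log_cauchyFactor_le {σ : ℝ} (hσ : |σ| = 1) {g₀ m₀ k : ℝ} {g m : ℂ}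
    (hg : ‖g - g₀‖ < g₀ / 4) (hm : ‖m - m₀‖ < g₀ / 4) {z : ℝ}
    (hk1 : (z - m₀) ^ 2 + g₀ ^ 2 ≤ k * (1 + z ^ 2))
    (hk2 : 1 + z ^ 2 ≤ k * ((z - m₀) ^ 2 + g₀ ^ 2)) :
    ‖Complex.log (cauchyFactor σ g m z)‖ ≤
      |Real.log (4 * k)| + Real.log (1 + z ^ 2) + Real.pi := by
  have hg₀ : 0 < g₀ := by linarith [norm_nonneg (g - g₀)]
  have hb := norm_cauchyFactor_bounds hσ hg hm z
  have e := norm_cauchyFactor_sq hσ g₀ m₀ z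
  have hN : 0 < (z - m₀) ^ 2 + g₀ ^ 2 := by positivity
  have hu : (0 : ℝ) < 1 + z ^ 2 := by positivity
  have hk0 : 0 < k := pos_of_mul_pos_left (hu.trans_le hk2) hN.le
  have hle := le_norm_cauchyFactor hσ hg₀ m₀ z
  have hA : 0 < ‖cauchyFactor σ g m z‖ := by linarith
  have hl := abs_log_sub_log_le (x := ‖cauchyFactor σ g m z‖ ^ 2) (u := 1 + z ^ 2) (c := 4 * k)
    (by positivity) hu
    (by have := pow_le_pow_left₀ hA.le hb.2 2
        rw [mul_pow, e] at this
        linarith)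
    (by have := pow_le_pow_left₀ (by positivity) hb.1 2
        rw [div_pow, e] at this
        nlinarith)
  have hlog0 : 0 ≤ Real.log (1 + z ^ 2) := Real.log_nonneg (by nlinarith [sq_nonneg z])
  rw [Real.log_pow] at hl
  push_cast at hl
  refine (norm_clog_le _).trans (add_le_add ?_ le_rfl)
  have h1 := abs_le.1 (hl.trans (le_abs_self _))
  have h2 := abs_nonneg (Real.log (4 * k))
  exact abs_le.2 ⟨by linarith, by linarith⟩

theorem norm_cauchyLog_le {g₀ m₀ k : ℝ} {g m : ℂ}
    (hg : ‖g - g₀‖ < g₀ / 4) (hm : ‖m - m₀‖ < g₀ / 4) {z : ℝ}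
    (hk1 : (z - m₀) ^ 2 + g₀ ^ 2 ≤ k * (1 + z ^ 2))
    (hk2 : 1 + z ^ 2 ≤ k * ((z - m₀) ^ 2 + g₀ ^ 2)) :
    ‖cauchyLog g m z‖ ≤ (|Real.log g₀| + Real.log 2 + |Real.log Real.pi| +
      2 * |Real.log (4 * k)| + 3 * Real.pi) + 2 * Real.log (1 + z ^ 2) := by
  have hg₀ : 0 < g₀ := by linarith [norm_nonneg (g - g₀)]
  have h1 := norm_log_cauchyFactor_le abs_one hg hm hk1 hk2
  have h2 := norm_log_cauchyFactor_le (σ := -1) (by simp) hg hm hk1 hk2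
  have hgl : ‖Complex.log g‖ ≤ |Real.log g₀| + Real.log 2 + Real.pi := by
    have e1 := norm_sub_norm_le g g₀
    have e2 := norm_sub_norm_le (g₀ : ℂ) g
    rw [norm_sub_rev] at e2
    rw [Complex.norm_real, Real.norm_of_nonneg hg₀.le] at e1 e2
    have := abs_log_sub_log_le (x := ‖g‖) (u := g₀) (c := 2) (by linarith) hg₀ (by linarith)
      (by linarith)
    have h3 := abs_sub_abs_le_abs_sub (Real.log ‖g‖) (Real.log g₀)
    exact (norm_clog_le g).trans (by linarith)
  rw [cauchyLog]
  have e1 := norm_sub_le (Complex.log g - Real.log Real.pi)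
    (Complex.log (cauchyFactor 1 g m z) + Complex.log (cauchyFactor (-1) g m z))
  have e2 := norm_sub_le (Complex.log g) (Real.log Real.pi)
  have e3 := norm_add_le (Complex.log (cauchyFactor 1 g m z))
    (Complex.log (cauchyFactor (-1) g m z))
  rw [Complex.norm_real, Real.norm_eq_abs] at e2
  linarith

theorem tendsto_cauchyExtension_div {E : Type*} {F : Filter E} {g m : E → ℂ} {g₀ m₀ : ℝ}
    (hg₀ : 0 < g₀) (hg : Tendsto g F (𝓝 g₀)) (hm : Tendsto m F (𝓝 m₀)) :
    Tendsto (fun p : E × ℝ => cauchyExtension (g p.1) (m p.1) p.2 / cauchyExtension g₀ m₀ p.2)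
      (F ×ˢ ⊤) (𝓝 1) := by
  have h1 := tendsto_cauchyFactor_div abs_one hg₀ hg hm
  have h2 := tendsto_cauchyFactor_div (σ := -1) (by simp) hg₀ hg hm
  have h3 : Tendsto (fun p : E × ℝ => g p.1 / g₀) (F ×ˢ ⊤) (𝓝 1) := by
    have := (hg.div_const (g₀ : ℂ)).comp (tendsto_fst (f := F) (g := (⊤ : Filter ℝ)))
    rwa [div_self (by exact_mod_cast hg₀.ne')] at this
  have h := h3.div (h1.mul h2) (by simp)
  rw [mul_one, div_one] at h
  refine h.congr fun p => ?_
  have hpi : (Real.pi : ℂ) ≠ 0 := by exact_mod_cast Real.pi_ne_zero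
  simp only [cauchyExtension, Pi.div_apply]
  rw [div_mul_div_comm]
  conv_rhs => rw [div_div_div_comm, mul_div_mul_left _ _ hpi]

theorem measurable_cauchyFactor (σ : ℝ) (g m : ℂ) : Measurable (cauchyFactor σ g m) := by
  unfold cauchyFactor
  fun_prop

/-- The Cauchy channel is regular, in terms of linear coordinates for its parameters. -/
theorem exists_regularChannel_cauchy {l : ℕ} {E : Type*} [NormedAddCommGroup E]
    [NormedSpace ℂ E] (g m : Fin l → E →L[ℂ] ℂ) {γ₀ μ₀ : Fin l → ℝ} (hγ₀ : ∀ i, 0 < γ₀ i)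
    {w₀ : E} (hg₀ : ∀ j, g j w₀ = γ₀ j) (hm₀ : ∀ j, m j w₀ = μ₀ j) (I : Fin l) :
    ∃ Q : RegularChannel l E I w₀, (∀ θ j z, Q.q θ j z = cauchyExtension (g j θ) (m j θ) z) ∧
      ∀ θ z, Q.L θ z = cauchyLog (g I θ) (m I θ) z := by
  obtain ⟨k, hk⟩ := (eventually_all.2 fun j =>
    eventually_cauchy_comparable (hγ₀ j) (μ₀ j)).exists
  obtain ⟨M, hM⟩ := Finite.exists_le γ₀
  obtain ⟨K, hK⟩ := Finite.exists_le fun j => |Real.log (γ₀ j)|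
  have hM0 : 0 < M := (hγ₀ I).trans_le (hM I)
  have hk0 : 0 < k := by
    have h1 := (hk I 0).2
    have h2 : 0 < (0 - μ₀ I) ^ 2 + γ₀ I ^ 2 := by have := hγ₀ I; positivity
    exact pos_of_mul_pos_left (lt_of_lt_of_le (by norm_num) h1) h2.le
  set V : Set E :=
    ⋂ j, {θ | ‖g j θ - γ₀ j‖ < γ₀ j / 4 ∧ ‖m j θ - μ₀ j‖ < γ₀ j / 4} with hV
  have hmemV : ∀ θ, θ ∈ V ↔ ∀ j, ‖g j θ - γ₀ j‖ < γ₀ j / 4 ∧ ‖m j θ - μ₀ j‖ < γ₀ j / 4 :=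
    fun θ => mem_iInter
  have hVo : IsOpen V := isOpen_iInter_of_finite fun j => by
    have h1 : IsOpen {θ : E | ‖g j θ - γ₀ j‖ < γ₀ j / 4} :=
      isOpen_lt (by fun_prop) continuous_const
    have h2 : IsOpen {θ : E | ‖m j θ - μ₀ j‖ < γ₀ j / 4} :=
      isOpen_lt (by fun_prop) continuous_const
    exact h1.inter h2
  have hc : w₀ ∈ V := (hmemV _).2 fun j => by
    have := hγ₀ j
    rw [hg₀, hm₀, sub_self, sub_self, norm_zero]
    constructor <;> linarith
  have hdF : ∀ (σ : ℝ) j z, Differentiable ℂ fun θ : E => cauchyFactor σ (g j θ) (m j θ) z :=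
    fun σ j z => by
      unfold cauchyFactor
      fun_prop
  have hone : |(-1 : ℝ)| = 1 := by simp
  have hslit : ∀ {σ : ℝ}, |σ| = 1 → ∀ θ ∈ V, ∀ j z,
      cauchyFactor σ (g j θ) (m j θ) z ∈ Complex.slitPlane := fun hσ θ hθ j z =>
    cauchyFactor_mem_slitPlane hσ ((hmemV θ).1 hθ j).1 ((hmemV θ).1 hθ j).2 z
  have hslitg : ∀ θ ∈ V, ∀ j, g j θ ∈ Complex.slitPlane := fun θ hθ j => by
    refine Complex.mem_slitPlane_iff.2 (Or.inl ?_)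
    have h := abs_lt.1 ((Complex.abs_re_le_norm _).trans_lt ((hmemV θ).1 hθ j).1)
    rw [Complex.sub_re, Complex.ofReal_re] at h
    linarith [hγ₀ j]
  have hden : ∀ θ ∈ V, ∀ j z, (Real.pi : ℂ) * (cauchyFactor 1 (g j θ) (m j θ) z *
      cauchyFactor (-1) (g j θ) (m j θ) z) ≠ 0 := fun θ hθ j z =>
    mul_ne_zero (by exact_mod_cast Real.pi_ne_zero) (mul_ne_zero
      (Complex.slitPlane_ne_zero (hslit abs_one θ hθ j z))
      (Complex.slitPlane_ne_zero (hslit hone θ hθ j z)))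
  have hqd : ∀ j z, DifferentiableOn ℂ (fun θ : E => cauchyExtension (g j θ) (m j θ) z) V :=
    fun j z => by
      have h1 := (((hdF 1 j z).fun_mul (hdF (-1) j z)).const_mul
        (Real.pi : ℂ)).differentiableOn (s := V)
      simp only [cauchyExtension, div_eq_mul_inv]
      exact (g j).differentiable.differentiableOn.fun_mul (h1.inv fun θ hθ => hden θ hθ j z)
  have hLd : ∀ z, DifferentiableOn ℂ (fun θ : E => cauchyLog (g I θ) (m I θ) z) V :=
    fun z => by
      have h0 := (g I).differentiable.differentiableOn.clog fun θ hθ => hslitg θ hθ I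
      have h1 := (hdF 1 I z).differentiableOn.clog fun θ hθ => hslit abs_one θ hθ I z
      have h2 := (hdF (-1) I z).differentiableOn.clog fun θ hθ => hslit hone θ hθ I z
      exact (h0.sub (differentiableOn_const _)).sub (h1.add h2)
  have hlim : ∀ j, Tendsto (fun p : E × ℝ => (cauchyExtension (g j p.1) (m j p.1) p.2 /
      cauchyExtension (g I p.1) (m I p.1) p.2) /
        (cauchyChannel γ₀ μ₀ j p.2 / cauchyChannel γ₀ μ₀ I p.2 : ℝ)) (𝓝 w₀ ×ˢ ⊤) (𝓝 1) :=
    fun j => by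
      have h1 : ∀ j, Tendsto (g j) (𝓝 w₀) (𝓝 (γ₀ j : ℂ)) := fun j => by
        simpa only [hg₀] using (g j).continuous.tendsto w₀
      have h2 : ∀ j, Tendsto (m j) (𝓝 w₀) (𝓝 (μ₀ j : ℂ)) := fun j => by
        simpa only [hm₀] using (m j).continuous.tendsto w₀
      have h3 := (tendsto_cauchyExtension_div (hγ₀ j) (h1 j) (h2 j)).div
        (tendsto_cauchyExtension_div (hγ₀ I) (h1 I) (h2 I)) one_ne_zero
      rw [div_one] at h3
      refine h3.congr fun p => ?_
      rw [Complex.ofReal_div, ← cauchyExtension_ofReal (hγ₀ j), ← cauchyExtension_ofReal (hγ₀ I)]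
      exact div_div_div_comm _ _ _ _
  have hratio : ∀ j z, |Real.log (cauchyChannel γ₀ μ₀ j z / cauchyChannel γ₀ μ₀ I z)| ≤
      2 * K + 2 * Real.log k := fun j z => by
    have hN : ∀ j, 0 < (z - μ₀ j) ^ 2 + γ₀ j ^ 2 := fun j => by
      have := hγ₀ j
      positivity
    have h := fun j => abs_le.1 (abs_log_sub_log_le (hN j) (by positivity) (hk j z).1 (hk j z).2)
    have hK' := fun j => abs_le.1 (hK j)
    rw [Real.log_div (cauchyChannel_pos (hγ₀ j) z).ne' (cauchyChannel_pos (hγ₀ I) z).ne',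
      log_cauchyChannel (hγ₀ j), log_cauchyChannel (hγ₀ I)]
    have := h j
    have := h I
    have := hK' j
    have := hK' I
    exact abs_le.2 ⟨by linarith, by linarith⟩
  set a : ℝ := K + Real.log 2 + |Real.log Real.pi| + 2 * |Real.log (4 * k)| + 3 * Real.pi
  exact ⟨
    { V := V
      isOpen_V := hVo
      mem_V := hc
      q := fun θ j => cauchyExtension (g j θ) (m j θ)
      L := fun θ => cauchyLog (g I θ) (m I θ)
      G := fun z => 8 * M * k * (1 + z ^ 2)⁻¹
      integrable_G := integrable_inv_one_add_sq.const_mul _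
      H := fun z => 8 * M * k * ((1 + z ^ 2)⁻¹ * (a + 2 * Real.log (1 + z ^ 2)))
      integrable_H := (integrable_inv_mul_log a 2).const_mul _
      q_diff := hqd
      q_meas := fun θ _ j => measurable_const.div (measurable_const.mul
        ((measurable_cauchyFactor _ _ _).mul (measurable_cauchyFactor _ _ _)))
      q_le := fun θ hθ j z => norm_cauchyExtension_le ((hmemV θ).1 hθ j).1
        ((hmemV θ).1 hθ j).2 (hM j) (hk j z).2
      q_ne := fun θ hθ z => div_ne_zero (Complex.slitPlane_ne_zero (hslitg θ hθ I))
        (hden θ hθ I z)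
      L_diff := hLd
      L_meas := fun θ _ => measurable_const.sub
        ((measurable_cauchyFactor _ _ _).clog.add (measurable_cauchyFactor _ _ _).clog)
      qL_le := Eventually.of_forall fun z θ hθ j => by
        have h1 := norm_cauchyExtension_le ((hmemV θ).1 hθ j).1
          ((hmemV θ).1 hθ j).2 (hM j) (hk j z).2
        have h2 := norm_cauchyLog_le ((hmemV θ).1 hθ I).1 ((hmemV θ).1 hθ I).2
          (hk I z).1 (hk I z).2
        have h3 : ‖cauchyLog (g I θ) (m I θ) z‖ ≤ a + 2 * Real.log (1 + z ^ 2) := by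
          have : |Real.log (γ₀ I)| ≤ K := hK I
          linarith
        rw [norm_mul, ← mul_assoc]
        exact mul_le_mul h1 h3 (norm_nonneg _) (by positivity)
      q₀ := cauchyChannel γ₀ μ₀
      q_base := fun j z => by rw [hg₀, hm₀, cauchyExtension_ofReal (hγ₀ j)]
      q₀_pos := fun j => cauchyChannel_pos (hγ₀ j)
      q₀_integral := fun j => ProbabilityTheory.integral_cauchyPDFReal_eq_one _
        (Real.toNNReal_pos.2 (hγ₀ j)).ne'
      C := 2 * K + 2 * Real.log k
      ratio_le := hratio
      ratio_tendsto := hlim }, fun _ _ _ => rfl, fun _ _ => rfl⟩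

/-- The entropy rate of a hidden Markov chain with an additive Cauchy channel is analytic. -/
theorem entropyRateAnalyticAt_cauchyChannel {l : ℕ} {F : Type*} [NormedAddCommGroup F]
    [NormedSpace ℝ F] {P : F → Matrix (Fin l) (Fin l) ℝ} {v : F → Fin l → ℝ} {ε₀ : F}
    (hP : ∀ᶠ ε in 𝓝 ε₀, P ε ∈ Matrix.rowStochastic ℝ (Fin l))
    (hPan : ∀ i j, AnalyticAt ℝ (fun ε => P ε i j) ε₀)
    (hv : ∀ᶠ ε in 𝓝 ε₀, IsStationaryVector (P ε) (v ε))
    (hPpos : ∀ i j, 0 < P ε₀ i j) {γ₀ : EuclideanSpace ℝ (Fin l)} (hγ₀ : ∀ i, 0 < γ₀ i)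
    (μ₀ : EuclideanSpace ℝ (Fin l)) :
    EntropyRateAnalyticAt
      (fun x : F × EuclideanSpace ℝ (Fin l) × EuclideanSpace ℝ (Fin l) => v x.1)
      (fun x => P x.1) (fun x => cauchyChannel x.2.1 x.2.2) (ε₀, γ₀, μ₀) := by
  -- A probability vector cannot be indexed by an empty type. Any `I` will do, since all Cauchy
  -- densities are mutually comparable.
  obtain ⟨I⟩ : Nonempty (Fin l) := by
    by_contra h
    rw [not_nonempty_iff] at h
    have := hv.self_of_nhds.1.2
    simp at this
  let ι := (toComplexCLM l).prodMap (toComplexCLM l)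
  obtain ⟨Q, hQq, hQL⟩ := exists_regularChannel_cauchy
    (fun j => (EuclideanSpace.proj (𝕜 := ℂ) j).comp (ContinuousLinearMap.fst ℂ _ _))
    (fun j => (EuclideanSpace.proj (𝕜 := ℂ) j).comp (ContinuousLinearMap.snd ℂ _ _)) hγ₀
    (w₀ := ι (γ₀, μ₀)) (μ₀ := μ₀)
    (fun _ => rfl) (fun _ => rfl) I
  have key := entropyRateAnalyticAt_of_regularChannel (q := fun θ => cauchyChannel θ.1 θ.2)
    hP hPan hv hPpos ι Q
  refine key ?_
  have hpos : ∀ j, ∀ᶠ θ : EuclideanSpace ℝ (Fin l) × EuclideanSpace ℝ (Fin l) in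
      𝓝 (γ₀, μ₀), 0 < θ.1 j := fun j =>
    (Continuous.continuousAt (by fun_prop)).eventually_const_lt (hγ₀ j)
  filter_upwards [eventually_all.2 hpos] with θ hθ
  refine ⟨fun j => isProbDensity_cauchyChannel (hθ j), fun z =>
    ⟨fun j => ⟨cauchyChannel_pos (hθ j) z, ?_⟩, ?_⟩⟩
  · rw [hQq]
    exact cauchyExtension_ofReal (hθ j) z
  · rw [hQL]
    exact cauchyLog_ofReal (hθ I) z

end HiddenMarkov

end

/-! ### The two assertions: general channels and the Cauchy channel -/

theorem theorem2 {l m₁ : ℕ}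
    -- the Markov chain, analytically parametrized on a bounded domain
    (Ω₁ : Set (EuclideanSpace ℝ (Fin m₁))) (hΩ₁ : HiddenMarkov.IsBoundedDomain Ω₁)
    (P : EuclideanSpace ℝ (Fin m₁) → Matrix (Fin l) (Fin l) ℝ)
    (v : EuclideanSpace ℝ (Fin m₁) → Fin l → ℝ)
    (hP : ∀ ε ∈ Ω₁, P ε ∈ Matrix.rowStochastic ℝ (Fin l))
    (hPan : ∀ i j, AnalyticOnNhd ℝ (fun ε => P ε i j) Ω₁)
    (hv : ∀ ε ∈ Ω₁, HiddenMarkov.IsStationaryVector (P ε) (v ε))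
    (ε₀ : EuclideanSpace ℝ (Fin m₁)) (hε₀ : ε₀ ∈ Ω₁)
    -- Condition (a)
    (ha : ∀ i j, 0 < P ε₀ i j) :
    -- general channels, analytically parametrized on a bounded domain
    (∀ (m₂ : ℕ) (Ω₂ : Set (EuclideanSpace ℝ (Fin m₂))), HiddenMarkov.IsBoundedDomain Ω₂ →
      ∀ q : EuclideanSpace ℝ (Fin m₂) → Fin l → ℝ → ℝ,
      (∀ θ ∈ Ω₂, ∀ y, HiddenMarkov.IsProbDensity (q θ y)) →
      (∀ y z, AnalyticOnNhd ℝ (fun θ => q θ y z) Ω₂) →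
      ∀ θ₀ ∈ Ω₂,
      -- Condition (b)
      (∀ y z, 0 < q θ₀ y z) →
      -- the complex extension of the channel densities, and Conditions (c) and (d)
      ∀ qc : EuclideanSpace ℂ (Fin m₂) → Fin l → ℝ → ℂ,
      HiddenMarkov.ExtendsChannel q qc θ₀ →
      HiddenMarkov.ConditionC qc θ₀ →
      (∃ I : Fin l, HiddenMarkov.ConditionD1 qc θ₀ I ∧ HiddenMarkov.ConditionD2 q qc θ₀ I) →
      -- comparability of the densities at `θ₀`
      (∃ C' > 0, ∃ C'' > 0, ∀ (i j : Fin l) (z : ℝ),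
        C' ≤ |q θ₀ j z / q θ₀ i z| ∧ |q θ₀ j z / q θ₀ i z| ≤ C'') →
      HiddenMarkov.EntropyRateAnalyticAt
        (fun x : EuclideanSpace ℝ (Fin m₁) × EuclideanSpace ℝ (Fin m₂) => v x.1)
        (fun x => P x.1) (fun x => q x.2) (ε₀, θ₀)) ∧
    -- the additive Cauchy channel
    (∀ γ₀ μ₀ : EuclideanSpace ℝ (Fin l), (∀ i, 0 < γ₀ i) →
      HiddenMarkov.EntropyRateAnalyticAt
        (fun x : EuclideanSpace ℝ (Fin m₁) × EuclideanSpace ℝ (Fin l) × EuclideanSpace ℝ (Fin l) =>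
          v x.1)
        (fun x => P x.1) (fun x => HiddenMarkov.cauchyChannel x.2.1 x.2.2) (ε₀, γ₀, μ₀)) := by
  have hnhds : Ω₁ ∈ 𝓝 ε₀ := hΩ₁.1.mem_nhds hε₀
  have hP' : ∀ᶠ ε in 𝓝 ε₀, P ε ∈ Matrix.rowStochastic ℝ (Fin l) := by
    filter_upwards [hnhds] with ε hε using hP ε hε
  have hv' : ∀ᶠ ε in 𝓝 ε₀, HiddenMarkov.IsStationaryVector (P ε) (v ε) := by
    filter_upwards [hnhds] with ε hε using hv ε hε
  have hPan' : ∀ i j, AnalyticAt ℝ (fun ε => P ε i j) ε₀ := fun i j => hPan i j ε₀ hε₀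
  refine ⟨?_, fun γ₀ μ₀ hγ₀ =>
    HiddenMarkov.entropyRateAnalyticAt_cauchyChannel hP' hPan' hv' ha hγ₀ μ₀⟩
  rintro m₂ Ω₂ hΩ₂ q hqd hqan θ₀ hθ₀ hqpos qc hext hC ⟨I, hD1, hD2⟩ ⟨a, ha', b, -, hab⟩
  exact HiddenMarkov.entropyRateAnalyticAt_of_conditions hP' hPan' hv' ha hΩ₂.1 hqd hqan hθ₀
    hqpos hext hC hD1 hD2 ha' hab
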